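/- Let $k$ be a field, let $A$ and $B$ be $k$-algebras, let $M$ be a $B$-$A$-bimodule and $N$ an $A$-$B$-bimodule (with $k$ acting centrally), and let $$\Lambda=\begin{pmatrix}A&N\\M&B\end{pmatrix}$$ be the corresponding null-square algebra: the product is matrix multiplication, using the products of $A$ and $B$ and the bimodule structures, with $mn=0$ and $nm=0$ for all $m\in M$, $n\in N$. Let $C=A\times B\subset\Lambda$ be the subalgebra of diagonal matrices and let $$K^1_C(\Lambda)=\operatorname{Ker}\bigl(\Lambda\otimes_C\Lambda\longrightarrow\Lambda\bigr)$$ be the kernel of the product map, a $\Lambda$-bimodule. For a $B$-bimodule $Z$ put $H_0(B,Z)=Z/\langle bz-zb\mid b\in B,\ z\in Z\rangle$. For $n\ge 1$ let the cyclic group $C_n=\langle t\mid t^n=1\rangle$ act on $H_0\bigl(B,(M\otimes_AN)^{\otimes_B n}\bigr)$ by $$t\,(x_n\otimes y_n\otimes\cdots\otimes x_2\otimes y_2\otimes x_1\otimes y_1)=x_1\otimes y_1\otimes x_n\otimes y_n\otimes\cdots\otimes x_2\otimes y_2\qquad(x_i\in M,\ y_i\in N).$$ Theorem. Assume that $M$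 is a projective $B$-$A$-bimodule and that $N$ is a projective $A$-$B$-bimodule. Then for every integer $m\ge 0$ there are isomorphisms of $k$-vector spaces $$\operatorname{Tor}^{\Lambda\text{-}\Lambda}_{2m+1}\bigl(K^1_C(\Lambda),\Lambda\bigr)\;\cong\;H_0\bigl(B,(M\otimes_AN)^{\otimes_B (m+1)}\bigr)^{C_{m+1}},$$ $$\operatorname{Tor}^{\Lambda\text{-}\Lambda}_{2m}\bigl(K^1_C(\Lambda),\Lambda\bigr)\;\cong\;H_0\bigl(B,(M\otimes_AN)^{\otimes_B (m+1)}\bigr)_{C_{m+1}},$$ where $\operatorname{Tor}^{\Lambda\text{-}\Lambda}_n(-,\Lambda)$ is the $n$-th left derived functor of $-\otimes_{\Lambda\otimes\Lambda^{\mathrm{op}}}\Lambda$ on $\Lambda$-bimodules, the superscript denotes invariants $\{h\mid sh=h\text{ for all }s\in C_{m+1}\}$, and the subscript denotes coinvariants, that is, the quotient by the subspace spanned by all $sh-h$. -/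

import Mathlib

open scoped TensorProduct
open CategoryTheory

universe u

set_option linter.unusedSectionVars false

noncomputable section

namespace NullSq

/-! ### Null-square algebras -/

/-- The matrices `(a n; m b)` with `a ∈ A`, `n ∈ N`, `m ∈ M`, `b ∈ B`, where `N` is an
`A`-`B`-bimodule and `M` is a `B`-`A`-bimodule. -/
@[ext]
structure NullSquare (A B M N : Type*) where
  a : A
  n : N
  m : M
  b : B

namespace NullSquare

section Ring

variable {A B M N : Type*} [Ring A] [Ring B] [AddCommGroup M] [AddCommGroup N]

instance : Zero (NullSquare A B M N) := ⟨⟨0, 0, 0, 0⟩⟩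
instance : Add (NullSquare A B M N) :=
  ⟨fun x y => ⟨x.a + y.a, x.n + y.n, x.m + y.m, x.b + y.b⟩⟩
instance : Neg (NullSquare A B M N) := ⟨fun x => ⟨-x.a, -x.n, -x.m, -x.b⟩⟩
instance : One (NullSquare A B M N) := ⟨⟨1, 0, 0, 1⟩⟩

@[simp] theorem zero_a : (0 : NullSquare A B M N).a = 0 := rfl
@[simp] theorem zero_n : (0 : NullSquare A B M N).n = 0 := rfl
@[simp] theorem zero_m : (0 : NullSquare A B M N).m = 0 := rfl
@[simp] theorem zero_b : (0 : NullSquare A B M N).b = 0 := rfl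
@[simp] theorem one_a : (1 : NullSquare A B M N).a = 1 := rfl
@[simp] theorem one_n : (1 : NullSquare A B M N).n = 0 := rfl
@[simp] theorem one_m : (1 : NullSquare A B M N).m = 0 := rfl
@[simp] theorem one_b : (1 : NullSquare A B M N).b = 1 := rfl
@[simp] theorem add_a (x y : NullSquare A B M N) : (x + y).a = x.a + y.a := rfl
@[simp] theorem add_n (x y : NullSquare A B M N) : (x + y).n = x.n + y.n := rfl
@[simp] theorem add_m (x y : NullSquare A B M N) : (x + y).m = x.m + y.m := rfl
@[simp] theorem add_b (x y : NullSquare A B M N) : (x + y).b = x.b + y.b := rfl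
@[simp] theorem neg_a (x : NullSquare A B M N) : (-x).a = -x.a := rfl
@[simp] theorem neg_n (x : NullSquare A B M N) : (-x).n = -x.n := rfl
@[simp] theorem neg_m (x : NullSquare A B M N) : (-x).m = -x.m := rfl
@[simp] theorem neg_b (x : NullSquare A B M N) : (-x).b = -x.b := rfl

instance : AddCommGroup (NullSquare A B M N) where
  add_assoc x y z := by ext <;> simp [add_assoc]
  zero_add x := by ext <;> simp
  add_zero x := by ext <;> simp
  add_comm x y := by ext <;> simp [add_comm]
  neg_add_cancel x := by ext <;> simp
  nsmul := nsmulRec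
  zsmul := zsmulRec

variable [Module B M] [Module Aᵐᵒᵖ M] [Module A N] [Module Bᵐᵒᵖ N]

/-- Matrix multiplication in which the products `m n'` and `n m'` are zero. -/
instance : Mul (NullSquare A B M N) :=
  ⟨fun x y =>
    ⟨x.a * y.a,
     x.a • y.n + MulOpposite.op y.b • x.n,
     MulOpposite.op y.a • x.m + x.b • y.m,
     x.b * y.b⟩⟩

@[simp] theorem mul_a (x y : NullSquare A B M N) : (x * y).a = x.a * y.a := rfl
@[simp] theorem mul_n (x y : NullSquare A B M N) :
    (x * y).n = x.a • y.n + MulOpposite.op y.b • x.n := rfl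
@[simp] theorem mul_m (x y : NullSquare A B M N) :
    (x * y).m = MulOpposite.op y.a • x.m + x.b • y.m := rfl
@[simp] theorem mul_b (x y : NullSquare A B M N) : (x * y).b = x.b * y.b := rfl

instance [SMulCommClass B Aᵐᵒᵖ M] [SMulCommClass A Bᵐᵒᵖ N] : Ring (NullSquare A B M N) where
  __ := (inferInstance : AddCommGroup (NullSquare A B M N))
  left_distrib x y z := by ext <;> simp [mul_add, add_smul] <;> abel
  right_distrib x y z := by ext <;> simp [add_mul, add_smul] <;> abel
  zero_mul x := by ext <;> simp
  mul_zero x := by ext <;> simp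
  mul_assoc x y z := by
    ext
    · simp [mul_assoc]
    · simp [mul_smul, smul_comm, add_assoc]
    · simp [mul_smul, smul_comm, add_assoc]
    · simp [mul_assoc]
  one_mul x := by ext <;> simp
  mul_one x := by ext <;> simp

end Ring

section Algebra

variable {k A B M N : Type*} [Field k] [Ring A] [Algebra k A] [Ring B] [Algebra k B]
  [AddCommGroup M] [Module k M] [AddCommGroup N] [Module k N]

instance : SMul k (NullSquare A B M N) :=
  ⟨fun r x => ⟨r • x.a, r • x.n, r • x.m, r • x.b⟩⟩

@[simp] theorem smul_a (r : k) (x : NullSquare A B M N) : (r • x).a = r • x.a := rfl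
@[simp] theorem smul_n (r : k) (x : NullSquare A B M N) : (r • x).n = r • x.n := rfl
@[simp] theorem smul_m (r : k) (x : NullSquare A B M N) : (r • x).m = r • x.m := rfl
@[simp] theorem smul_b (r : k) (x : NullSquare A B M N) : (r • x).b = r • x.b := rfl

instance : Module k (NullSquare A B M N) where
  one_smul x := by ext <;> simp
  mul_smul r s x := by ext <;> simp [mul_smul]
  smul_zero r := by ext <;> simp
  smul_add r x y := by ext <;> simp
  add_smul r s x := by ext <;> simp [add_smul]
  zero_smul x := by ext <;> simp

variable [Module B M] [Module Aᵐᵒᵖ M] [Module A N] [Module Bᵐᵒᵖ N]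
  [IsScalarTower k B M] [IsScalarTower k Aᵐᵒᵖ M] [SMulCommClass B Aᵐᵒᵖ M]
  [IsScalarTower k A N] [IsScalarTower k Bᵐᵒᵖ N] [SMulCommClass A Bᵐᵒᵖ N]

instance : Algebra k (NullSquare A B M N) :=
  Algebra.ofModule
    (fun r x y => by
      ext
      · simp
      · simp [smul_comm r]
      · simp [smul_comm r]
      · simp)
    (fun r x y => by
      ext
      · simp
      · simp [smul_comm r]
      · simp [smul_comm r]
      · simp)

variable (k A B M N) in
/-- The subalgebra `C = A × B` of diagonal matrices. -/
def diag : Subalgebra k (NullSquare A B M N) where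
  carrier := {x | x.n = 0 ∧ x.m = 0}
  mul_mem' := by
    rintro x y ⟨h1, h2⟩ ⟨h3, h4⟩
    simp [h1, h2, h3, h4]
  add_mem' := by
    rintro x y ⟨h1, h2⟩ ⟨h3, h4⟩
    simp [h1, h2, h3, h4]
  algebraMap_mem' r := by
    rw [Algebra.algebraMap_eq_smul_one]
    simp

end Algebra

end NullSquare

/-! ### Bimodules over `k`-algebras

An `S`-`T`-bimodule over `k` is a `k`-module `X` with commuting actions of `S` and of `Tᵐᵒᵖ`
(so `x t` is `MulOpposite.op t • x`), both compatible with the action of `k`. -/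

section Bimodule

variable (k S T X : Type*) [Field k] [Ring S] [Algebra k S] [Ring T] [Algebra k T]
  [AddCommGroup X] [Module k X] [Module S X] [Module Tᵐᵒᵖ X]
  [IsScalarTower k S X] [IsScalarTower k Tᵐᵒᵖ X] [SMulCommClass S Tᵐᵒᵖ X]

/-- An `S`-`T`-bimodule `X` as a left module over `S ⊗ Tᵐᵒᵖ`, with `(s ⊗ t) x = s x t`. -/
def toBimod : ModuleCat (S ⊗[k] Tᵐᵒᵖ) :=
  letI : Module (S ⊗[k] Tᵐᵒᵖ) X := TensorProduct.Algebra.module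
  ModuleCat.of (S ⊗[k] Tᵐᵒᵖ) X

variable {k S T X} in
/-- A `k`-linear map that commutes with both actions, as a map of `S ⊗ Tᵐᵒᵖ`-modules. -/
def toBimodMap {X' : Type*} [AddCommGroup X'] [Module k X'] [Module S X'] [Module Tᵐᵒᵖ X']
    [IsScalarTower k S X'] [IsScalarTower k Tᵐᵒᵖ X'] [SMulCommClass S Tᵐᵒᵖ X']
    (f : X →ₗ[k] X') (hS : ∀ (s : S) x, f (s • x) = s • f x)
    (hT : ∀ (t : Tᵐᵒᵖ) x, f (t • x) = t • f x) :
    toBimod k S T X →ₗ[S ⊗[k] Tᵐᵒᵖ] toBimod k S T X' :=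
  letI : Module (S ⊗[k] Tᵐᵒᵖ) X := TensorProduct.Algebra.module
  letI : Module (S ⊗[k] Tᵐᵒᵖ) X' := TensorProduct.Algebra.module
  let g : X →ₗ[S ⊗[k] Tᵐᵒᵖ] X' :=
    { toFun := f
      map_add' := map_add f
      map_smul' := fun e x => by
        induction e using TensorProduct.induction_on with
        | zero =>
          exact (congrArg f (zero_smul (S ⊗[k] Tᵐᵒᵖ) x)).trans
            ((map_zero f).trans (zero_smul (S ⊗[k] Tᵐᵒᵖ) (f x)).symm)
        | add e e' he he' =>
          simp only [RingHom.id_apply] at he he' ⊢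
          rw [add_smul, map_add, he, he', add_smul]
        | tmul s t =>
          rw [RingHom.id_apply, TensorProduct.Algebra.smul_def, TensorProduct.Algebra.smul_def,
            hS, hT] }
  g

/-- `X` is a projective `S`-`T`-bimodule. -/
def IsProjectiveBimodule : Prop :=
  Module.Projective (S ⊗[k] Tᵐᵒᵖ) (toBimod k S T X)

end Bimodule

/-! ### Tensor product over a `k`-algebra -/

section BimodTensor

variable (k S R T X Y : Type*) [Field k] [Ring S] [Algebra k S] [Ring R] [Algebra k R]
  [Ring T] [Algebra k T]
  [AddCommGroup X] [Module k X] [Module S X] [Module Rᵐᵒᵖ X]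
  [AddCommGroup Y] [Module k Y] [Module R Y] [Module Tᵐᵒᵖ Y]

/-- The relations `x r ⊗ y = x ⊗ r y`. -/
def middleRel : Submodule k (X ⊗[k] Y) :=
  Submodule.span k {z | ∃ (x : X) (r : R) (y : Y),
    z = (MulOpposite.op r • x) ⊗ₜ[k] y - x ⊗ₜ[k] (r • y)}

/-- The tensor product `X ⊗_R Y` of an `S`-`R`-bimodule `X` and an `R`-`T`-bimodule `Y`; it is an
`S`-`T`-bimodule by the instances below. -/
def BimodTensor (k S R T X Y : Type*) [Field k] [Ring S] [Algebra k S] [Ring R] [Algebra k R]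
    [Ring T] [Algebra k T]
    [AddCommGroup X] [Module k X] [Module S X] [Module Rᵐᵒᵖ X]
    [AddCommGroup Y] [Module k Y] [Module R Y] [Module Tᵐᵒᵖ Y] : Type _ :=
  (X ⊗[k] Y) ⧸ middleRel k R X Y

namespace BimodTensor

instance : AddCommGroup (BimodTensor k S R T X Y) :=
  inferInstanceAs (AddCommGroup ((X ⊗[k] Y) ⧸ middleRel k R X Y))

instance : Module k (BimodTensor k S R T X Y) :=
  inferInstanceAs (Module k ((X ⊗[k] Y) ⧸ middleRel k R X Y))

/-- The projection `X ⊗_k Y → X ⊗_R Y`. -/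
def mk : X ⊗[k] Y →ₗ[k] BimodTensor k S R T X Y := (middleRel k R X Y).mkQ

variable {X Y}

/-- The class of `x ⊗ y` in `X ⊗_R Y`. -/
def tmul (x : X) (y : Y) : BimodTensor k S R T X Y := mk k S R T X Y (x ⊗ₜ[k] y)

theorem tmul_smul (x : X) (r : R) (y : Y) :
    tmul k S R T (MulOpposite.op r • x) y = tmul k S R T x (r • y) := by
  rw [← sub_eq_zero, tmul, tmul, ← map_sub]
  exact (Submodule.Quotient.mk_eq_zero _).2 (Submodule.subset_span ⟨x, r, y, rfl⟩)

variable {k S R T} in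
theorem hom_ext {Z : Type*} [AddCommGroup Z] [Module k Z]
    {f g : BimodTensor k S R T X Y →ₗ[k] Z}
    (h : ∀ x y, f (tmul k S R T x y) = g (tmul k S R T x y)) : f = g :=
  Submodule.linearMap_qext _ (TensorProduct.ext' h)

/-- The linear map out of `X ⊗_R Y` given by an `R`-balanced bilinear map. -/
def lift {Z : Type*} [AddCommGroup Z] [Module k Z] (f : X →ₗ[k] Y →ₗ[k] Z)
    (h : ∀ x (r : R) y, f (MulOpposite.op r • x) y = f x (r • y)) :
    BimodTensor k S R T X Y →ₗ[k] Z :=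
  (middleRel k R X Y).liftQ (TensorProduct.lift f) (Submodule.span_le.2 (by
    rintro _ ⟨x, r, y, rfl⟩
    simp [h]))

@[simp] theorem lift_tmul {Z : Type*} [AddCommGroup Z] [Module k Z] (f : X →ₗ[k] Y →ₗ[k] Z)
    (h : ∀ x (r : R) y, f (MulOpposite.op r • x) y = f x (r • y)) (x : X) (y : Y) :
    lift k S R T f h (tmul k S R T x y) = f x y := rfl

/-- The bilinear map `(x, y) ↦ x ⊗ y`. -/
def tmulₗ : X →ₗ[k] Y →ₗ[k] BimodTensor k S R T X Y :=
  (TensorProduct.mk k X Y).compr₂ (mk k S R T X Y)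

@[simp] theorem tmulₗ_apply (x : X) (y : Y) : tmulₗ k S R T x y = tmul k S R T x y := rfl

variable (X Y)

section Left

variable [IsScalarTower k S X] [SMulCommClass S Rᵐᵒᵖ X]

/-- The left action `s (x ⊗ y) = s x ⊗ y`. -/
def leftAct : S →ₐ[k] Module.End k (BimodTensor k S R T X Y) :=
  AlgHom.ofLinearMap
    { toFun := fun s => lift k S R T ((tmulₗ k S R T).comp (Algebra.lsmul k k X s))
        (fun x r y => by
          simp only [LinearMap.comp_apply, Algebra.lsmul_coe, tmulₗ_apply]
          rw [smul_comm, tmul_smul])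
      map_add' := fun s s' => hom_ext fun x y => by
        rw [LinearMap.add_apply]
        simp only [lift_tmul]
        simp
      map_smul' := fun c s => hom_ext fun x y => by
        rw [LinearMap.smul_apply]
        simp only [lift_tmul]
        simp }
    (hom_ext fun x y => by simp)
    (fun s s' => hom_ext fun x y => by simp)

instance : Module S (BimodTensor k S R T X Y) :=
  Module.compHom _ (leftAct k S R T X Y).toRingHom

theorem left_smul_def (s : S) (z : BimodTensor k S R T X Y) :
    s • z = leftAct k S R T X Y s z := rfl

variable {X Y} in
@[simp] theorem left_smul_tmul (s : S) (x : X) (y : Y) :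
    s • tmul k S R T x y = tmul k S R T (s • x) y := rfl

instance : IsScalarTower k S (BimodTensor k S R T X Y) :=
  ⟨fun c s z => by rw [left_smul_def, left_smul_def, map_smul]; rfl⟩

end Left

section Right

variable [IsScalarTower k Tᵐᵒᵖ Y] [SMulCommClass R Tᵐᵒᵖ Y]

/-- The right action `(x ⊗ y) t = x ⊗ y t`. -/
def rightAct : Tᵐᵒᵖ →ₐ[k] Module.End k (BimodTensor k S R T X Y) :=
  AlgHom.ofLinearMap
    { toFun := fun t => lift k S R T ((tmulₗ k S R T).compl₂ (Algebra.lsmul k k Y t))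
        (fun x r y => by
          simp only [LinearMap.compl₂_apply, Algebra.lsmul_coe, tmulₗ_apply]
          rw [tmul_smul, smul_comm])
      map_add' := fun s s' => hom_ext fun x y => by
        rw [LinearMap.add_apply]
        simp only [lift_tmul, map_add, LinearMap.compl₂_apply, LinearMap.add_apply]
      map_smul' := fun c s => hom_ext fun x y => by
        rw [LinearMap.smul_apply]
        simp only [lift_tmul]
        simp }
    (hom_ext fun x y => by simp)
    (fun s s' => hom_ext fun x y => by simp)

instance : Module Tᵐᵒᵖ (BimodTensor k S R T X Y) :=
  Module.compHom _ (rightAct k S R T X Y).toRingHom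

theorem right_smul_def (t : Tᵐᵒᵖ) (z : BimodTensor k S R T X Y) :
    t • z = rightAct k S R T X Y t z := rfl

variable {X Y} in
@[simp] theorem right_smul_tmul (t : Tᵐᵒᵖ) (x : X) (y : Y) :
    t • tmul k S R T x y = tmul k S R T x (t • y) := rfl

instance : IsScalarTower k Tᵐᵒᵖ (BimodTensor k S R T X Y) :=
  ⟨fun c s z => by rw [right_smul_def, right_smul_def, map_smul]; rfl⟩

end Right

instance [IsScalarTower k S X] [SMulCommClass S Rᵐᵒᵖ X]
    [IsScalarTower k Tᵐᵒᵖ Y] [SMulCommClass R Tᵐᵒᵖ Y] :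
    SMulCommClass S Tᵐᵒᵖ (BimodTensor k S R T X Y) :=
  ⟨fun s t z => by
    have h : (leftAct k S R T X Y s) ∘ₗ (rightAct k S R T X Y t) =
        (rightAct k S R T X Y t) ∘ₗ (leftAct k S R T X Y s) := hom_ext fun x y => rfl
    exact LinearMap.congr_fun h z⟩

end BimodTensor

end BimodTensor

/-! ### The kernel of the product map `Λ ⊗_C Λ → Λ` -/

section Kernel

variable (k : Type*) {L : Type*} [Field k] [Ring L] [Algebra k L] (C : Subalgebra k L)

/-- The right action of a subalgebra by multiplication. -/
instance rightModule : Module (C)ᵐᵒᵖ L := Module.compHom L (C.val.toRingHom.op)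

theorem op_smul_eq (c : C) (x : L) : MulOpposite.op c • x = x * (c : L) := rfl

instance : SMulCommClass L (C)ᵐᵒᵖ L :=
  ⟨fun s c x => by
    rw [← MulOpposite.op_unop c, op_smul_eq, op_smul_eq, smul_eq_mul, smul_eq_mul, mul_assoc]⟩

instance : SMulCommClass C Lᵐᵒᵖ L :=
  ⟨fun c s x => by
    simp [Subalgebra.smul_def, mul_assoc]⟩

/-- `Λ ⊗_C Λ` as a `Λ`-bimodule. -/
abbrev RelTensor : Type _ := BimodTensor k L C L L L

/-- The product map `Λ ⊗_C Λ → Λ` as a linear map. -/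
def mulMap : RelTensor k C →ₗ[k] L :=
  BimodTensor.lift k L C L (LinearMap.mul k L) (fun x c y => by
    simp [op_smul_eq, Subalgebra.smul_def, mul_assoc])

/-- The product map `Λ ⊗_C Λ → Λ` as a map of `Λ`-bimodules. -/
def mulBimodMap : toBimod k L L (RelTensor k C) →ₗ[L ⊗[k] Lᵐᵒᵖ] toBimod k L L L :=
  toBimodMap (mulMap k C)
    (fun s z => LinearMap.congr_fun
      (f := mulMap k C ∘ₗ BimodTensor.leftAct k L C L L L s)
      (g := Algebra.lsmul k k L s ∘ₗ mulMap k C)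
      (BimodTensor.hom_ext fun x y => mul_assoc s x y) z)
    (fun t z => LinearMap.congr_fun
      (f := mulMap k C ∘ₗ BimodTensor.rightAct k L C L L L t)
      (g := Algebra.lsmul k k L t ∘ₗ mulMap k C)
      (BimodTensor.hom_ext fun x y => (mul_assoc x y t.unop).symm) z)

/-- The `Λ`-bimodule `K¹_C(Λ) = Ker (Λ ⊗_C Λ → Λ)`. -/
def K1 : ModuleCat (L ⊗[k] Lᵐᵒᵖ) :=
  ModuleCat.of (L ⊗[k] Lᵐᵒᵖ) (LinearMap.ker (mulBimodMap k C))

end Kernel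

/-! ### `Tor` of bimodules -/

section Tor

open ModuleCat

variable (k L : Type u) [Field k] [Ring L] [Algebra k L]

/-- The relations `l' x l ⊗ y = x ⊗ l y l'` defining `X ⊗_{Λ-Λ} Y`. -/
def bimodRel (X Y : ModuleCat.{u} (L ⊗[k] Lᵐᵒᵖ)) : Submodule k (X ⊗[k] Y) :=
  Submodule.span k {z | ∃ (l l' : L) (x : X) (y : Y),
    z = ((l' ⊗ₜ[k] MulOpposite.op l : L ⊗[k] Lᵐᵒᵖ) • x) ⊗ₜ[k] y -
      x ⊗ₜ[k] ((l ⊗ₜ[k] MulOpposite.op l' : L ⊗[k] Lᵐᵒᵖ) • y)}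

/-- The functor `X ↦ X ⊗_{Λ-Λ} Y` from `Λ`-bimodules to vector spaces. -/
def tensorFunctor (Y : ModuleCat.{u} (L ⊗[k] Lᵐᵒᵖ)) :
    ModuleCat.{u} (L ⊗[k] Lᵐᵒᵖ) ⥤ ModuleCat.{u} k where
  obj X := ModuleCat.of k ((X ⊗[k] Y) ⧸ bimodRel k L X Y)
  map {X X'} f := ModuleCat.ofHom <|
    (bimodRel k L X Y).mapQ (bimodRel k L X' Y) ((f.hom.restrictScalars k).rTensor Y)
      (Submodule.span_le.2 (by
        rintro _ ⟨l, l', x, y, rfl⟩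
        refine Submodule.subset_span ⟨l, l', f.hom x, y, ?_⟩
        simp))
  map_id X := by
    ext : 1
    exact Submodule.linearMap_qext _ (TensorProduct.ext' fun x y => rfl)
  map_comp f g := by
    ext : 1
    exact Submodule.linearMap_qext _ (TensorProduct.ext' fun x y => rfl)

instance (Y : ModuleCat.{u} (L ⊗[k] Lᵐᵒᵖ)) : (tensorFunctor k L Y).Additive where
  map_add {X X' f g} := by
    ext : 1
    refine Submodule.linearMap_qext _ (TensorProduct.ext' fun x y => ?_)
    change Submodule.Quotient.mk ((f.hom x + g.hom x) ⊗ₜ[k] y) = _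
    rw [TensorProduct.add_tmul]
    rfl

/-- `Tor_n^{Λ-Λ}(X, Y)`: the `n`-th left derived functor of `- ⊗_{Λ-Λ} Y`, at `X`. -/
def bimodTor (n : ℕ) (X Y : ModuleCat.{u} (L ⊗[k] Lᵐᵒᵖ)) : ModuleCat.{u} k :=
  ((tensorFunctor k L Y).leftDerived n).obj X

end Tor

/-! ### Tensor powers of a bimodule and their zeroth Hochschild homology -/

section HochschildZero

variable (k B Z : Type*) [Field k] [Ring B] [AddCommGroup Z] [Module k Z]
  [Module B Z] [Module Bᵐᵒᵖ Z]

/-- `⟨b z - z b⟩`. -/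
def commutatorSpan : Submodule k Z :=
  Submodule.span k {w | ∃ (b : B) (z : Z), w = b • z - MulOpposite.op b • z}

/-- `H_0(B, Z) = Z / ⟨b z - z b⟩` for a `B`-bimodule `Z`. -/
abbrev HochschildZero : Type _ := Z ⧸ commutatorSpan k B Z

end HochschildZero

section TensorPower

variable (k B X : Type*) [Field k] [Ring B]
  [AddCommGroup X] [Module k X] [Module B X] [Module Bᵐᵒᵖ X] (m : ℕ)

/-- The relations `⋯ ⊗ xᵢ b ⊗ xᵢ₊₁ ⊗ ⋯ = ⋯ ⊗ xᵢ ⊗ b xᵢ₊₁ ⊗ ⋯` between adjacent factors of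
`x₀ ⊗ ⋯ ⊗ xₘ`. -/
def powRel : Submodule k (⨂[k] _ : Fin (m + 1), X) :=
  Submodule.span k {z | ∃ (i : Fin m) (b : B) (x : Fin (m + 1) → X),
    z = PiTensorProduct.tprod k
          (Function.update x i.castSucc (MulOpposite.op b • x i.castSucc)) -
        PiTensorProduct.tprod k (Function.update x i.succ (b • x i.succ))}

/-- The tensor power `X^{⊗_B (m+1)} = X ⊗_B ⋯ ⊗_B X` (with `m + 1` factors) of a `B`-bimodule. -/
def BimodPow : Type _ := (⨂[k] _ : Fin (m + 1), X) ⧸ powRel k B X m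

namespace BimodPow

instance : AddCommGroup (BimodPow k B X m) :=
  inferInstanceAs (AddCommGroup ((⨂[k] _ : Fin (m + 1), X) ⧸ powRel k B X m))

instance : Module k (BimodPow k B X m) :=
  inferInstanceAs (Module k ((⨂[k] _ : Fin (m + 1), X) ⧸ powRel k B X m))

variable {X m}

/-- The class of `x₀ ⊗ ⋯ ⊗ xₘ`. -/
def tprod : MultilinearMap k (fun _ : Fin (m + 1) => X) (BimodPow k B X m) :=
  (powRel k B X m).mkQ.compMultilinearMap (PiTensorProduct.tprod k)

theorem tprod_rel (i : Fin m) (b : B) (x : Fin (m + 1) → X) :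
    tprod k B (Function.update x i.castSucc (MulOpposite.op b • x i.castSucc)) =
      tprod k B (Function.update x i.succ (b • x i.succ)) := by
  rw [← sub_eq_zero]
  exact (Submodule.Quotient.mk_eq_zero (powRel k B X m)).2 (Submodule.subset_span ⟨i, b, x, rfl⟩)

variable {k B} in
theorem hom_ext {Z : Type*} [AddCommGroup Z] [Module k Z] {f g : BimodPow k B X m →ₗ[k] Z}
    (h : ∀ x, f (tprod k B x) = g (tprod k B x)) : f = g :=
  Submodule.linearMap_qext _ (PiTensorProduct.ext (MultilinearMap.ext h))

/-- The linear map out of the tensor power given by a `B`-balanced multilinear map. -/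
def lift {Z : Type*} [AddCommGroup Z] [Module k Z]
    (f : MultilinearMap k (fun _ : Fin (m + 1) => X) Z)
    (h : ∀ (i : Fin m) (b : B) (x : Fin (m + 1) → X),
      f (Function.update x i.castSucc (MulOpposite.op b • x i.castSucc)) =
        f (Function.update x i.succ (b • x i.succ))) : BimodPow k B X m →ₗ[k] Z :=
  (powRel k B X m).liftQ (PiTensorProduct.lift f) (Submodule.span_le.2 (by
    rintro _ ⟨i, b, x, rfl⟩
    simp [h]))

@[simp] theorem lift_tprod {Z : Type*} [AddCommGroup Z] [Module k Z]
    (f : MultilinearMap k (fun _ : Fin (m + 1) => X) Z)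
    (h : ∀ (i : Fin m) (b : B) (x : Fin (m + 1) → X),
      f (Function.update x i.castSucc (MulOpposite.op b • x i.castSucc)) =
        f (Function.update x i.succ (b • x i.succ))) (x : Fin (m + 1) → X) :
    lift k B f h (tprod k B x) = f x := by
  change PiTensorProduct.lift f (PiTensorProduct.tprod k x) = f x
  simp

variable {k} in
/-- Apply an endomorphism to the factor with index `j`. -/
def actAt (j : Fin (m + 1)) (φ : Module.End k X) :
    MultilinearMap k (fun _ : Fin (m + 1) => X) (BimodPow k B X m) :=
  (tprod k B).compLinearMap (Function.update (fun _ => LinearMap.id) j φ)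

theorem actAt_apply (j : Fin (m + 1)) (φ : Module.End k X) (x : Fin (m + 1) → X) :
    actAt B j φ x = tprod k B (Function.update x j (φ (x j))) := by
  simp only [actAt, MultilinearMap.compLinearMap_apply]
  congr 1
  funext i
  by_cases h : i = j
  · subst h; simp
  · simp [h]

/-- Commuting endomorphisms of factors can be applied in either order. -/
theorem update_update (φ ψ : X → X) (i j : Fin (m + 1)) (x : Fin (m + 1) → X)
    (h : i = j → ∀ y, φ (ψ y) = ψ (φ y)) :
    Function.update (Function.update x i (ψ (x i))) j
        (φ (Function.update x i (ψ (x i)) j)) =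
      Function.update (Function.update x j (φ (x j))) i
        (ψ (Function.update x j (φ (x j)) i)) := by
  by_cases hij : i = j
  · subst hij
    simp [h rfl]
  · rw [Function.update_of_ne (Ne.symm hij), Function.update_of_ne hij,
      Function.update_comm hij]

variable [Algebra k B] [IsScalarTower k B X] [IsScalarTower k Bᵐᵒᵖ X] [SMulCommClass B Bᵐᵒᵖ X]

variable (X m)

/-- The left action `b (x₀ ⊗ ⋯ ⊗ xₘ) = b x₀ ⊗ ⋯ ⊗ xₘ`. -/
def leftAct : B →ₐ[k] Module.End k (BimodPow k B X m) :=
  AlgHom.ofLinearMap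
    { toFun := fun b => lift k B (actAt B 0 (Algebra.lsmul k k X b)) (fun i c x => by
        simp only [actAt_apply, Algebra.lsmul_coe]
        rw [update_update (b • ·) (MulOpposite.op c • ·) _ _ x (fun _ y => smul_comm _ _ _),
          update_update (b • ·) (c • ·) _ _ x (fun h => absurd h (Fin.succ_ne_zero i)),
          tprod_rel])
      map_add' := fun b c => hom_ext fun x => by
        simp [actAt_apply]
      map_smul' := fun r b => hom_ext fun x => by
        simp [actAt_apply] }
    (hom_ext fun x => by simp [actAt_apply])
    (fun b c => hom_ext fun x => by simp [actAt_apply])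

/-- The right action `(x₀ ⊗ ⋯ ⊗ xₘ) b = x₀ ⊗ ⋯ ⊗ xₘ b`. -/
def rightAct : Bᵐᵒᵖ →ₐ[k] Module.End k (BimodPow k B X m) :=
  AlgHom.ofLinearMap
    { toFun := fun b => lift k B (actAt B (Fin.last m) (Algebra.lsmul k k X b)) (fun i c x => by
        simp only [actAt_apply, Algebra.lsmul_coe]
        rw [update_update (b • ·) (MulOpposite.op c • ·) _ _ x
            (fun h => absurd h (Fin.castSucc_lt_last i).ne),
          update_update (b • ·) (c • ·) _ _ x (fun _ y => (smul_comm _ _ _).symm),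
          tprod_rel])
      map_add' := fun b c => hom_ext fun x => by
        simp [actAt_apply]
      map_smul' := fun r b => hom_ext fun x => by
        simp [actAt_apply] }
    (hom_ext fun x => by simp [actAt_apply])
    (fun b c => hom_ext fun x => by simp [actAt_apply])

instance : Module B (BimodPow k B X m) :=
  Module.compHom _ (leftAct k B X m).toRingHom

instance : Module Bᵐᵒᵖ (BimodPow k B X m) :=
  Module.compHom _ (rightAct k B X m).toRingHom

variable {X m}

theorem left_smul_tprod (b : B) (x : Fin (m + 1) → X) :
    b • tprod k B x = tprod k B (Function.update x 0 (b • x 0)) := by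
  change leftAct k B X m b (tprod k B x) = _
  simp [leftAct, actAt_apply]

theorem right_smul_tprod (b : Bᵐᵒᵖ) (x : Fin (m + 1) → X) :
    b • tprod k B x = tprod k B (Function.update x (Fin.last m) (b • x (Fin.last m))) := by
  change rightAct k B X m b (tprod k B x) = _
  simp [rightAct, actAt_apply]

theorem left_smul_def (b : B) (z : BimodPow k B X m) : b • z = leftAct k B X m b z := rfl

theorem right_smul_def (b : Bᵐᵒᵖ) (z : BimodPow k B X m) : b • z = rightAct k B X m b z := rfl

instance : IsScalarTower k B (BimodPow k B X m) :=
  ⟨fun c s z => by rw [left_smul_def, left_smul_def, map_smul]; rfl⟩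

instance : IsScalarTower k Bᵐᵒᵖ (BimodPow k B X m) :=
  ⟨fun c s z => by rw [right_smul_def, right_smul_def, map_smul]; rfl⟩

instance : SMulCommClass B Bᵐᵒᵖ (BimodPow k B X m) :=
  ⟨fun s t z => by
    have h : (leftAct k B X m s) ∘ₗ (rightAct k B X m t) =
        (rightAct k B X m t) ∘ₗ (leftAct k B X m s) := hom_ext fun x => by
      simp only [LinearMap.comp_apply, ← left_smul_def, ← right_smul_def, left_smul_tprod,
        right_smul_tprod]
      rw [update_update (s • ·) (t • ·) _ _ x (fun _ y => smul_comm _ _ _)]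
    exact LinearMap.congr_fun h z⟩

end BimodPow

/-! ### The action of the cyclic group -/

open BimodPow

variable [Algebra k B] [IsScalarTower k B X] [IsScalarTower k Bᵐᵒᵖ X] [SMulCommClass B Bᵐᵒᵖ X]

/-- The class of `x₀ ⊗ ⋯ ⊗ xₘ` in `H_0(B, X^{⊗_B (m+1)})`. -/
def cycTprod : MultilinearMap k (fun _ : Fin (m + 1) => X) (HochschildZero k B (BimodPow k B X m)) :=
  (commutatorSpan k B (BimodPow k B X m)).mkQ.compMultilinearMap (BimodPow.tprod k B)

theorem cycTprod_rel (i : Fin (m + 1)) (b : B) (x : Fin (m + 1) → X) :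
    cycTprod k B X m (Function.update x i (MulOpposite.op b • x i)) =
      cycTprod k B X m (Function.update x (i + 1) (b • x (i + 1))) := by
  induction i using Fin.lastCases with
  | cast j =>
    rw [Fin.coeSucc_eq_succ]
    exact congrArg (commutatorSpan k B (BimodPow k B X m)).mkQ (tprod_rel k B j b x)
  | last =>
    rw [Fin.last_add_one, eq_comm, ← sub_eq_zero]
    refine (Submodule.Quotient.mk_eq_zero (commutatorSpan k B (BimodPow k B X m))).2
      (Submodule.subset_span ⟨b, BimodPow.tprod k B x, ?_⟩)
    rw [left_smul_tprod, right_smul_tprod]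

variable {k B X m} in
theorem cyc_hom_ext {Z : Type*} [AddCommGroup Z] [Module k Z]
    {f g : HochschildZero k B (BimodPow k B X m) →ₗ[k] Z}
    (h : ∀ x, f (cycTprod k B X m x) = g (cycTprod k B X m x)) : f = g :=
  Submodule.linearMap_qext _ (BimodPow.hom_ext h)

theorem update_sub (s j : Fin (m + 1)) (x : Fin (m + 1) → X) (y : X) :
    (fun i => Function.update x j y (i - s)) = Function.update (fun i => x (i - s)) (j + s) y := by
  funext i
  by_cases h : i = j + s
  · subst h; simp
  · rw [Function.update_of_ne h, Function.update_of_ne (fun h' => h (by rw [← h']; simp))]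

/-- The multilinear map `x ↦ [x₋ₛ ⊗ x₁₋ₛ ⊗ ⋯ ⊗ xₘ₋ₛ]`, with indices modulo `m + 1`. -/
def rotAux (s : Fin (m + 1)) :
    MultilinearMap k (fun _ : Fin (m + 1) => X) (HochschildZero k B (BimodPow k B X m)) :=
  (cycTprod k B X m).domDomCongr (Equiv.subRight s)

theorem rotAux_apply (s : Fin (m + 1)) (x : Fin (m + 1) → X) :
    rotAux k B X m s x = cycTprod k B X m (fun i => x (i - s)) := rfl

theorem rotAux_rel (s i : Fin (m + 1)) (b : B) (x : Fin (m + 1) → X) :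
    rotAux k B X m s (Function.update x i (MulOpposite.op b • x i)) =
      rotAux k B X m s (Function.update x (i + 1) (b • x (i + 1))) := by
  have h := cycTprod_rel k B X m (i + s) b (fun j => x (j - s))
  rw [rotAux_apply, rotAux_apply, update_sub, update_sub]
  rw [add_right_comm] at h
  simpa using h

/-- The map `x₀ ⊗ ⋯ ⊗ xₘ ↦ [x₋ₛ ⊗ ⋯ ⊗ xₘ₋ₛ]` on the tensor power. -/
def rotPow (s : Fin (m + 1)) :
    BimodPow k B X m →ₗ[k] HochschildZero k B (BimodPow k B X m) :=
  BimodPow.lift k B (rotAux k B X m s) (fun i b x => by rw [rotAux_rel, Fin.coeSucc_eq_succ])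

theorem rotPow_tprod (s : Fin (m + 1)) (x : Fin (m + 1) → X) :
    rotPow k B X m s (BimodPow.tprod k B x) = rotAux k B X m s x :=
  BimodPow.lift_tprod k B _ _ x

theorem rotPow_comm (s : Fin (m + 1)) (b : B) (z : BimodPow k B X m) :
    rotPow k B X m s (b • z) = rotPow k B X m s (MulOpposite.op b • z) := by
  have h : rotPow k B X m s ∘ₗ BimodPow.leftAct k B X m b =
      rotPow k B X m s ∘ₗ BimodPow.rightAct k B X m (MulOpposite.op b) :=
    BimodPow.hom_ext fun x => by
      simp only [LinearMap.comp_apply, ← left_smul_def, ← right_smul_def, left_smul_tprod,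
        right_smul_tprod, rotPow_tprod]
      rw [rotAux_rel, Fin.last_add_one]
  exact LinearMap.congr_fun h z

/-- The cyclic permutation by `s` places of the tensor factors,
`[x₀ ⊗ ⋯ ⊗ xₘ] ↦ [x₋ₛ ⊗ ⋯ ⊗ xₘ₋ₛ]`. For `s = 1` this is
`[x₀ ⊗ ⋯ ⊗ xₘ] ↦ [xₘ ⊗ x₀ ⊗ ⋯ ⊗ xₘ₋₁]`. -/
def rot (s : Fin (m + 1)) : Module.End k (HochschildZero k B (BimodPow k B X m)) :=
  (commutatorSpan k B (BimodPow k B X m)).liftQ (rotPow k B X m s) (Submodule.span_le.2 (by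
    rintro _ ⟨b, z, rfl⟩
    rw [SetLike.mem_coe, LinearMap.mem_ker, map_sub, rotPow_comm, sub_self]))

theorem rot_cycTprod (s : Fin (m + 1)) (x : Fin (m + 1) → X) :
    rot k B X m s (cycTprod k B X m x) = cycTprod k B X m (fun i => x (i - s)) :=
  rotPow_tprod k B X m s x

theorem rot_zero : rot k B X m 0 = 1 := cyc_hom_ext fun x => by
  rw [rot_cycTprod]
  simp

theorem rot_add (s t : Fin (m + 1)) : rot k B X m (s + t) = rot k B X m s * rot k B X m t :=
  cyc_hom_ext fun x => by
    rw [Module.End.mul_apply, rot_cycTprod, rot_cycTprod, rot_cycTprod]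
    simp only [sub_sub]

/-- The action of the cyclic group `C_{m+1}` on `H_0(B, X^{⊗_B (m+1)})`, whose generator `t`
(the class of `1`) acts by `t (x₀ ⊗ ⋯ ⊗ xₘ) = xₘ ⊗ x₀ ⊗ ⋯ ⊗ xₘ₋₁`. Note that `ZMod (m + 1)`
is by definition `Fin (m + 1)`. -/
def cyclicRep : Representation k (Multiplicative (ZMod (m + 1)))
    (HochschildZero k B (BimodPow k B X m)) where
  toFun g := rot k B X m (Multiplicative.toAdd g : ZMod (m + 1))
  map_one' := rot_zero k B X m
  map_mul' g h := rot_add k B X m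
    (Multiplicative.toAdd g : ZMod (m + 1)) (Multiplicative.toAdd h : ZMod (m + 1))

end TensorPower

end NullSq

end

open NullSq

/-! The algebra Λ is a trivial extension C ⊕ J of C = A × B by the bimodule J = M ⊕ N, with J·J = 0
(`NullSquare.nullExt`). For such an extension K¹ has an explicit relative bar resolution with terms
Pₙ = Λ ⊗_C J^{⊗_C (n+1)} ⊗_C Λ. Because J·J = 0, only the two outer terms of the bar differential
survive: a generator x₀ ⊗ ⋯ ⊗ xₙ₊₁ goes to x₀ (x₁ ⊗ ⋯ ⊗ xₙ₊₁) + (-1)ⁿ (x₀ ⊗ ⋯ ⊗ xₙ) xₙ₊₁, and P₀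
maps to K¹ by j ↦ j ⊗ 1 - 1 ⊗ j. Splitting both copies of Λ as C ⊕ J turns Pₙ into a sum of four
tensor powers of J (`Res`), and exactness can be read off the components (`Res.d_exact`,
`aug_eq_zero_iff`, `exists_aug_eq`). Projectivity of M and N yields sections of the left and the
right action on J; applied to the first and the last factor of a tensor power, they make Pₙ a
retract of a free bimodule (`Res.isProjective`).

Tensoring with Λ over Λ-Λ gives H₀(C, J^{⊗(n+1)}) ⊕ H₀(C, J^{⊗(n+2)}) (`tensorEquiv`), and the
differential from degree n+1 to degree n becomes (a, b) ↦ (0, a + (-1)ⁿ t a), where t rotates the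
factors by one place (`tensorEquiv_map`). A cyclic word whose letters alternate between M and N has
even length, so H₀(C, J^{⊗ r}) = 0 for odd r (`subsingleton_cycPow_even`). What is left is, for each
m, the map 1 + t on V = H₀(C, J^{⊗(2m+2)}), from degree 2m+1 to degree 2m; its kernel and cokernel
are the two Tor groups.

Finally V = W ⊕ tW, where W is spanned by the words that begin with a letter of M. Grouping letters
in pairs identifies W with H₀(B, (M ⊗_A N)^{⊗(m+1)}) (`contract`, `expand`); t exchanges the two
summands, and t² acts on W as the generator s of the cyclic group (`OffDiag.isSwap`). Then w ↦ w - t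
w identifies ker (1 - s) with ker (1 + t), and the inclusion of W identifies the two cokernels
(`IsSwap.kerEquiv`, `IsSwap.cokerEquiv`). No division by m + 1 occurs, so the characteristic of k
plays no role. -/

noncomputable section

namespace NullSq

/-! ### Projective resolutions of modules from exact sequences -/

section Resolution

variable {R : Type u} [Ring R] (P : ℕ → ModuleCat.{u} R) (d : ∀ n, P (n + 1) ⟶ P n)
  {X : ModuleCat.{u} R} (ε : P 0 ⟶ X)

/-- The chain complex of an exact sequence of modules. -/
abbrev exactComplex (hd : ∀ n, Function.Exact (d (n + 1)) (d n)) :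
    ChainComplex (ModuleCat.{u} R) ℕ :=
  ChainComplex.of P d (fun n => by
    ext x
    exact (hd n).apply_apply_eq_zero x)

/-- `ChainComplex.of` defines its differential by a case distinction on the indices; this recovers
the given map between consecutive degrees. -/
theorem exactComplex_d (hd : ∀ n, Function.Exact (d (n + 1)) (d n)) (n : ℕ) :
    (exactComplex P d hd).d (n + 1) n = d n :=
  ChainComplex.of_d _ _ _

theorem exactComplex_comp (hd : ∀ n, Function.Exact (d (n + 1)) (d n))
    (h0 : Function.Exact (d 0) ε) : (exactComplex P d hd).d 1 0 ≫ ε = 0 := by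
  rw [exactComplex_d]
  ext x
  exact h0.apply_apply_eq_zero x

/-- The projective resolution given by an exact sequence of projective modules. -/
def resolutionOfExact (hP : ∀ n, Module.Projective R (P n))
    (hd : ∀ n, Function.Exact (d (n + 1)) (d n)) (h0 : Function.Exact (d 0) ε)
    (hε : Function.Surjective ε) : ProjectiveResolution X where
  complex := exactComplex P d hd
  projective n := (P n).projective_of_categoryTheory_projective
  π := (ChainComplex.toSingle₀Equiv _ _).symm ⟨ε, exactComplex_comp P d ε hd h0⟩
  quasiIso := ⟨fun n => by
    cases n with
    | zero =>
      -- In degree zero the claim amounts to exactness of P₁ → P₀ → X at P₀ together with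
      -- surjectivity of `ε`.
      rw [ChainComplex.quasiIsoAt₀_iff, ShortComplex.quasiIso_iff_of_zeros']
      · dsimp
        refine (ShortComplex.exact_and_epi_g_iff_of_iso ?_).2
          ⟨ModuleCat.shortComplex_exact (ShortComplex.mk (d 0) ε (by
            ext x
            exact h0.apply_apply_eq_zero x)) h0, (ModuleCat.epi_iff_surjective ε).2 hε⟩
        exact ShortComplex.isoMk (Iso.refl _) (Iso.refl _) (Iso.refl _)
          ((Category.id_comp _).trans ((exactComplex_d P d hd 0).symm.trans
            (Category.comp_id _).symm))
          (by
            have h := ChainComplex.toSingle₀Equiv_symm_apply_f_zero (C := exactComplex P d hd) ε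
              (exactComplex_comp P d ε hd h0)
            exact (Category.id_comp ε).trans (h.symm.trans (Category.comp_id _).symm))
      all_goals rfl
    | succ n =>
      -- In positive degree the target complex is exact, so only exactness of the source is at
      -- stake.
      rw [quasiIsoAt_iff_exactAt']
      · rw [HomologicalComplex.exactAt_iff' _ (n + 1 + 1) (n + 1) n (by simp) (by simp)]
        have h : d (n + 1) ≫ d n = 0 := by
          ext x
          exact (hd n).apply_apply_eq_zero x
        refine (ShortComplex.exact_iff_of_iso ?_).2
          (ModuleCat.shortComplex_exact (ShortComplex.mk (d (n + 1)) (d n) h) (hd n))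
        exact ShortComplex.isoMk (Iso.refl _) (Iso.refl _) (Iso.refl _)
          ((Category.id_comp _).trans ((exactComplex_d P d hd (n + 1)).symm.trans
            (Category.comp_id _).symm))
          ((Category.id_comp _).trans ((exactComplex_d P d hd n).symm.trans
            (Category.comp_id _).symm))
      · apply ChainComplex.exactAt_succ_single_obj⟩

end Resolution

/-! ### Homology and derived functors next to a vanishing differential. -/

section Homology

open HomologicalComplex Limits

variable {R : Type u} [Ring R] (K : ChainComplex (ModuleCat.{u} R) ℕ)

/-- If the incoming differential is zero, then the homology is the kernel of the outgoing one. -/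
def homologyIsoKer (n : ℕ) (h : K.d (n + 2) (n + 1) = 0) :
    K.homology (n + 1) ≃ₗ[R] LinearMap.ker (K.d (n + 1) n).hom :=
  ((K.isoHomologyπ (n + 2) (n + 1) (by simp) h).symm ≪≫
    IsLimit.conePointUniqueUpToIso (K.cyclesIsKernel (n + 1) n (by simp))
      (ModuleCat.kernelIsLimit _)).toLinearEquiv

/-- If the outgoing differential is zero, then the homology is the cokernel of the incoming one. -/
def homologyIsoCoker (n : ℕ) (h : ∀ j, K.d n j = 0) :
    K.homology n ≃ₗ[R] (K.X n ⧸ LinearMap.range (K.d (n + 1) n).hom) :=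
  ((K.isoHomologyι n _ rfl (h _)) ≪≫
    IsColimit.coconePointUniqueUpToIso (K.opcyclesIsCokernel (n + 1) n (by simp))
      (ModuleCat.cokernelIsColimit _)).toLinearEquiv

end Homology

section LeftDerived

variable {R S : Type u} [Ring R] [Ring S] (F : ModuleCat.{u} R ⥤ ModuleCat.{u} S) [F.Additive]
  (P : ℕ → ModuleCat.{u} R) (d : ∀ n, P (n + 1) ⟶ P n)
  {X : ModuleCat.{u} R} (ε : P 0 ⟶ X)

/-- Once `F` kills the incoming differential there are no boundaries in degree n + 1, and the
homology is the space of cycles. -/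
theorem leftDerived_equiv_ker (hP : ∀ n, Module.Projective R (P n))
    (hd : ∀ n, Function.Exact (d (n + 1)) (d n)) (h0 : Function.Exact (d 0) ε)
    (hε : Function.Surjective ε) (n : ℕ) (h : F.map (d (n + 1)) = 0) :
    Nonempty ((F.leftDerived (n + 1)).obj X ≃ₗ[S] LinearMap.ker (F.map (d n)).hom) := by
  let r := resolutionOfExact P d ε hP hd h0 hε
  let K := (F.mapHomologicalComplex (ComplexShape.down ℕ)).obj r.complex
  have hK : ∀ j, K.d (j + 1) j = F.map (d j) := fun j => by
    change F.map ((exactComplex P d hd).d (j + 1) j) = _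
    rw [exactComplex_d]
  have e := homologyIsoKer K n ((hK _).trans h)
  rw [hK] at e
  exact ⟨(r.isoLeftDerivedObj F (n + 1)).toLinearEquiv.trans e⟩

/-- Once `F` kills what leaves degree n, everything there is a cycle. The condition ranges over all
targets j so that degree zero, which has no predecessor, is covered too. -/
theorem leftDerived_equiv_coker (hP : ∀ n, Module.Projective R (P n))
    (hd : ∀ n, Function.Exact (d (n + 1)) (d n)) (h0 : Function.Exact (d 0) ε)
    (hε : Function.Surjective ε) (n : ℕ)
    (h : ∀ j, F.map ((exactComplex P d hd).d n j) = 0) :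
    Nonempty ((F.leftDerived n).obj X ≃ₗ[S]
      (F.obj (P n) ⧸ LinearMap.range (F.map (d n)).hom)) := by
  let r := resolutionOfExact P d ε hP hd h0 hε
  let K := (F.mapHomologicalComplex (ComplexShape.down ℕ)).obj r.complex
  have hK : ∀ j, K.d (j + 1) j = F.map (d j) := fun j => by
    change F.map ((exactComplex P d hd).d (j + 1) j) = _
    rw [exactComplex_d]
  have e := homologyIsoCoker K n h
  rw [hK] at e
  exact ⟨(r.isoLeftDerivedObj F n).toLinearEquiv.trans e⟩

end LeftDerived

end NullSq

end

noncomputable section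

namespace NullSq

/-! ### Adding a factor to a tensor power -/

namespace BimodPow

variable {k C J : Type*} [Field k] [Ring C] [Algebra k C] [AddCommGroup J] [Module k J]
  [Module C J] [Module Cᵐᵒᵖ J] [IsScalarTower k C J] [IsScalarTower k Cᵐᵒᵖ J]
  [SMulCommClass C Cᵐᵒᵖ J] {n : ℕ}

/-- A form of `tprod_rel` that leaves the two families free: adding a factor produces them in
another shape than `Function.update`. -/
theorem tprod_eq_of_rel {x y : Fin (n + 1) → J} (i : Fin n) (c : C) (z : Fin (n + 1) → J)
    (hx : x = Function.update z i.castSucc (MulOpposite.op c • z i.castSucc))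
    (hy : y = Function.update z i.succ (c • z i.succ)) : tprod k C x = tprod k C y := by
  rw [hx, hy, tprod_rel]

variable (k C n) in
/-- The multilinear map `x ↦ j ⊗ x₀ ⊗ ⋯ ⊗ xₙ`. -/
def tprodCons (j : J) : MultilinearMap k (fun _ : Fin (n + 1) => J) (BimodPow k C J (n + 1)) :=
  (tprod k C).curryLeft j

theorem tprodCons_apply (j : J) (x : Fin (n + 1) → J) :
    tprodCons k C n j x = tprod k C (Fin.cons j x : Fin (n + 2) → J) := rfl

variable (k C J n) in
/-- The multilinear map `x ↦ (j ↦ x₀ ⊗ ⋯ ⊗ xₙ ⊗ j)`. -/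
def tprodSnoc : MultilinearMap k (fun _ : Fin (n + 1) => J) (J →ₗ[k] BimodPow k C J (n + 1)) :=
  (tprod k C).curryRight

theorem tprodSnoc_apply (x : Fin (n + 1) → J) (j : J) :
    tprodSnoc k C J n x j = tprod k C (Fin.snoc x j : Fin (n + 2) → J) := rfl

theorem snoc_update_const (x : Fin (n + 1) → J) (j y : J) (i : Fin (n + 1)) :
    (Fin.snoc (Function.update x i y) j : Fin (n + 2) → J) =
      Function.update (Fin.snoc x j : Fin (n + 2) → J) i.castSucc y :=
  Fin.snoc_update (α := fun _ => J) j x i y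

theorem cons_update_const (x : Fin (n + 1) → J) (j y : J) (i : Fin (n + 1)) :
    (Fin.cons j (Function.update x i y) : Fin (n + 2) → J) =
      Function.update (Fin.cons j x : Fin (n + 2) → J) i.succ y :=
  Fin.cons_update (α := fun _ => J) j x i y

theorem tprodCons_rel (j : J) (i : Fin n) (c : C) (x : Fin (n + 1) → J) :
    tprodCons k C n j (Function.update x i.castSucc (MulOpposite.op c • x i.castSucc)) =
      tprodCons k C n j (Function.update x i.succ (c • x i.succ)) := by
  refine tprod_eq_of_rel i.succ c (Fin.cons j x : Fin (n + 2) → J) ?_ ?_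
  · rw [← Fin.succ_castSucc, Fin.cons_succ, ← cons_update_const]
  · rw [Fin.cons_succ, ← cons_update_const]

variable (k C J n) in
/-- The map `j ⊗ t ↦ j ⊗ t`. -/
def cons : J →ₗ[k] BimodPow k C J n →ₗ[k] BimodPow k C J (n + 1) where
  toFun j := lift k C (tprodCons k C n j) (tprodCons_rel j)
  map_add' j j' := hom_ext fun x => by
    rw [LinearMap.add_apply, lift_tprod, lift_tprod, lift_tprod]
    exact (tprod k C).cons_add x j j'
  map_smul' r j := hom_ext fun x => by
    rw [LinearMap.smul_apply, lift_tprod, lift_tprod]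
    exact (tprod k C).cons_smul x r j

@[simp] theorem cons_tprod (j : J) (x : Fin (n + 1) → J) :
    cons k C J n j (tprod k C x) = tprod k C (Fin.cons j x : Fin (n + 2) → J) :=
  lift_tprod k C _ (tprodCons_rel j) x

variable (k C J n) in
/-- The map `t ⊗ j ↦ t ⊗ j`. -/
def snoc : BimodPow k C J n →ₗ[k] J →ₗ[k] BimodPow k C J (n + 1) :=
  lift k C (tprodSnoc k C J n) (fun i c x => by
    ext j
    refine tprod_eq_of_rel i.castSucc c (Fin.snoc x j : Fin (n + 2) → J) ?_ ?_
    · rw [Fin.snoc_castSucc, snoc_update_const]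
    · rw [Fin.succ_castSucc, Fin.snoc_castSucc, snoc_update_const])

@[simp] theorem snoc_tprod (x : Fin (n + 1) → J) (j : J) :
    snoc k C J n (tprod k C x) j = tprod k C (Fin.snoc x j : Fin (n + 2) → J) :=
  LinearMap.congr_fun (lift_tprod k C _ _ x) j

theorem tprod_eq_cons (x : Fin (n + 2) → J) :
    tprod k C x = cons k C J n (x 0) (tprod k C (Fin.tail x)) := by
  rw [cons_tprod, Fin.cons_self_tail]

theorem tprod_eq_snoc (x : Fin (n + 2) → J) :
    tprod k C x = snoc k C J n (tprod k C (Fin.init x)) (x (Fin.last (n + 1))) := by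
  rw [snoc_tprod, Fin.snoc_init_self]

/-- Splitting a factor off a pure tensor lets later identities be checked with `cons` and `snoc`
alone, without index arithmetic. -/
theorem hom_ext_cons {Z : Type*} [AddCommGroup Z] [Module k Z]
    {f g : BimodPow k C J (n + 1) →ₗ[k] Z}
    (h : ∀ j t, f (cons k C J n j t) = g (cons k C J n j t)) : f = g :=
  hom_ext fun x => by rw [tprod_eq_cons, h]

theorem hom_ext_snoc {Z : Type*} [AddCommGroup Z] [Module k Z]
    {f g : BimodPow k C J (n + 1) →ₗ[k] Z}
    (h : ∀ t j, f (snoc k C J n t j) = g (snoc k C J n t j)) : f = g :=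
  hom_ext fun x => by rw [tprod_eq_snoc, h]

/-- This is the relation at the joint between the new first factor and the old one. -/
theorem cons_op_smul (c : C) (j : J) (t : BimodPow k C J n) :
    cons k C J n (MulOpposite.op c • j) t = cons k C J n j (c • t) := by
  have h : cons k C J n (MulOpposite.op c • j) = cons k C J n j ∘ₗ leftAct k C J n c :=
    hom_ext fun x => by
      rw [LinearMap.comp_apply, ← left_smul_def, left_smul_tprod, cons_tprod, cons_tprod]
      refine tprod_eq_of_rel 0 c (Fin.cons j x) ?_ ?_
      · simp
      · simp [Fin.cons_update]
  exact LinearMap.congr_fun h t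

theorem snoc_op_smul (c : C) (t : BimodPow k C J n) (j : J) :
    snoc k C J n (MulOpposite.op c • t) j = snoc k C J n t (c • j) := by
  have h : (snoc k C J n).flip j ∘ₗ rightAct k C J n (MulOpposite.op c) =
      (snoc k C J n).flip (c • j) :=
    hom_ext fun x => by
      rw [LinearMap.comp_apply, ← right_smul_def, right_smul_tprod, LinearMap.flip_apply,
        LinearMap.flip_apply, snoc_tprod, snoc_tprod]
      refine tprod_eq_of_rel (Fin.last n) c (Fin.snoc x j : Fin (n + 2) → J) ?_ ?_
      · rw [Fin.snoc_castSucc, snoc_update_const]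
      · rw [Fin.succ_last, Fin.snoc_last, Fin.update_snoc_last]
  exact LinearMap.congr_fun h t

@[simp] theorem smul_cons (c : C) (j : J) (t : BimodPow k C J n) :
    c • cons k C J n j t = cons k C J n (c • j) t := by
  have h : leftAct k C J (n + 1) c ∘ₗ cons k C J n j = cons k C J n (c • j) :=
    hom_ext fun x => by
      rw [LinearMap.comp_apply, ← left_smul_def, cons_tprod, cons_tprod, left_smul_tprod]
      simp
  exact LinearMap.congr_fun h t

@[simp] theorem op_smul_cons (c : Cᵐᵒᵖ) (j : J) (t : BimodPow k C J n) :
    c • cons k C J n j t = cons k C J n j (c • t) := by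
  have h : rightAct k C J (n + 1) c ∘ₗ cons k C J n j = cons k C J n j ∘ₗ rightAct k C J n c :=
    hom_ext fun x => by
      rw [LinearMap.comp_apply, LinearMap.comp_apply, ← right_smul_def, ← right_smul_def,
        cons_tprod, right_smul_tprod, right_smul_tprod, cons_tprod, ← Fin.succ_last,
        Fin.cons_succ, Fin.cons_update]
  exact LinearMap.congr_fun h t

@[simp] theorem smul_snoc (c : C) (t : BimodPow k C J n) (j : J) :
    c • snoc k C J n t j = snoc k C J n (c • t) j := by
  have h : leftAct k C J (n + 1) c ∘ₗ (snoc k C J n).flip j =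
      (snoc k C J n).flip j ∘ₗ leftAct k C J n c :=
    hom_ext fun x => by
      rw [LinearMap.comp_apply, LinearMap.comp_apply, ← left_smul_def, ← left_smul_def,
        LinearMap.flip_apply, LinearMap.flip_apply, left_smul_tprod, snoc_tprod, snoc_tprod,
        left_smul_tprod, ← Fin.castSucc_zero, Fin.snoc_castSucc, snoc_update_const]
  exact LinearMap.congr_fun h t

@[simp] theorem op_smul_snoc (c : Cᵐᵒᵖ) (t : BimodPow k C J n) (j : J) :
    c • snoc k C J n t j = snoc k C J n t (c • j) := by
  have h : rightAct k C J (n + 1) c ∘ₗ (snoc k C J n).flip j = (snoc k C J n).flip (c • j) :=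
    hom_ext fun x => by
      rw [LinearMap.comp_apply, ← right_smul_def, LinearMap.flip_apply, LinearMap.flip_apply,
        snoc_tprod, snoc_tprod, right_smul_tprod, Fin.snoc_last, Fin.update_snoc_last]
  exact LinearMap.congr_fun h t

/-- Associativity of adding a factor on either side. It makes the left and right actions on `Res`
commute in the component `w`. -/
theorem cons_snoc (j j' : J) (t : BimodPow k C J n) :
    cons k C J (n + 1) j (snoc k C J n t j') = snoc k C J (n + 1) (cons k C J n j t) j' := by
  have h : cons k C J (n + 1) j ∘ₗ (snoc k C J n).flip j' =
      (snoc k C J (n + 1)).flip j' ∘ₗ cons k C J n j :=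
    hom_ext fun x => by
      simp only [LinearMap.comp_apply, LinearMap.flip_apply, cons_tprod, snoc_tprod]
      rw [Fin.cons_snoc_eq_snoc_cons]
  exact LinearMap.congr_fun h t

variable {Z : Type*} [AddCommGroup Z] [Module k Z]

/-- The multilinear map `x ↦ φ(x₀, x₁ ⊗ ⋯ ⊗ xₙ)`. -/
def consMultilinear (φ : J →ₗ[k] BimodPow k C J n →ₗ[k] Z) :
    MultilinearMap k (fun _ : Fin (n + 2) => J) Z :=
  LinearMap.uncurryLeft (M := fun _ : Fin (n + 2) => J)
    { toFun := fun j => (φ j).compMultilinearMap (tprod k C)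
      map_add' := fun j j' => by ext x; simp
      map_smul' := fun r j => by ext x; simp }

theorem consMultilinear_apply (φ : J →ₗ[k] BimodPow k C J n →ₗ[k] Z) (x : Fin (n + 2) → J) :
    consMultilinear φ x = φ (x 0) (tprod k C (Fin.tail x)) := rfl

/-- The multilinear map `x ↦ φ(x₀ ⊗ ⋯ ⊗ xₙ₋₁, xₙ)`. -/
def snocMultilinear (φ : BimodPow k C J n →ₗ[k] J →ₗ[k] Z) :
    MultilinearMap k (fun _ : Fin (n + 2) => J) Z :=
  MultilinearMap.uncurryRight (M := fun _ : Fin (n + 2) => J)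
    (φ.compMultilinearMap (tprod k C))

theorem snocMultilinear_apply (φ : BimodPow k C J n →ₗ[k] J →ₗ[k] Z) (x : Fin (n + 2) → J) :
    snocMultilinear φ x = φ (tprod k C (Fin.init x)) (x (Fin.last (n + 1))) := rfl

theorem tail_update_succ_const (x : Fin (n + 2) → J) (i : Fin (n + 1)) (y : J) :
    Fin.tail (Function.update x i.succ y) = Function.update (Fin.tail x) i y :=
  Fin.tail_update_succ (α := fun _ => J) x i y

theorem init_update_castSucc_const (x : Fin (n + 2) → J) (i : Fin (n + 1)) (y : J) :
    (Fin.init (Function.update x i.castSucc y) : Fin (n + 1) → J) =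
      Function.update (Fin.init x : Fin (n + 1) → J) i y :=
  Fin.init_update_castSucc (α := fun _ => J) x i y

/-- The linear map out of `J ⊗_C J^{⊗_C (n+1)}` given by a balanced bilinear map. -/
def liftCons (φ : J →ₗ[k] BimodPow k C J n →ₗ[k] Z)
    (h : ∀ j (c : C) t, φ (MulOpposite.op c • j) t = φ j (c • t)) :
    BimodPow k C J (n + 1) →ₗ[k] Z :=
  lift k C (consMultilinear φ) (fun i c x => by
    rw [consMultilinear_apply, consMultilinear_apply]
    -- The relation between the first two factors is the balancing of `φ`; all later ones already
    -- hold in its second argument.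
    induction i using Fin.cases with
    | zero =>
      rw [Fin.castSucc_zero, Function.update_self, h, left_smul_tprod,
        Function.update_of_ne (Fin.succ_ne_zero _).symm, tail_update_succ_const,
        Fin.tail_update_zero]
      rfl
    | succ i =>
      rw [Fin.castSucc_succ, Function.update_of_ne (Fin.succ_ne_zero _).symm,
        Function.update_of_ne (Fin.succ_ne_zero _).symm, tail_update_succ_const,
        tail_update_succ_const]
      exact congrArg _ (tprod_rel k C i c (Fin.tail x)))

@[simp] theorem liftCons_cons (φ : J →ₗ[k] BimodPow k C J n →ₗ[k] Z)
    (h : ∀ j (c : C) t, φ (MulOpposite.op c • j) t = φ j (c • t)) (j : J)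
    (t : BimodPow k C J n) : liftCons φ h (cons k C J n j t) = φ j t := by
  have H : liftCons φ h ∘ₗ cons k C J n j = φ j := hom_ext fun x => by
    rw [LinearMap.comp_apply, cons_tprod, liftCons, lift_tprod, consMultilinear_apply,
      Fin.cons_zero, Fin.tail_cons]
  exact LinearMap.congr_fun H t

/-- The linear map out of `J^{⊗_C (n+1)} ⊗_C J` given by a balanced bilinear map. -/
def liftSnoc (φ : BimodPow k C J n →ₗ[k] J →ₗ[k] Z)
    (h : ∀ t (c : C) j, φ (MulOpposite.op c • t) j = φ t (c • j)) :
    BimodPow k C J (n + 1) →ₗ[k] Z :=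
  lift k C (snocMultilinear φ) (fun i c x => by
    rw [snocMultilinear_apply, snocMultilinear_apply]
    induction i using Fin.lastCases with
    | last =>
      rw [Fin.succ_last, Function.update_self, ← h, right_smul_tprod,
        Function.update_of_ne (Fin.castSucc_lt_last _).ne', init_update_castSucc_const,
        Fin.init_update_last]
      rfl
    | cast i =>
      rw [← Fin.castSucc_succ, Function.update_of_ne (Fin.castSucc_lt_last _).ne',
        Function.update_of_ne (Fin.castSucc_lt_last _).ne', init_update_castSucc_const,
        init_update_castSucc_const]
      exact congrArg (φ · _) (tprod_rel k C i c (Fin.init x)))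

@[simp] theorem liftSnoc_snoc (φ : BimodPow k C J n →ₗ[k] J →ₗ[k] Z)
    (h : ∀ t (c : C) j, φ (MulOpposite.op c • t) j = φ t (c • j)) (t : BimodPow k C J n)
    (j : J) : liftSnoc φ h (snoc k C J n t j) = φ t j := by
  have H : liftSnoc φ h ∘ₗ (snoc k C J n).flip j = φ.flip j := hom_ext fun x => by
    rw [LinearMap.comp_apply, LinearMap.flip_apply, snoc_tprod, liftSnoc, lift_tprod,
      snocMultilinear_apply, Fin.snoc_last, Fin.init_snoc, LinearMap.flip_apply]
  exact LinearMap.congr_fun H t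

variable (k C J) in
/-- The tensor power with one factor. -/
def single : J ≃ₗ[k] BimodPow k C J 0 :=
  LinearEquiv.ofLinearMap
    ((MultilinearMap.ofSubsingleton k J (BimodPow k C J 0) (0 : Fin 1)).symm (tprod k C))
    (lift k C (MultilinearMap.ofSubsingleton k J J (0 : Fin 1) LinearMap.id)
      (fun i => Fin.elim0 i))
    (hom_ext fun x => by
      rw [LinearMap.comp_apply, lift_tprod]
      refine congrArg (tprod k C) (funext fun i => ?_)
      rw [Fin.fin_one_eq_zero i]
      rfl)
    (LinearMap.ext fun j => lift_tprod k C _ (fun i => Fin.elim0 i) _)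

theorem single_apply (j : J) : single k C J j = tprod k C (fun _ => j) := rfl

theorem smul_single (c : C) (j : J) : c • single k C J j = single k C J (c • j) := by
  rw [single_apply, single_apply, left_smul_tprod]
  congr 1
  ext i
  rw [Fin.fin_one_eq_zero i, Function.update_self]

theorem op_smul_single (c : Cᵐᵒᵖ) (j : J) : c • single k C J j = single k C J (c • j) := by
  rw [single_apply, single_apply, right_smul_tprod]
  congr 1
  ext i
  rw [Fin.fin_one_eq_zero i]
  exact Function.update_self _ _ _

theorem cons_single (j j' : J) :
    cons k C J 0 j (single k C J j') = snoc k C J 0 (single k C J j) j' := by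
  rw [single_apply, single_apply, cons_tprod, snoc_tprod]
  congr 1
  ext i
  fin_cases i <;> rfl

end BimodPow

end NullSq

end

/-! ### The terms of the relative bar resolution of a trivial extension. -/

noncomputable section

namespace NullSq

open BimodPow

/-- A decomposition of a `k`-algebra `L` as the trivial extension of an algebra `C` by a
`C`-bimodule `J` of square zero. -/
structure NullExt (k L C J : Type*) [Field k] [Ring L] [Algebra k L] [Ring C] [Algebra k C]
    [AddCommGroup J] [Module k J] [Module C J] [Module Cᵐᵒᵖ J] where
  /-- the inclusion of `C` -/
  inC : C →ₐ[k] L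
  /-- the inclusion of `J` -/
  inJ : J →ₗ[k] L
  /-- the projection to `C` -/
  prC : L →ₐ[k] C
  /-- the projection to `J` -/
  prJ : L →ₗ[k] J
  prC_inC : ∀ c, prC (inC c) = c
  prC_inJ : ∀ j, prC (inJ j) = 0
  prJ_inC : ∀ c, prJ (inC c) = 0
  prJ_inJ : ∀ j, prJ (inJ j) = j
  inC_add_inJ : ∀ l, inC (prC l) + inJ (prJ l) = l
  prJ_mul : ∀ l l', prJ (l * l') = prC l • prJ l' + MulOpposite.op (prC l') • prJ l

attribute [simp] NullExt.prC_inC NullExt.prC_inJ NullExt.prJ_inC NullExt.prJ_inJ NullExt.prJ_mul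

namespace NullExt

variable {k L C J : Type*} [Field k] [Ring L] [Algebra k L] [Ring C] [Algebra k C]
  [AddCommGroup J] [Module k J] [Module C J] [Module Cᵐᵒᵖ J] [IsScalarTower k C J]
  [IsScalarTower k Cᵐᵒᵖ J] [SMulCommClass C Cᵐᵒᵖ J] (E : NullExt k L C J)

theorem ext_pr {l l' : L} (h : E.prC l = E.prC l') (h' : E.prJ l = E.prJ l') : l = l' := by
  rw [← E.inC_add_inJ l, h, h', E.inC_add_inJ]

@[simp] theorem prJ_one : E.prJ 1 = 0 := by
  rw [← map_one E.inC, E.prJ_inC]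

theorem inJ_smul (c : C) (j : J) : E.inJ (c • j) = E.inC c * E.inJ j :=
  E.ext_pr (by simp) (by simp)

theorem inJ_op_smul (c : C) (j : J) : E.inJ (MulOpposite.op c • j) = E.inJ j * E.inC c :=
  E.ext_pr (by simp) (by simp)

/-- `J` has square zero because `prC` is multiplicative and kills `J`, and the formula for `prJ` of
a product has no term in two elements of `J`. -/
theorem inJ_mul_inJ (j j' : J) : E.inJ j * E.inJ j' = 0 :=
  E.ext_pr (by simp) (by simp)

/-- The `L`-bimodule `L ⊗_C J^{⊗_C (n+1)} ⊗_C L`: a quadruple `(x, y, z, w)` stands for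
`1 ⊗ x ⊗ 1 + y + z + w`, where `y` is in `J ⊗_C J^{⊗_C (n+1)} ⊗_C C`, where `z` is in
`C ⊗_C J^{⊗_C (n+1)} ⊗_C J`, and `w` is in `J ⊗_C J^{⊗_C (n+1)} ⊗_C J`. -/
@[ext]
structure Res (E : NullExt k L C J) (n : ℕ) where
  x : BimodPow k C J n
  y : BimodPow k C J (n + 1)
  z : BimodPow k C J (n + 1)
  w : BimodPow k C J (n + 2)

namespace Res

variable {E} {n : ℕ}

/-- The components of an element. -/
def equivProd : Res E n ≃ BimodPow k C J n × BimodPow k C J (n + 1) × BimodPow k C J (n + 1) ×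
    BimodPow k C J (n + 2) where
  toFun p := (p.x, p.y, p.z, p.w)
  invFun p := ⟨p.1, p.2.1, p.2.2.1, p.2.2.2⟩

instance : AddCommGroup (Res E n) := equivProd.addCommGroup
instance : Module k (Res E n) := equivProd.module k

@[simp] theorem zero_x : (0 : Res E n).x = 0 := rfl
@[simp] theorem zero_y : (0 : Res E n).y = 0 := rfl
@[simp] theorem zero_z : (0 : Res E n).z = 0 := rfl
@[simp] theorem zero_w : (0 : Res E n).w = 0 := rfl
@[simp] theorem add_x (p q : Res E n) : (p + q).x = p.x + q.x := rfl
@[simp] theorem add_y (p q : Res E n) : (p + q).y = p.y + q.y := rfl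
@[simp] theorem add_z (p q : Res E n) : (p + q).z = p.z + q.z := rfl
@[simp] theorem add_w (p q : Res E n) : (p + q).w = p.w + q.w := rfl
@[simp] theorem smul_x (r : k) (p : Res E n) : (r • p).x = r • p.x := rfl
@[simp] theorem smul_y (r : k) (p : Res E n) : (r • p).y = r • p.y := rfl
@[simp] theorem smul_z (r : k) (p : Res E n) : (r • p).z = r • p.z := rfl
@[simp] theorem smul_w (r : k) (p : Res E n) : (r • p).w = r • p.w := rfl

/-- Multiplication on the outer left factor `L = C ⊕ J`: the `J`-part of `l` turns an outer left `C`
into an outer left `J`, so it moves `x` into `y` and `z` into `w`, and it kills `y` and `w` because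
`J·J = 0`. -/
instance : SMul L (Res E n) :=
  ⟨fun l p => ⟨E.prC l • p.x, E.prC l • p.y + cons k C J n (E.prJ l) p.x, E.prC l • p.z,
    E.prC l • p.w + cons k C J (n + 1) (E.prJ l) p.z⟩⟩

@[simp] theorem left_smul_x (l : L) (p : Res E n) : (l • p).x = E.prC l • p.x := rfl
@[simp] theorem left_smul_y (l : L) (p : Res E n) :
    (l • p).y = E.prC l • p.y + cons k C J n (E.prJ l) p.x := rfl
@[simp] theorem left_smul_z (l : L) (p : Res E n) : (l • p).z = E.prC l • p.z := rfl
@[simp] theorem left_smul_w (l : L) (p : Res E n) :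
    (l • p).w = E.prC l • p.w + cons k C J (n + 1) (E.prJ l) p.z := rfl

/-- The mirror image: the `J`-part moves `x` into `z` and `y` into `w`, and kills `z` and `w`. -/
instance : SMul Lᵐᵒᵖ (Res E n) :=
  ⟨fun l p => ⟨MulOpposite.op (E.prC l.unop) • p.x, MulOpposite.op (E.prC l.unop) • p.y,
    MulOpposite.op (E.prC l.unop) • p.z + snoc k C J n p.x (E.prJ l.unop),
    MulOpposite.op (E.prC l.unop) • p.w + snoc k C J (n + 1) p.y (E.prJ l.unop)⟩⟩

@[simp] theorem right_smul_x (l : Lᵐᵒᵖ) (p : Res E n) :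
    (l • p).x = MulOpposite.op (E.prC l.unop) • p.x := rfl
@[simp] theorem right_smul_y (l : Lᵐᵒᵖ) (p : Res E n) :
    (l • p).y = MulOpposite.op (E.prC l.unop) • p.y := rfl
@[simp] theorem right_smul_z (l : Lᵐᵒᵖ) (p : Res E n) :
    (l • p).z = MulOpposite.op (E.prC l.unop) • p.z + snoc k C J n p.x (E.prJ l.unop) := rfl
@[simp] theorem right_smul_w (l : Lᵐᵒᵖ) (p : Res E n) :
    (l • p).w = MulOpposite.op (E.prC l.unop) • p.w + snoc k C J (n + 1) p.y (E.prJ l.unop) := rfl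

instance : Module L (Res E n) where
  one_smul p := by ext <;> simp
  mul_smul l l' p := by
    ext
    · simp [mul_smul]
    · simp [mul_smul, cons_op_smul, add_assoc]
    · simp [mul_smul]
    · simp [mul_smul, cons_op_smul, add_assoc]
  smul_zero l := by ext <;> simp
  smul_add l p q := by ext <;> simp <;> abel
  add_smul l l' p := by ext <;> simp [add_smul] <;> abel
  zero_smul p := by ext <;> simp

instance : Module Lᵐᵒᵖ (Res E n) where
  one_smul p := by ext <;> simp
  mul_smul l l' p := by
    ext
    · simp [mul_smul]
    · simp [mul_smul]
    · simp only [right_smul_z, right_smul_x, MulOpposite.unop_mul, map_mul, MulOpposite.op_mul,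
        mul_smul, prJ_mul, map_add, snoc_op_smul, smul_add, op_smul_snoc]
      abel
    · simp only [right_smul_w, right_smul_y, MulOpposite.unop_mul, map_mul, MulOpposite.op_mul,
        mul_smul, prJ_mul, map_add, snoc_op_smul, smul_add, op_smul_snoc]
      abel
  smul_zero l := by ext <;> simp
  smul_add l p q := by ext <;> simp <;> abel
  add_smul l l' p := by ext <;> simp [add_smul] <;> abel
  zero_smul p := by ext <;> simp

instance : IsScalarTower k L (Res E n) :=
  ⟨fun r l p => by ext <;> simp⟩

instance : IsScalarTower k Lᵐᵒᵖ (Res E n) :=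
  ⟨fun r l p => by ext <;> simp [MulOpposite.op_smul]⟩

instance : SMulCommClass L Lᵐᵒᵖ (Res E n) :=
  ⟨fun l l' p => by
    ext
    · simp [smul_comm]
    · simp [smul_comm]
    · simp [smul_comm]
    · simp [smul_comm, cons_snoc]
      abel⟩

end Res
end NullExt

end NullSq

end

/-! ### The differential, its exactness, and bimodule maps out of the terms. -/

noncomputable section

namespace NullSq

open BimodPow
namespace NullExt

variable {k L C J : Type*} [Field k] [Ring L] [Algebra k L] [Ring C] [Algebra k C]
  [AddCommGroup J] [Module k J] [Module C J] [Module Cᵐᵒᵖ J] [IsScalarTower k C J]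
  [IsScalarTower k Cᵐᵒᵖ J] [SMulCommClass C Cᵐᵒᵖ J] {E : NullExt k L C J}

namespace Res

variable {n : ℕ}

variable (E n) in
/-- The differential of the resolution, with a sign `ε`. -/
def d (ε : k) : Res E (n + 1) →ₗ[k] Res E n where
  -- The first factor of a generator moves into the left copy of `L`, and, with coefficient `ε`, the
  -- last one into the right copy. On `y` the left copy is already in `J`, so only the second term
  -- survives; on `z` only the first does.
  toFun p := ⟨0, p.x, ε • p.x, p.z + ε • p.y⟩
  map_add' p q := by ext <;> simp; abel
  map_smul' r p := by ext <;> simp [smul_comm r]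

@[simp] theorem d_x (ε : k) (p : Res E (n + 1)) : (d E n ε p).x = 0 := rfl
@[simp] theorem d_y (ε : k) (p : Res E (n + 1)) : (d E n ε p).y = p.x := rfl
@[simp] theorem d_z (ε : k) (p : Res E (n + 1)) : (d E n ε p).z = ε • p.x := rfl
@[simp] theorem d_w (ε : k) (p : Res E (n + 1)) : (d E n ε p).w = p.z + ε • p.y := rfl

theorem d_left_smul (ε : k) (l : L) (p : Res E (n + 1)) : d E n ε (l • p) = l • d E n ε p := by
  ext
  · simp
  · simp
  · simp [smul_comm ε]
  · simp [smul_comm ε, add_assoc]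

theorem d_right_smul (ε : k) (l : Lᵐᵒᵖ) (p : Res E (n + 1)) :
    d E n ε (l • p) = l • d E n ε p := by
  ext
  · simp
  · simp
  · simp [smul_comm ε]
  · simp [smul_comm ε]
    abel

/-- The kernel of `d` with sign ε is given by x = 0 and z = -ε y, with w free, and ⟨y, 0, w, 0⟩ is a
preimage under the differential with sign -ε. The composite vanishes since -ε and ε meet in w. This
works for every scalar ε. -/
theorem d_exact (ε : k) : Function.Exact (d E (n + 1) (-ε)) (d E n ε) := by
  intro p
  constructor
  · intro h
    have hx : p.x = 0 := congrArg y h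
    have hw : p.z + ε • p.y = 0 := congrArg w h
    refine ⟨⟨p.y, 0, p.w, 0⟩, ?_⟩
    ext
    · simp [hx]
    · simp
    · simp [eq_neg_of_add_eq_zero_left hw]
    · simp
  · rintro ⟨q, rfl⟩
    ext <;> simp

variable (E n) in
/-- The inclusion `t ↦ 1 ⊗ t ⊗ 1`. -/
def incl : BimodPow k C J n →ₗ[k] Res E n where
  toFun t := ⟨t, 0, 0, 0⟩
  map_add' s t := by ext <;> simp
  map_smul' r t := by ext <;> simp

@[simp] theorem incl_x (t : BimodPow k C J n) : (incl E n t).x = t := rfl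
@[simp] theorem incl_y (t : BimodPow k C J n) : (incl E n t).y = 0 := rfl
@[simp] theorem incl_z (t : BimodPow k C J n) : (incl E n t).z = 0 := rfl
@[simp] theorem incl_w (t : BimodPow k C J n) : (incl E n t).w = 0 := rfl

theorem incl_smul (c : C) (t : BimodPow k C J n) : incl E n (c • t) = E.inC c • incl E n t := by
  ext <;> simp

theorem incl_op_smul (c : C) (t : BimodPow k C J n) :
    incl E n (MulOpposite.op c • t) = MulOpposite.op (E.inC c) • incl E n t := by
  ext <;> simp

variable (E n) in
/-- The inclusion of the component `y`. -/
def inclY : BimodPow k C J (n + 1) →ₗ[k] Res E n where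
  toFun t := ⟨0, t, 0, 0⟩
  map_add' s t := by ext <;> simp
  map_smul' r t := by ext <;> simp

variable (E n) in
/-- The inclusion of the component `z`. -/
def inclZ : BimodPow k C J (n + 1) →ₗ[k] Res E n where
  toFun t := ⟨0, 0, t, 0⟩
  map_add' s t := by ext <;> simp
  map_smul' r t := by ext <;> simp

variable (E n) in
/-- The inclusion of the component `w`. -/
def inclW : BimodPow k C J (n + 2) →ₗ[k] Res E n where
  toFun t := ⟨0, 0, 0, t⟩
  map_add' s t := by ext <;> simp
  map_smul' r t := by ext <;> simp

theorem inclY_cons (j : J) (t : BimodPow k C J n) :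
    inclY E n (cons k C J n j t) = E.inJ j • incl E n t := by
  ext <;> simp [inclY]

theorem inclZ_snoc (t : BimodPow k C J n) (j : J) :
    inclZ E n (snoc k C J n t j) = MulOpposite.op (E.inJ j) • incl E n t := by
  ext <;> simp [inclZ]

theorem inclW_cons (j : J) (t : BimodPow k C J (n + 1)) :
    inclW E n (cons k C J (n + 1) j t) = E.inJ j • inclZ E n t := by
  ext <;> simp [inclW, inclZ]

theorem eq_incl_add (p : Res E n) :
    p = incl E n p.x + inclY E n p.y + inclZ E n p.z + inclW E n p.w := by
  ext <;> simp [inclY, inclZ, inclW]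

section Extend

variable {Y : Type*} [AddCommGroup Y] [Module k Y] [Module L Y] [Module Lᵐᵒᵖ Y]
  [IsScalarTower k L Y] [IsScalarTower k Lᵐᵒᵖ Y] [SMulCommClass L Lᵐᵒᵖ Y]

/-- Maps of `L`-bimodules on the resolution are determined by their values on the generators. -/
theorem hom_ext {f g : Res E n →ₗ[k] Y} (hf : ∀ (l : L) p, f (l • p) = l • f p)
    (hf' : ∀ (l : Lᵐᵒᵖ) p, f (l • p) = l • f p) (hg : ∀ (l : L) p, g (l • p) = l • g p)
    (hg' : ∀ (l : Lᵐᵒᵖ) p, g (l • p) = l • g p) (h : ∀ t, f (incl E n t) = g (incl E n t)) :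
    f = g := by
  have hy : f ∘ₗ inclY E n = g ∘ₗ inclY E n := hom_ext_cons fun j t => by
    simp only [LinearMap.comp_apply, inclY_cons, hf, hg, h]
  have hz : f ∘ₗ inclZ E n = g ∘ₗ inclZ E n := hom_ext_snoc fun t j => by
    simp only [LinearMap.comp_apply, inclZ_snoc, hf', hg', h]
  have hw : f ∘ₗ inclW E n = g ∘ₗ inclW E n := hom_ext_cons fun j t => by
    simp only [LinearMap.comp_apply, inclW_cons, hf, hg]
    exact congrArg _ (LinearMap.congr_fun hz t)
  ext p
  rw [eq_incl_add p]
  simp only [map_add]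
  congr 1
  · congr 1
    · congr 1
      · exact h _
      · exact LinearMap.congr_fun hy _
    · exact LinearMap.congr_fun hz _
  · exact LinearMap.congr_fun hw _

variable (f : BimodPow k C J n →ₗ[k] Y) (hl : ∀ (c : C) t, f (c • t) = E.inC c • f t)
  (hr : ∀ (c : C) t, f (MulOpposite.op c • t) = MulOpposite.op (E.inC c) • f t)

/-- The map `j ⊗ t ↦ j f(t)`. -/
def extendY : BimodPow k C J (n + 1) →ₗ[k] Y :=
  liftCons (((LinearMap.lcomp k Y f).comp ((Algebra.lsmul k k Y).toLinearMap)).comp E.inJ)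
    (fun j c t => by simp [E.inJ_op_smul, hl])

@[simp] theorem extendY_cons (j : J) (t : BimodPow k C J n) :
    extendY f hl (cons k C J n j t) = E.inJ j • f t := by
  simp [extendY]

/-- The map `t ⊗ j ↦ f(t) j`. -/
def extendZ : BimodPow k C J (n + 1) →ₗ[k] Y :=
  liftSnoc (((LinearMap.lcomp k Y f).comp ((Algebra.lsmul k k Y).toLinearMap)).comp
      ((MulOpposite.opLinearEquiv k).toLinearMap.comp E.inJ)).flip
    (fun t c j => by simp [E.inJ_smul, hr])

@[simp] theorem extendZ_snoc (j : J) (t : BimodPow k C J n) :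
    extendZ f hr (snoc k C J n t j) = MulOpposite.op (E.inJ j) • f t := by
  simp [extendZ]

/-- Left `C`-linearity of `extendZ` is the balancing condition that lets `extendY` be applied to it
in the definition of `extendW`. -/
theorem extendZ_smul (hl : ∀ (c : C) t, f (c • t) = E.inC c • f t) (c : C)
    (t : BimodPow k C J (n + 1)) : extendZ f hr (c • t) = E.inC c • extendZ f hr t := by
  have h : extendZ f hr ∘ₗ leftAct k C J (n + 1) c =
      Algebra.lsmul k k Y (E.inC c) ∘ₗ extendZ f hr := hom_ext_snoc fun t j => by
    simp only [LinearMap.comp_apply, ← BimodPow.left_smul_def, smul_snoc, extendZ_snoc, hl,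
      Algebra.lsmul_coe]
    rw [smul_comm (E.inC c)]
  exact LinearMap.congr_fun h t

theorem extendZ_op_smul (c : C) (t : BimodPow k C J (n + 1)) :
    extendZ f hr (MulOpposite.op c • t) = MulOpposite.op (E.inC c) • extendZ f hr t := by
  have h : extendZ f hr ∘ₗ rightAct k C J (n + 1) (MulOpposite.op c) =
      Algebra.lsmul k k Y (MulOpposite.op (E.inC c)) ∘ₗ extendZ f hr := hom_ext_snoc fun t j => by
    simp only [LinearMap.comp_apply, ← BimodPow.right_smul_def, op_smul_snoc, extendZ_snoc,
      Algebra.lsmul_coe]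
    rw [E.inJ_op_smul, MulOpposite.op_mul, mul_smul]
  exact LinearMap.congr_fun h t

/-- The values of `extendZ` lie in `Y·J`, which `J` annihilates from the right. -/
theorem op_inJ_smul_extendZ (j : J) (t : BimodPow k C J (n + 1)) :
    MulOpposite.op (E.inJ j) • extendZ f hr t = 0 := by
  have h : Algebra.lsmul k k Y (MulOpposite.op (E.inJ j)) ∘ₗ extendZ f hr = 0 :=
    hom_ext_snoc fun t j' => by
      simp only [LinearMap.comp_apply, extendZ_snoc, Algebra.lsmul_coe]
      rw [← mul_smul, ← MulOpposite.op_mul, E.inJ_mul_inJ, MulOpposite.op_zero, zero_smul,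
        LinearMap.zero_apply]
  exact LinearMap.congr_fun h t

theorem extendY_smul (c : C) (t : BimodPow k C J (n + 1)) :
    extendY f hl (c • t) = E.inC c • extendY f hl t := by
  have h : extendY f hl ∘ₗ leftAct k C J (n + 1) c =
      Algebra.lsmul k k Y (E.inC c) ∘ₗ extendY f hl := hom_ext_cons fun j t => by
    simp only [LinearMap.comp_apply, ← BimodPow.left_smul_def, smul_cons, extendY_cons,
      Algebra.lsmul_coe]
    rw [E.inJ_smul, mul_smul]
  exact LinearMap.congr_fun h t

theorem extendY_op_smul (hr : ∀ (c : C) t, f (MulOpposite.op c • t) = MulOpposite.op (E.inC c) • f t)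
    (c : C) (t : BimodPow k C J (n + 1)) :
    extendY f hl (MulOpposite.op c • t) = MulOpposite.op (E.inC c) • extendY f hl t := by
  have h : extendY f hl ∘ₗ rightAct k C J (n + 1) (MulOpposite.op c) =
      Algebra.lsmul k k Y (MulOpposite.op (E.inC c)) ∘ₗ extendY f hl := hom_ext_cons fun j t => by
    simp only [LinearMap.comp_apply, ← BimodPow.right_smul_def, op_smul_cons, extendY_cons, hr,
      Algebra.lsmul_coe]
    rw [smul_comm]
  exact LinearMap.congr_fun h t

theorem inJ_smul_extendY (j : J) (t : BimodPow k C J (n + 1)) :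
    E.inJ j • extendY f hl t = 0 := by
  have h : Algebra.lsmul k k Y (E.inJ j) ∘ₗ extendY f hl = 0 :=
    hom_ext_cons fun j' t => by
      simp only [LinearMap.comp_apply, extendY_cons, Algebra.lsmul_coe]
      rw [← mul_smul, E.inJ_mul_inJ, zero_smul, LinearMap.zero_apply]
  exact LinearMap.congr_fun h t

/-- The map `j ⊗ t ⊗ j' ↦ j f(t) j'`. -/
def extendW : BimodPow k C J (n + 2) →ₗ[k] Y :=
  extendY (E := E) (extendZ f hr) (extendZ_smul f hr hl)

theorem extendW_cons (j : J) (t : BimodPow k C J (n + 1)) :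
    extendW f hl hr (cons k C J (n + 1) j t) = E.inJ j • extendZ f hr t :=
  extendY_cons _ _ _ _

/-- `extendW` is built by splitting off the first factor. Splitting off the last one gives the same
map because the two actions on `Y` commute; right linearity of `extend` needs this second form. -/
theorem extendW_snoc (t : BimodPow k C J (n + 1)) (j : J) :
    extendW f hl hr (snoc k C J (n + 1) t j) = MulOpposite.op (E.inJ j) • extendY f hl t := by
  have h : extendW f hl hr ∘ₗ (snoc k C J (n + 1)).flip j =
      Algebra.lsmul k k Y (MulOpposite.op (E.inJ j)) ∘ₗ extendY f hl :=
    hom_ext_cons fun j' t => by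
      simp only [LinearMap.comp_apply, LinearMap.flip_apply, ← cons_snoc, extendW_cons,
        extendY_cons, extendZ_snoc, Algebra.lsmul_coe]
      rw [smul_comm]
  exact LinearMap.congr_fun h t

/-- The extension of a map of `C`-bimodules on `J^{⊗_C (n+1)}` to a map of `L`-bimodules on
`L ⊗_C J^{⊗_C (n+1)} ⊗_C L`. -/
def extend : Res E n →ₗ[k] Y where
  toFun p := f p.x + extendY f hl p.y + extendZ f hr p.z + extendW f hl hr p.w
  map_add' p q := by
    simp only [add_x, add_y, add_z, add_w, map_add]
    abel
  map_smul' r p := by simp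

theorem extend_apply (p : Res E n) : extend f hl hr p =
    f p.x + extendY f hl p.y + extendZ f hr p.z + extendW f hl hr p.w := rfl

@[simp] theorem extend_incl (t : BimodPow k C J n) : extend f hl hr (incl E n t) = f t := by
  simp [extend_apply]

theorem extend_left_smul (l : L) (p : Res E n) :
    extend f hl hr (l • p) = l • extend f hl hr p := by
  -- The `C`-part of `l` is handled by `C`-linearity of the four pieces; the `J`-part sends the
  -- value on `x` to that on `y`, the value on `z` to that on `w`, and kills the other two.
  conv_rhs => rw [← E.inC_add_inJ l]
  simp only [extend_apply, left_smul_x, left_smul_y, left_smul_z, left_smul_w, map_add, hl,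
    extendY_smul, extendZ_smul f hr hl, extendY_cons, extendW_cons, add_smul, smul_add,
    inJ_smul_extendY]
  have h1 : extendW f hl hr (E.prC l • p.w) = E.inC (E.prC l) • extendW f hl hr p.w :=
    extendY_smul _ _ _ _
  have h2 : E.inJ (E.prJ l) • extendW f hl hr p.w = 0 := inJ_smul_extendY _ _ _ _
  rw [h1, h2]
  abel

theorem extend_right_smul (l : Lᵐᵒᵖ) (p : Res E n) :
    extend f hl hr (l • p) = l • extend f hl hr p := by
  conv_rhs => rw [← MulOpposite.op_unop l, ← E.inC_add_inJ l.unop, MulOpposite.op_add]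
  simp only [extend_apply, right_smul_x, right_smul_y, right_smul_z, right_smul_w, map_add, hr,
    extendY_op_smul f hl hr, extendZ_op_smul f hr, extendZ_snoc, extendW_snoc, add_smul, smul_add,
    op_inJ_smul_extendZ]
  have h1 : extendW f hl hr (MulOpposite.op (E.prC l.unop) • p.w) =
      MulOpposite.op (E.inC (E.prC l.unop)) • extendW f hl hr p.w :=
    extendY_op_smul _ _ (extendZ_op_smul f hr) _ _
  have h2 : MulOpposite.op (E.inJ (E.prJ l.unop)) • extendW f hl hr p.w = 0 := by
    have h : Algebra.lsmul k k Y (MulOpposite.op (E.inJ (E.prJ l.unop))) ∘ₗ extendW f hl hr = 0 :=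
      hom_ext_cons fun j' t => by
        simp only [LinearMap.comp_apply, extendW_cons, Algebra.lsmul_coe]
        rw [← smul_comm (E.inJ j'), op_inJ_smul_extendZ, smul_zero, LinearMap.zero_apply]
    exact LinearMap.congr_fun h _
  rw [h1, h2]
  abel

end Extend

end Res
end NullExt

end NullSq

end

noncomputable section

namespace NullSq

open BimodPow

/-! ### Relative projectivity of bimodules -/

section RelSplit

variable (k S T X : Type*) [Field k] [Ring S] [Algebra k S] [Ring T] [Algebra k T]
  [AddCommGroup X] [Module k X] [Module S X] [Module T X] [IsScalarTower k S X]
  [IsScalarTower k T X]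

/-- The action `s ⊗ x ↦ s x` as a linear map. -/
def actMap : S ⊗[k] X →ₗ[k] X := TensorProduct.lift (Algebra.lsmul k k X : S →ₐ[k] _).toLinearMap

/-- A linear section `X → S ⊗ X` of the action of `S` that commutes with the actions of
`S` and `T`. -/
structure IsRelSection (τ : X →ₗ[k] S ⊗[k] X) : Prop where
  smul_left : ∀ (s : S) x, τ (s • x) = s • τ x
  smul_right : ∀ (t : T) x, τ (t • x) = (Algebra.lsmul k k X t : X →ₗ[k] X).lTensor S (τ x)
  act : ∀ x, actMap k S X (τ x) = x

variable {k S T X}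

@[simp] theorem actMap_tmul (s : S) (x : X) : actMap k S X (s ⊗ₜ x) = s • x := rfl

theorem lTensor_smul_left {Y Y' : Type*} [AddCommGroup Y] [Module k Y] [AddCommGroup Y']
    [Module k Y'] (f : Y →ₗ[k] Y') (s : S) (z : S ⊗[k] Y) :
    f.lTensor S (s • z) = s • f.lTensor S z := by
  induction z with
  | zero => simp
  | add z z' h h' => simp only [smul_add, map_add, h, h']
  | tmul s' y => simp [TensorProduct.smul_tmul']

end RelSplit

section Projective

variable {k S T X : Type*} [Field k] [Ring S] [Algebra k S] [Ring T] [Algebra k T]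
  [AddCommGroup X] [Module k X] [Module S X] [Module Tᵐᵒᵖ X]
  [IsScalarTower k S X] [IsScalarTower k Tᵐᵒᵖ X] [SMulCommClass S Tᵐᵒᵖ X]

-- The splitting of the free module on the set `X` onto `X`, expressed through the separate actions
-- of `S` and `Tᵐᵒᵖ`, so that the `S ⊗ Tᵐᵒᵖ`-structure on `X` stays local to this proof.
variable (k S T X) in
theorem IsProjectiveBimodule.exists_section (h : IsProjectiveBimodule k S T X) :
    ∃ σ : X →ₗ[k] X →₀ (S ⊗[k] Tᵐᵒᵖ),
      (∀ (s : S) x, σ (s • x) = (s ⊗ₜ 1 : S ⊗[k] Tᵐᵒᵖ) • σ x) ∧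
      (∀ (t : Tᵐᵒᵖ) x, σ (t • x) = (1 ⊗ₜ t : S ⊗[k] Tᵐᵒᵖ) • σ x) ∧
      ∀ x, (Finsupp.lsum k fun y => TensorProduct.lift
        (((Algebra.lsmul k k X : S →ₐ[k] _).toLinearMap).compl₂
          ((Algebra.lsmul k k X : Tᵐᵒᵖ →ₐ[k] _).toLinearMap.flip y))) (σ x) = x := by
  let _ : Module (S ⊗[k] Tᵐᵒᵖ) X := TensorProduct.Algebra.module
  have h' : Module.Projective (S ⊗[k] Tᵐᵒᵖ) X := h
  obtain ⟨σ, hσ⟩ := Module.projective_def'.1 h'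
  have hl : ∀ (s : S) (x : X), s • x = (s ⊗ₜ 1 : S ⊗[k] Tᵐᵒᵖ) • x := fun s x => by
    rw [TensorProduct.Algebra.smul_def, one_smul]
  have hr : ∀ (t : Tᵐᵒᵖ) (x : X), t • x = (1 ⊗ₜ t : S ⊗[k] Tᵐᵒᵖ) • x := fun s x => by
    rw [TensorProduct.Algebra.smul_def, one_smul]
  refine ⟨{ toFun := σ, map_add' := map_add σ, map_smul' := fun r x => ?_ }, fun s x => ?_,
    fun t x => ?_, fun x => ?_⟩
  · have h1 : r • x = ((algebraMap k S r) ⊗ₜ 1 : S ⊗[k] Tᵐᵒᵖ) • x := by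
      rw [← hl, algebraMap_smul]
    rw [h1, map_smul, ← Algebra.TensorProduct.algebraMap_apply, algebraMap_smul]
    rfl
  · exact (congrArg σ (hl s x)).trans (map_smul σ _ x)
  · exact (congrArg σ (hr t x)).trans (map_smul σ _ x)
  · refine Eq.trans ?_ (LinearMap.congr_fun hσ x)
    change _ = Finsupp.linearCombination _ id (σ x)
    change (Finsupp.lsum k _) (σ x) = _
    rw [Finsupp.lsum_apply, Finsupp.linearCombination_apply]
    refine Finsupp.sum_congr fun y _ => ?_
    induction (σ x) y with
    | zero => exact (map_zero _).trans (zero_smul (S ⊗[k] Tᵐᵒᵖ) y).symm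
    | add e e' h h' => rw [map_add, h, h', add_smul]
    | tmul s t => rw [TensorProduct.Algebra.smul_def]; simp

theorem finsupp_tmul_induction {p : (X →₀ (S ⊗[k] Tᵐᵒᵖ)) → Prop} (f : X →₀ (S ⊗[k] Tᵐᵒᵖ))
    (h0 : p 0) (hadd : ∀ f g, p f → p g → p (f + g))
    (hs : ∀ x s t, p (Finsupp.single x (s ⊗ₜ t))) : p f := by
  induction f using Finsupp.induction_linear with
  | zero => exact h0
  | add f g hf hg => exact hadd f g hf hg
  | single x e =>
    induction e with
    | zero => rwa [Finsupp.single_zero]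
    | add e e' h h' => rw [Finsupp.single_add]; exact hadd _ _ h h'
    | tmul s t => exact hs x s t

/-- A projective bimodule has a bimodule section of the left action. -/
theorem IsProjectiveBimodule.exists_left (h : IsProjectiveBimodule k S T X) :
    ∃ τ : X →ₗ[k] S ⊗[k] X, IsRelSection k S Tᵐᵒᵖ X τ := by
  obtain ⟨σ, hs, ht, ha⟩ := h.exists_section
  -- In s ⊗ t at the basis element y, the right action of t is carried out and that of s is kept
  -- formal.
  let θ : (X →₀ (S ⊗[k] Tᵐᵒᵖ)) →ₗ[k] S ⊗[k] X := Finsupp.lsum k fun y =>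
    ((Algebra.lsmul k k X : Tᵐᵒᵖ →ₐ[k] _).toLinearMap.flip y).lTensor S
  have hθ : ∀ y s t, θ (Finsupp.single y (s ⊗ₜ t)) = s ⊗ₜ (t • y) := fun y s t => by simp [θ]
  refine ⟨θ ∘ₗ σ, fun s x => ?_, fun t x => ?_, fun x => ?_⟩
  · rw [LinearMap.comp_apply, LinearMap.comp_apply, hs]
    generalize σ x = f
    induction f using finsupp_tmul_induction with
    | h0 => simp
    | hadd f g hf hg => simp only [smul_add, map_add, hf, hg]
    | hs y s' t => simp [hθ, TensorProduct.smul_tmul']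
  · rw [LinearMap.comp_apply, LinearMap.comp_apply, ht]
    generalize σ x = f
    induction f using finsupp_tmul_induction with
    | h0 => simp
    | hadd f g hf hg => simp only [smul_add, map_add, hf, hg]
    | hs y s' t => simp [hθ, mul_smul]
  · refine Eq.trans ?_ (ha x)
    rw [LinearMap.comp_apply]
    generalize σ x = f
    induction f using finsupp_tmul_induction with
    | h0 => simp
    | hadd f g hf hg => simp only [map_add, hf, hg]
    | hs y s' t => rw [hθ]; simp

/-- A projective bimodule has a bimodule section of the right action. -/
theorem IsProjectiveBimodule.exists_right (h : IsProjectiveBimodule k S T X) :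
    ∃ τ : X →ₗ[k] Tᵐᵒᵖ ⊗[k] X, IsRelSection k Tᵐᵒᵖ S X τ := by
  obtain ⟨σ, hs, ht, ha⟩ := h.exists_section
  let θ : (X →₀ (S ⊗[k] Tᵐᵒᵖ)) →ₗ[k] Tᵐᵒᵖ ⊗[k] X := Finsupp.lsum k fun y =>
    (((Algebra.lsmul k k X : S →ₐ[k] _).toLinearMap.flip y).lTensor Tᵐᵒᵖ).comp
      (TensorProduct.comm k S Tᵐᵒᵖ).toLinearMap
  have hθ : ∀ y s t, θ (Finsupp.single y (s ⊗ₜ t)) = t ⊗ₜ (s • y) := fun y s t => by simp [θ]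
  refine ⟨θ ∘ₗ σ, fun t x => ?_, fun s x => ?_, fun x => ?_⟩
  · rw [LinearMap.comp_apply, LinearMap.comp_apply, ht]
    generalize σ x = f
    induction f using finsupp_tmul_induction with
    | h0 => simp
    | hadd f g hf hg => simp only [smul_add, map_add, hf, hg]
    | hs y s' t => simp [hθ, TensorProduct.smul_tmul']
  · rw [LinearMap.comp_apply, LinearMap.comp_apply, hs]
    generalize σ x = f
    induction f using finsupp_tmul_induction with
    | h0 => simp
    | hadd f g hf hg => simp only [smul_add, map_add, hf, hg]
    | hs y s' t => simp [hθ, mul_smul]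
  · refine Eq.trans ?_ (ha x)
    rw [LinearMap.comp_apply]
    generalize σ x = f
    induction f using finsupp_tmul_induction with
    | h0 => simp
    | hadd f g hf hg => simp only [map_add, hf, hg]
    | hs y s' t => rw [hθ]; simp [smul_comm s']

end Projective

section Sum

variable {k S T S₁ T₁ X X₁ : Type*} [Field k] [Ring S] [Algebra k S] [Ring T] [Algebra k T]
  [Ring S₁] [Algebra k S₁] [Ring T₁] [Algebra k T₁]
  [AddCommGroup X] [Module k X] [Module S X] [Module T X] [IsScalarTower k S X]
  [IsScalarTower k T X]
  [AddCommGroup X₁] [Module k X₁] [Module S₁ X₁] [Module T₁ X₁] [IsScalarTower k S₁ X₁]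
  [IsScalarTower k T₁ X₁]

/-- Transport of a section of the action to a direct sum of bimodules. -/
theorem IsRelSection.transport {τ : X₁ →ₗ[k] S₁ ⊗[k] X₁} (h : IsRelSection k S₁ T₁ X₁ τ)
    (i : X₁ →ₗ[k] X) (p : X →ₗ[k] X₁) (φ : S₁ →ₗ[k] S) (ψ : S → S₁) (χ : T → T₁)
    (hφ : ∀ s s₁, φ (ψ s * s₁) = s * φ s₁) (hi : ∀ s₁ x₁, φ s₁ • i x₁ = i (s₁ • x₁))
    (hi' : ∀ t x₁, i (χ t • x₁) = t • i x₁)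
    (hp : ∀ s x, p (s • x) = ψ s • p x) (hp' : ∀ (t : T) x, p (t • x) = χ t • p x) :
    let τ' := TensorProduct.map φ i ∘ₗ τ ∘ₗ p
    (∀ (s : S) x, τ' (s • x) = s • τ' x) ∧
    (∀ (t : T) x, τ' (t • x) = (Algebra.lsmul k k X t : X →ₗ[k] X).lTensor S (τ' x)) ∧
    ∀ x, actMap k S X (τ' x) = i (p x) := by
  intro τ'
  refine ⟨fun s x => ?_, fun t x => ?_, fun x => ?_⟩
  · simp only [τ', LinearMap.comp_apply, hp, h.smul_left]
    induction τ (p x) with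
    | zero => simp
    | add z z' h h' => simp only [smul_add, map_add, h, h']
    | tmul s₁ y => simp [TensorProduct.smul_tmul', hφ]
  · simp only [τ', LinearMap.comp_apply, hp', h.smul_right]
    induction τ (p x) with
    | zero => simp
    | add z z' h h' => simp only [map_add, h, h']
    | tmul s₁ y => simp [hi']
  · conv_rhs => rw [← h.act (p x)]
    simp only [τ', LinearMap.comp_apply]
    induction τ (p x) with
    | zero => simp
    | add z z' h h' => simp only [map_add, h, h']
    | tmul s₁ y => simp [hi]

/-- Each summand supplies a section only up to its projection, as `IsRelSection.transport` produces
it; complementary projections add up to the identity. -/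
theorem IsRelSection.add {τ τ' : X →ₗ[k] S ⊗[k] X} {q q' : X → X}
    (h : (∀ (s : S) x, τ (s • x) = s • τ x) ∧
      (∀ (t : T) x, τ (t • x) = (Algebra.lsmul k k X t : X →ₗ[k] X).lTensor S (τ x)) ∧
      ∀ x, actMap k S X (τ x) = q x)
    (h' : (∀ (s : S) x, τ' (s • x) = s • τ' x) ∧
      (∀ (t : T) x, τ' (t • x) = (Algebra.lsmul k k X t : X →ₗ[k] X).lTensor S (τ' x)) ∧
      ∀ x, actMap k S X (τ' x) = q' x)
    (hq : ∀ x, q x + q' x = x) : IsRelSection k S T X (τ + τ') where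
  smul_left s x := by simp [h.1, h'.1]
  smul_right t x := by simp [h.2.1, h'.2.1]
  act x := by simp [h.2.2, h'.2.2, hq]

end Sum

/-! ### Sections of the actions on tensor powers. -/

section Pow

variable {k C J : Type*} [Field k] [Ring C] [Algebra k C]
  [AddCommGroup J] [Module k J] [Module C J] [Module Cᵐᵒᵖ J] [IsScalarTower k C J]
  [IsScalarTower k Cᵐᵒᵖ J] [SMulCommClass C Cᵐᵒᵖ J]

/-- The section is applied to the first factor. It commutes with the right action on that factor, so
it descends to the tensor product over `C`; the right action on the last factor is untouched. -/
theorem BimodPow.exists_left {τ : J →ₗ[k] C ⊗[k] J} (h : IsRelSection k C Cᵐᵒᵖ J τ) (n : ℕ) :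
    ∃ τ' : BimodPow k C J n →ₗ[k] C ⊗[k] BimodPow k C J n,
      IsRelSection k C Cᵐᵒᵖ (BimodPow k C J n) τ' := by
  cases n with
  | zero =>
    have := IsRelSection.transport (S := C) (T := Cᵐᵒᵖ) h (single k C J).toLinearMap
      (single k C J).symm.toLinearMap LinearMap.id id id (fun _ _ => rfl) (fun s x => smul_single _ _)
      (fun t x => (op_smul_single _ _).symm) (fun s x => by
        simp [LinearEquiv.symm_apply_eq, ← smul_single]) (fun s x => by
        simp [LinearEquiv.symm_apply_eq, ← op_smul_single])
    exact ⟨_, this.1, this.2.1, fun x => (this.2.2 x).trans ((single k C J).apply_symm_apply x)⟩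
  | succ n =>
    let φ : J →ₗ[k] BimodPow k C J n →ₗ[k] C ⊗[k] BimodPow k C J (n + 1) :=
      ((LinearMap.lcomp k _ τ).comp
        ((LinearMap.lTensorHom C).comp (cons k C J n).flip)).flip
    have hφ : ∀ j t, φ j t = ((cons k C J n).flip t).lTensor C (τ j) := fun j t => rfl
    have hb : ∀ j (c : C) t, φ (MulOpposite.op c • j) t = φ j (c • t) := fun j c t => by
      rw [hφ, hφ, h.smul_right, ← LinearMap.lTensor_comp_apply]
      congr 2
      ext j'
      simp [cons_op_smul]
    refine ⟨liftCons φ hb, fun c t => ?_, fun c t => ?_, fun t => ?_⟩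
    · have H : liftCons φ hb ∘ₗ leftAct k C J (n + 1) c =
          Algebra.lsmul k k (C ⊗[k] BimodPow k C J (n + 1)) c ∘ₗ liftCons φ hb :=
        hom_ext_cons fun j t => by
          simp only [LinearMap.comp_apply, ← BimodPow.left_smul_def, smul_cons, liftCons_cons,
            hφ, h.smul_left, Algebra.lsmul_coe, lTensor_smul_left]
      exact LinearMap.congr_fun H t
    · have H : liftCons φ hb ∘ₗ rightAct k C J (n + 1) c =
          (Algebra.lsmul k k (BimodPow k C J (n + 1)) c : _ →ₗ[k] _).lTensor C ∘ₗ
            liftCons φ hb :=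
        hom_ext_cons fun j t => by
          simp only [LinearMap.comp_apply, ← BimodPow.right_smul_def, op_smul_cons, liftCons_cons,
            hφ]
          rw [← LinearMap.lTensor_comp_apply]
          congr 2
          ext j'
          simp
      exact LinearMap.congr_fun H t
    · have H : actMap k C _ ∘ₗ liftCons φ hb = LinearMap.id :=
        hom_ext_cons fun j t => by
          rw [LinearMap.comp_apply, liftCons_cons, hφ, LinearMap.id_apply]
          conv_rhs => rw [← h.act j]
          induction τ j with
          | zero => simp
          | add z z' h h' => simp only [map_add, h, h', LinearMap.add_apply]
          | tmul s₁ y => simp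
      exact LinearMap.congr_fun H t

/-- The same with the last factor, whose left action the section respects. -/
theorem BimodPow.exists_right {τ : J →ₗ[k] Cᵐᵒᵖ ⊗[k] J} (h : IsRelSection k Cᵐᵒᵖ C J τ) (n : ℕ) :
    ∃ τ' : BimodPow k C J n →ₗ[k] Cᵐᵒᵖ ⊗[k] BimodPow k C J n,
      IsRelSection k Cᵐᵒᵖ C (BimodPow k C J n) τ' := by
  cases n with
  | zero =>
    have := IsRelSection.transport (S := Cᵐᵒᵖ) (T := C) h (single k C J).toLinearMap
      (single k C J).symm.toLinearMap LinearMap.id id id (fun _ _ => rfl)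
      (fun s x => op_smul_single _ _)
      (fun t x => (smul_single _ _).symm) (fun s x => by
        simp [LinearEquiv.symm_apply_eq, ← op_smul_single]) (fun s x => by
        simp [LinearEquiv.symm_apply_eq, ← smul_single])
    exact ⟨_, this.1, this.2.1, fun x => (this.2.2 x).trans ((single k C J).apply_symm_apply x)⟩
  | succ n =>
    let φ : BimodPow k C J n →ₗ[k] J →ₗ[k] Cᵐᵒᵖ ⊗[k] BimodPow k C J (n + 1) :=
      (LinearMap.lcomp k _ τ).comp ((LinearMap.lTensorHom Cᵐᵒᵖ).comp (snoc k C J n))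
    have hφ : ∀ t j, φ t j = (snoc k C J n t).lTensor Cᵐᵒᵖ (τ j) := fun j t => rfl
    have hb : ∀ t (c : C) j, φ (MulOpposite.op c • t) j = φ t (c • j) := fun t c j => by
      rw [hφ, hφ, h.smul_right, ← LinearMap.lTensor_comp_apply]
      congr 2
      ext j'
      simp [snoc_op_smul]
    refine ⟨liftSnoc φ hb, fun c t => ?_, fun c t => ?_, fun t => ?_⟩
    · have H : liftSnoc φ hb ∘ₗ rightAct k C J (n + 1) c =
          Algebra.lsmul k k (Cᵐᵒᵖ ⊗[k] BimodPow k C J (n + 1)) c ∘ₗ liftSnoc φ hb :=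
        hom_ext_snoc fun t j => by
          simp only [LinearMap.comp_apply, ← BimodPow.right_smul_def, op_smul_snoc, liftSnoc_snoc,
            hφ, h.smul_left, Algebra.lsmul_coe, lTensor_smul_left]
      exact LinearMap.congr_fun H t
    · have H : liftSnoc φ hb ∘ₗ leftAct k C J (n + 1) c =
          (Algebra.lsmul k k (BimodPow k C J (n + 1)) c : _ →ₗ[k] _).lTensor Cᵐᵒᵖ ∘ₗ
            liftSnoc φ hb :=
        hom_ext_snoc fun t j => by
          simp only [LinearMap.comp_apply, ← BimodPow.left_smul_def, smul_snoc, liftSnoc_snoc,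
            hφ]
          rw [← LinearMap.lTensor_comp_apply]
          congr 2
          ext j'
          simp
      exact LinearMap.congr_fun H t
    · have H : actMap k Cᵐᵒᵖ _ ∘ₗ liftSnoc φ hb = LinearMap.id :=
        hom_ext_snoc fun t j => by
          rw [LinearMap.comp_apply, liftSnoc_snoc, hφ, LinearMap.id_apply]
          conv_rhs => rw [← h.act j]
          induction τ j with
          | zero => simp
          | add z z' h h' => simp only [map_add, h, h']
          | tmul s₁ y => simp
      exact LinearMap.congr_fun H t

end Pow

end NullSq

end

noncomputable section

namespace NullSq

open BimodPow

/-! ### Projectivity of the terms of the resolution -/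

section FreeBimod

/-- The free `L`-bimodule on a vector space `V`. -/
def FreeBimod (k L V : Type*) [Field k] [Ring L] [Algebra k L] [AddCommGroup V] [Module k V] :
    Type _ := (L ⊗[k] Lᵐᵒᵖ) ⊗[k] V

variable (k L V : Type*) [Field k] [Ring L] [Algebra k L] [AddCommGroup V] [Module k V]

namespace FreeBimod

instance : AddCommGroup (FreeBimod k L V) :=
  inferInstanceAs (AddCommGroup ((L ⊗[k] Lᵐᵒᵖ) ⊗[k] V))

instance : Module k (FreeBimod k L V) :=
  inferInstanceAs (Module k ((L ⊗[k] Lᵐᵒᵖ) ⊗[k] V))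

instance : Module (L ⊗[k] Lᵐᵒᵖ) (FreeBimod k L V) :=
  inferInstanceAs (Module (L ⊗[k] Lᵐᵒᵖ) ((L ⊗[k] Lᵐᵒᵖ) ⊗[k] V))

instance : IsScalarTower k (L ⊗[k] Lᵐᵒᵖ) (FreeBimod k L V) :=
  inferInstanceAs (IsScalarTower k (L ⊗[k] Lᵐᵒᵖ) ((L ⊗[k] Lᵐᵒᵖ) ⊗[k] V))

instance : Module.Free (L ⊗[k] Lᵐᵒᵖ) (FreeBimod k L V) :=
  inferInstanceAs (Module.Free (L ⊗[k] Lᵐᵒᵖ) ((L ⊗[k] Lᵐᵒᵖ) ⊗[k] V))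

instance : Module L (FreeBimod k L V) :=
  Module.compHom _ (Algebra.TensorProduct.includeLeft : L →ₐ[k] L ⊗[k] Lᵐᵒᵖ).toRingHom

instance : Module Lᵐᵒᵖ (FreeBimod k L V) :=
  Module.compHom _ (Algebra.TensorProduct.includeRight : Lᵐᵒᵖ →ₐ[k] L ⊗[k] Lᵐᵒᵖ).toRingHom

variable {k L V}

theorem left_smul_eq (l : L) (x : FreeBimod k L V) :
    l • x = (l ⊗ₜ 1 : L ⊗[k] Lᵐᵒᵖ) • x := rfl

theorem right_smul_eq (l : Lᵐᵒᵖ) (x : FreeBimod k L V) :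
    l • x = (1 ⊗ₜ l : L ⊗[k] Lᵐᵒᵖ) • x := rfl

instance : IsScalarTower k L (FreeBimod k L V) :=
  ⟨fun r l x => by
    rw [left_smul_eq, left_smul_eq, ← smul_assoc, TensorProduct.smul_tmul']⟩

instance : IsScalarTower k Lᵐᵒᵖ (FreeBimod k L V) :=
  ⟨fun r l x => by
    rw [right_smul_eq, right_smul_eq, ← smul_assoc, TensorProduct.tmul_smul]⟩

instance : SMulCommClass L Lᵐᵒᵖ (FreeBimod k L V) :=
  ⟨fun l l' x => by
    rw [left_smul_eq, right_smul_eq, right_smul_eq, left_smul_eq, ← mul_smul, ← mul_smul]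
    simp⟩

variable (k) in
/-- The element `(l ⊗ l') ⊗ v`. -/
def mk (l : L) (l' : Lᵐᵒᵖ) (v : V) : FreeBimod k L V :=
  ((l ⊗ₜ l') ⊗ₜ v : (L ⊗[k] Lᵐᵒᵖ) ⊗[k] V)

theorem left_smul_mk (l l₁ : L) (l₂ : Lᵐᵒᵖ) (v : V) : l • mk k l₁ l₂ v = mk k (l * l₁) l₂ v := by
  refine (TensorProduct.smul_tmul' (l ⊗ₜ 1 : L ⊗[k] Lᵐᵒᵖ) (l₁ ⊗ₜ l₂ : L ⊗[k] Lᵐᵒᵖ) v).trans ?_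
  rw [smul_eq_mul, Algebra.TensorProduct.tmul_mul_tmul, one_mul]
  rfl

theorem right_smul_mk (l₁ : L) (l l₂ : Lᵐᵒᵖ) (v : V) :
    l • mk k l₁ l₂ v = mk k l₁ (l * l₂) v := by
  refine (TensorProduct.smul_tmul' (1 ⊗ₜ l : L ⊗[k] Lᵐᵒᵖ) (l₁ ⊗ₜ l₂ : L ⊗[k] Lᵐᵒᵖ) v).trans ?_
  rw [smul_eq_mul, Algebra.TensorProduct.tmul_mul_tmul, one_mul]
  rfl

/-- `toBimod` rebuilds the `L ⊗ Lᵐᵒᵖ`-action from the two one-sided ones. It must agree with the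
original action before freeness gives projectivity in the sense of `IsProjectiveBimodule`. -/
theorem moduleAux_eq (e : L ⊗[k] Lᵐᵒᵖ) (x : FreeBimod k L V) :
    TensorProduct.Algebra.moduleAux e x = e • x := by
  induction e with
  | zero =>
    rw [map_zero, LinearMap.zero_apply]
    exact (zero_smul (L ⊗[k] Lᵐᵒᵖ) x).symm
  | add e e' h h' => simp only [map_add, LinearMap.add_apply, add_smul, h, h']
  | tmul l l' =>
    rw [TensorProduct.Algebra.moduleAux_apply, left_smul_eq, right_smul_eq, ← mul_smul,
      Algebra.TensorProduct.tmul_mul_tmul, mul_one, one_mul]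

variable (k L V) in
theorem isProjective : IsProjectiveBimodule k L L (FreeBimod k L V) := by
  let e : FreeBimod k L V ≃ₗ[L ⊗[k] Lᵐᵒᵖ] toBimod k L L (FreeBimod k L V) :=
    { AddEquiv.refl (FreeBimod k L V) with
      map_smul' := fun e x => (moduleAux_eq e x).symm }
  exact Module.Projective.of_equiv e

@[elab_as_elim]
theorem induction_on {p : FreeBimod k L V → Prop} (x : FreeBimod k L V) (h0 : p 0)
    (hadd : ∀ x y, p x → p y → p (x + y))
    (ht : ∀ l l' v, p (mk k l l' v)) : p x := by
  induction x using TensorProduct.induction_on with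
  | zero => exact h0
  | add x y hx hy => exact hadd x y hx hy
  | tmul e v =>
    induction e with
    | zero => rw [TensorProduct.zero_tmul]; exact h0
    | add e e' h h' => rw [TensorProduct.add_tmul]; exact hadd _ _ h h'
    | tmul l l' => exact ht l l' v

variable {Y : Type*} [AddCommGroup Y] [Module k Y] [Module L Y] [Module Lᵐᵒᵖ Y]
  [IsScalarTower k L Y] [IsScalarTower k Lᵐᵒᵖ Y] [SMulCommClass L Lᵐᵒᵖ Y]

/-- The map of bimodules that extends a linear map. -/
def lift (f : V →ₗ[k] Y) : FreeBimod k L V →ₗ[k] Y :=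
  TensorProduct.lift ((TensorProduct.lift ((LinearMap.mul k (Module.End k Y)).compl₁₂
    (Algebra.lsmul k k Y : L →ₐ[k] _).toLinearMap
    (Algebra.lsmul k k Y : Lᵐᵒᵖ →ₐ[k] _).toLinearMap)).compl₂ f)

theorem lift_mk (f : V →ₗ[k] Y) (l : L) (l' : Lᵐᵒᵖ) (v : V) :
    lift f (mk k l l' v) = l • l' • f v := rfl

theorem lift_left_smul (f : V →ₗ[k] Y) (l : L) (x : FreeBimod k L V) :
    lift f (l • x) = l • lift f x := by
  induction x using induction_on with
  | h0 => simp
  | hadd x y hx hy => simp only [smul_add, map_add, hx, hy]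
  | ht l₁ l₂ v => rw [left_smul_mk, lift_mk, lift_mk, mul_smul]

theorem lift_right_smul (f : V →ₗ[k] Y) (l : Lᵐᵒᵖ) (x : FreeBimod k L V) :
    lift f (l • x) = l • lift f x := by
  induction x using induction_on with
  | h0 => simp
  | hadd x y hx hy => simp only [smul_add, map_add, hx, hy]
  | ht l₁ l₂ v => rw [right_smul_mk, lift_mk, lift_mk, mul_smul, smul_comm l₁ l]

end FreeBimod

end FreeBimod

namespace NullExt

variable {k L C J : Type*} [Field k] [Ring L] [Algebra k L] [Ring C] [Algebra k C]
  [AddCommGroup J] [Module k J] [Module C J] [Module Cᵐᵒᵖ J] [IsScalarTower k C J]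
  [IsScalarTower k Cᵐᵒᵖ J] [SMulCommClass C Cᵐᵒᵖ J] (E : NullExt k L C J)

/-- The map `(c ⊗ c') ⊗ v ↦ (c ⊗ c') ⊗ v` from `C ⊗ (Cᵐᵒᵖ ⊗ V)` to the free `L`-bimodule. -/
def toFree (V : Type*) [AddCommGroup V] [Module k V] :
    C ⊗[k] (Cᵐᵒᵖ ⊗[k] V) →ₗ[k] FreeBimod k L V :=
  ((TensorProduct.map E.inC.toLinearMap (AlgHom.op E.inC).toLinearMap).rTensor V).comp
    (TensorProduct.assoc k C Cᵐᵒᵖ V).symm.toLinearMap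

theorem toFree_tmul {V : Type*} [AddCommGroup V] [Module k V] (c : C) (c' : Cᵐᵒᵖ) (v : V) :
    E.toFree V (c ⊗ₜ (c' ⊗ₜ v)) =
      FreeBimod.mk k (E.inC c) (MulOpposite.op (E.inC c'.unop)) v := rfl

/-- Composing the left and right sections gives a `C`-bimodule map from T = J^{⊗(n+1)} to C ⊗ Cᵐᵒᵖ ⊗
T that splits the action. Pushed into the free `L`-bimodule on T and extended to `Res`, it splits
the map from that free bimodule onto `Res`; on generators this is the splitting over `C`. -/
theorem Res.isProjective {τ : J →ₗ[k] C ⊗[k] J} (h : IsRelSection k C Cᵐᵒᵖ J τ)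
    {τ' : J →ₗ[k] Cᵐᵒᵖ ⊗[k] J} (h' : IsRelSection k Cᵐᵒᵖ C J τ') (n : ℕ) :
    IsProjectiveBimodule k L L (Res E n) := by
  obtain ⟨σ, hσ⟩ := BimodPow.exists_left h n
  obtain ⟨σ', hσ'⟩ := BimodPow.exists_right h' n
  let g : C ⊗[k] BimodPow k C J n →ₗ[k] FreeBimod k L (BimodPow k C J n) :=
    (E.toFree _).comp (σ'.lTensor C)
  have hg : ∀ c x, g (c ⊗ₜ x) = E.toFree _ (c ⊗ₜ (σ' x)) := fun c x => rfl
  have hl : ∀ (c : C) t, g (σ (c • t)) = E.inC c • g (σ t) := fun c t => by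
    rw [hσ.smul_left]
    induction σ t with
    | zero => simp
    | add z z' h h' => simp only [smul_add, map_add, h, h']
    | tmul c₁ y =>
      rw [TensorProduct.smul_tmul', hg, hg]
      induction σ' y with
      | zero => simp
      | add z z' h h' => simp only [TensorProduct.tmul_add, smul_add, map_add, h, h']
      | tmul c₂ y => rw [toFree_tmul, toFree_tmul, FreeBimod.left_smul_mk, smul_eq_mul, map_mul]
  have hr : ∀ (c : C) t, g (σ (MulOpposite.op c • t)) = MulOpposite.op (E.inC c) • g (σ t) :=
    fun c t => by
      rw [hσ.smul_right]
      induction σ t with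
      | zero => simp
      | add z z' h h' => simp only [smul_add, map_add, h, h']
      | tmul c₁ y =>
        rw [LinearMap.lTensor_tmul, hg, hg, Algebra.lsmul_coe, hσ'.smul_left]
        induction σ' y with
        | zero => simp
        | add z z' h h' => simp only [TensorProduct.tmul_add, smul_add, map_add, h, h']
        | tmul c₂ y =>
          rw [TensorProduct.smul_tmul', toFree_tmul, toFree_tmul, FreeBimod.right_smul_mk,
            smul_eq_mul, MulOpposite.unop_mul, map_mul, MulOpposite.op_mul, MulOpposite.unop_op]
  have ha : ∀ t, FreeBimod.lift (incl E n) (g (σ t)) = incl E n t := fun t => by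
    conv_rhs => rw [← hσ.act t]
    induction σ t with
    | zero => simp
    | add z z' h h' => simp only [map_add, h, h']
    | tmul c₁ y =>
      rw [hg, actMap_tmul, incl_smul]
      conv_rhs => rw [← hσ'.act y]
      induction σ' y with
      | zero => simp
      | add z z' h h' => simp only [TensorProduct.tmul_add, smul_add, map_add, h, h']
      | tmul c₂ y =>
        rw [toFree_tmul, FreeBimod.lift_mk, actMap_tmul, ← incl_op_smul, MulOpposite.op_unop]
  have hfree := FreeBimod.isProjective k L (BimodPow k C J n)
  unfold IsProjectiveBimodule at hfree ⊢
  refine Module.Projective.of_split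
    (toBimodMap (extend (g ∘ₗ σ) hl hr) (extend_left_smul _ _ _) (extend_right_smul _ _ _))
    (toBimodMap (FreeBimod.lift (incl E n)) (FreeBimod.lift_left_smul _)
      (FreeBimod.lift_right_smul _)) ?_
  have H : FreeBimod.lift (incl E n) ∘ₗ extend (g ∘ₗ σ) hl hr = LinearMap.id :=
    hom_ext
      (fun l p => by
        rw [LinearMap.comp_apply, extend_left_smul, FreeBimod.lift_left_smul, LinearMap.comp_apply])
      (fun l p => by
        rw [LinearMap.comp_apply, extend_right_smul, FreeBimod.lift_right_smul,
          LinearMap.comp_apply])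
      (fun l p => rfl) (fun l p => rfl)
      (fun t => by
        rw [LinearMap.comp_apply, extend_incl, LinearMap.comp_apply, ha, LinearMap.id_apply])
  exact LinearMap.ext fun p => LinearMap.congr_fun H p

end NullExt

end NullSq

end

noncomputable section

namespace NullSq

open BimodPow

/-! ### The augmentation -/

@[elab_as_elim]
theorem BimodTensor.induction_tmul {k S R T X Y : Type*} [Field k] [Ring S] [Algebra k S] [Ring R]
    [Algebra k R] [Ring T] [Algebra k T]
    [AddCommGroup X] [Module k X] [Module S X] [Module Rᵐᵒᵖ X]
    [AddCommGroup Y] [Module k Y] [Module R Y] [Module Tᵐᵒᵖ Y]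
    {p : BimodTensor k S R T X Y → Prop} (z : BimodTensor k S R T X Y) (zero : p 0)
    (add : ∀ z z', p z → p z' → p (z + z')) (tmul : ∀ x y, p (tmul k S R T x y)) : p z := by
  obtain ⟨z, rfl⟩ : ∃ z', mk k S R T X Y z' = z := Submodule.mkQ_surjective _ z
  induction z with
  | zero => rwa [map_zero]
  | add z z' h h' => rw [map_add]; exact add _ _ h h'
  | tmul x y => exact tmul x y

namespace NullExt

variable {k L C J : Type*} [Field k] [Ring L] [Algebra k L] [Ring C] [Algebra k C]
  [AddCommGroup J] [Module k J] [Module C J] [Module Cᵐᵒᵖ J] [IsScalarTower k C J]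
  [IsScalarTower k Cᵐᵒᵖ J] [SMulCommClass C Cᵐᵒᵖ J] (E : NullExt k L C J)
  (D : Subalgebra k L)

/-- The map `j ↦ j ⊗ 1 - 1 ⊗ j`. -/
def commMap : J →ₗ[k] RelTensor k D :=
  ((BimodTensor.tmulₗ k L D L).flip (1 : L) - BimodTensor.tmulₗ k L D L (1 : L)).comp E.inJ

theorem commMap_apply (j : J) : E.commMap D j =
    BimodTensor.tmul k L D L (E.inJ j) (1 : L) - BimodTensor.tmul k L D L (1 : L) (E.inJ j) := rfl

variable {D}

theorem relTensor_smul_right (x y z : L) (hz : z ∈ D) :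
    BimodTensor.tmul k L D L (x * z) y = BimodTensor.tmul k L D L x (z * y) :=
  BimodTensor.tmul_smul k L D L x ⟨z, hz⟩ y

/-- Elements of `C` pass through the middle of `L ⊗_D L`, so c ⊗ j = 1 ⊗ c j. -/
theorem commMap_smul (hD : ∀ c, E.inC c ∈ D) (c : C) (j : J) :
    E.commMap D (c • j) = E.inC c • E.commMap D j := by
  rw [commMap_apply, commMap_apply, smul_sub, BimodTensor.left_smul_tmul,
    BimodTensor.left_smul_tmul, E.inJ_smul, ← relTensor_smul_right 1 _ _ (hD c), smul_eq_mul,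
    smul_eq_mul, one_mul, mul_one]

theorem commMap_op_smul (hD : ∀ c, E.inC c ∈ D) (c : C) (j : J) :
    E.commMap D (MulOpposite.op c • j) = MulOpposite.op (E.inC c) • E.commMap D j := by
  rw [commMap_apply, commMap_apply, smul_sub, BimodTensor.right_smul_tmul,
    BimodTensor.right_smul_tmul, E.inJ_op_smul, relTensor_smul_right _ _ _ (hD c)]
  simp

variable (D) in
/-- The map `j ↦ j ⊗ 1 - 1 ⊗ j` on the tensor power with one factor. -/
def augAux : BimodPow k C J 0 →ₗ[k] RelTensor k D :=
  (E.commMap D).comp (single k C J).symm.toLinearMap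

@[simp] theorem augAux_single (j : J) : E.augAux D (single k C J j) = E.commMap D j := by
  simp [augAux]

theorem augAux_smul (hD : ∀ c, E.inC c ∈ D) (c : C) (t : BimodPow k C J 0) :
    E.augAux D (c • t) = E.inC c • E.augAux D t := by
  obtain ⟨j, rfl⟩ := (single k C J).surjective t
  rw [smul_single, augAux_single, augAux_single, commMap_smul _ hD]

theorem augAux_op_smul (hD : ∀ c, E.inC c ∈ D) (c : C) (t : BimodPow k C J 0) :
    E.augAux D (MulOpposite.op c • t) = MulOpposite.op (E.inC c) • E.augAux D t := by
  obtain ⟨j, rfl⟩ := (single k C J).surjective t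
  rw [op_smul_single, augAux_single, augAux_single, commMap_op_smul _ hD]

/-- The map `L ⊗_C J ⊗_C L → L ⊗_C L` given by `j ↦ j ⊗ 1 - 1 ⊗ j`. -/
def aug (hD : ∀ c, E.inC c ∈ D) : Res E 0 →ₗ[k] RelTensor k D :=
  Res.extend (E.augAux D) (E.augAux_smul hD) (E.augAux_op_smul hD)

variable (hD : ∀ c, E.inC c ∈ D)

/-- Expanding j (j' ⊗ 1 - 1 ⊗ j') leaves -j ⊗ j', since j j' = 0. From the right, (j ⊗ 1 - 1 ⊗ j) j'
leaves +j ⊗ j'; hence the opposite signs on `y` and `z`. -/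
theorem augY_cons (j j' : J) :
    Res.extendY (E.augAux D) (E.augAux_smul hD) (cons k C J 0 j (single k C J j')) =
      -BimodTensor.tmul k L D L (E.inJ j) (E.inJ j') := by
  rw [Res.extendY_cons, augAux_single, commMap_apply, smul_sub, BimodTensor.left_smul_tmul,
    BimodTensor.left_smul_tmul, smul_eq_mul, smul_eq_mul, inJ_mul_inJ, mul_one]
  simp [BimodTensor.tmul]

theorem augZ_cons (j j' : J) :
    Res.extendZ (E.augAux D) (E.augAux_op_smul hD) (cons k C J 0 j (single k C J j')) =
      BimodTensor.tmul k L D L (E.inJ j) (E.inJ j') := by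
  rw [cons_single, Res.extendZ_snoc, augAux_single, commMap_apply, smul_sub,
    BimodTensor.right_smul_tmul, BimodTensor.right_smul_tmul, op_smul_eq_mul, op_smul_eq_mul,
    inJ_mul_inJ, one_mul]
  simp [BimodTensor.tmul]

theorem hom_ext_pair {Z : Type*} [AddCommGroup Z] [Module k Z] {f g : BimodPow k C J 1 →ₗ[k] Z}
    (h : ∀ j j', f (cons k C J 0 j (single k C J j')) = g (cons k C J 0 j (single k C J j'))) :
    f = g :=
  hom_ext_cons fun j t => by
    obtain ⟨j', rfl⟩ := (single k C J).surjective t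
    exact h j j'

theorem augY_eq : Res.extendY (E.augAux D) (E.augAux_smul hD) =
    -Res.extendZ (E.augAux D) (E.augAux_op_smul hD) :=
  hom_ext_pair fun j j' => by
    rw [LinearMap.neg_apply, augY_cons E hD, augZ_cons E hD]

theorem augW_eq : Res.extendW (E.augAux D) (E.augAux_smul hD) (E.augAux_op_smul hD) = 0 :=
  hom_ext_cons fun j t => by
    rw [Res.extendW_cons, LinearMap.zero_apply]
    have h : Algebra.lsmul k k (RelTensor k D) (E.inJ j) ∘ₗ
        Res.extendZ (E.augAux D) (E.augAux_op_smul hD) = 0 := hom_ext_pair fun j₁ j₂ => by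
      rw [LinearMap.comp_apply, augZ_cons E hD]
      change E.inJ j • BimodTensor.tmul k L D L (E.inJ j₁) (E.inJ j₂) = _
      rw [BimodTensor.left_smul_tmul, smul_eq_mul, inJ_mul_inJ]
      simp [BimodTensor.tmul]
    exact LinearMap.congr_fun h t

theorem aug_apply (p : Res E 0) : E.aug hD p =
    E.augAux D p.x + Res.extendZ (E.augAux D) (E.augAux_op_smul hD) (p.z - p.y) := by
  rw [aug, Res.extend_apply, augY_eq E hD, augW_eq E hD, map_sub, LinearMap.neg_apply,
    LinearMap.zero_apply]
  abel

theorem prJ_eq_zero (hD' : ∀ d ∈ D, ∃ c, E.inC c = d) (d : D) : E.prJ d = 0 := by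
  obtain ⟨c, hc⟩ := hD' d d.2
  rw [← hc, E.prJ_inC]

/-- The projection `L ⊗_C L → J ⊗_C C = J`. -/
def projLeft (hD' : ∀ d ∈ D, ∃ c, E.inC c = d) : RelTensor k D →ₗ[k] J :=
  BimodTensor.lift k L D L
    (((Algebra.lsmul k k J : Cᵐᵒᵖ →ₐ[k] _).toLinearMap.comp
      ((MulOpposite.opLinearEquiv k).toLinearMap.comp E.prC.toLinearMap)).flip.comp E.prJ)
    (fun x d y => by
      simp [op_smul_eq, Subalgebra.smul_def, E.prJ_eq_zero hD'])

/-- The projection `L ⊗_C L → J ⊗_C J`. -/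
def projPair (hD' : ∀ d ∈ D, ∃ c, E.inC c = d) : RelTensor k D →ₗ[k] BimodPow k C J 1 :=
  BimodTensor.lift k L D L
    ((cons k C J 0).compl₁₂ E.prJ ((single k C J).toLinearMap.comp E.prJ))
    (fun x d y => by
      simp [op_smul_eq, Subalgebra.smul_def, E.prJ_eq_zero hD', cons_op_smul, smul_single])

/-- `projLeft` takes j ⊗ 1 - 1 ⊗ j to j and kills J ⊗ J, so it recovers x. With x = 0, `projPair`
recovers z - y, on which alone the rest depends. -/
theorem aug_eq_zero_iff (hD' : ∀ d ∈ D, ∃ c, E.inC c = d) (p : Res E 0) :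
    E.aug hD p = 0 ↔ p.x = 0 ∧ p.z = p.y := by
  constructor
  · intro h
    rw [aug_apply] at h
    have h1 : E.projLeft hD' ∘ₗ E.augAux D = (single k C J).symm.toLinearMap := by
      ext t
      obtain ⟨j, rfl⟩ := (single k C J).surjective t
      rw [LinearMap.comp_apply, augAux_single, commMap_apply]
      simp [projLeft]
    have h2 : E.projLeft hD' ∘ₗ Res.extendZ (E.augAux D) (E.augAux_op_smul hD) = 0 :=
      hom_ext_pair fun j₁ j₂ => by
        rw [LinearMap.comp_apply, augZ_cons E hD]
        simp [projLeft]
    have h3 : E.projPair hD' ∘ₗ Res.extendZ (E.augAux D) (E.augAux_op_smul hD) = LinearMap.id :=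
      hom_ext_pair fun j₁ j₂ => by
        rw [LinearMap.comp_apply, augZ_cons E hD]
        simp [projPair]
    have hx : p.x = 0 := by
      have := congrArg (E.projLeft hD') h
      rw [map_add, map_zero, ← LinearMap.comp_apply, ← LinearMap.comp_apply, h1, h2] at this
      simpa using this
    refine ⟨hx, ?_⟩
    rw [hx, map_zero, zero_add] at h
    have := congrArg (E.projPair hD') h
    rw [← LinearMap.comp_apply, h3, map_zero] at this
    exact sub_eq_zero.1 this
  · rintro ⟨hx, hz⟩
    rw [aug_apply, hx, hz, sub_self, map_zero, map_zero, add_zero]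

theorem mulMap_left_smul (l : L) (z : RelTensor k D) : mulMap k D (l • z) = l * mulMap k D z :=
  LinearMap.congr_fun
    (f := mulMap k D ∘ₗ BimodTensor.leftAct k L D L L L l)
    (g := Algebra.lsmul k k L l ∘ₗ mulMap k D)
    (BimodTensor.hom_ext fun x y => mul_assoc l x y) z

theorem mulMap_right_smul (l : Lᵐᵒᵖ) (z : RelTensor k D) :
    mulMap k D (l • z) = l • mulMap k D z :=
  LinearMap.congr_fun
    (f := mulMap k D ∘ₗ BimodTensor.rightAct k L D L L L l)
    (g := Algebra.lsmul k k L l ∘ₗ mulMap k D)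
    (BimodTensor.hom_ext fun x y => (mul_assoc x y l.unop).symm) z

theorem mulMap_aug (p : Res E 0) : mulMap k D (E.aug hD p) = 0 := by
  have h : mulMap k D ∘ₗ E.aug hD = 0 := Res.hom_ext
    (fun l p => by
      rw [LinearMap.comp_apply, aug, Res.extend_left_smul, mulMap_left_smul]
      rfl)
    (fun l p => by
      rw [LinearMap.comp_apply, aug, Res.extend_right_smul, mulMap_right_smul]
      rfl)
    (fun l p => by simp) (fun l p => by simp)
    (fun t => by
      obtain ⟨j, rfl⟩ := (single k C J).surjective t
      rw [LinearMap.comp_apply, aug, Res.extend_incl, augAux_single, commMap_apply, map_sub]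
      simp [mulMap])
  exact LinearMap.congr_fun h p

/-- For elements z of the kernel of multiplication the subtracted term is zero, so this is
surjectivity onto K¹, stated so that it can be proved by induction on all tensors. -/
theorem exists_aug_eq (z : RelTensor k D) : ∃ p, E.aug hD p =
    z - BimodTensor.tmul k L D L (mulMap k D z) (1 : L) := by
  induction z using BimodTensor.induction_tmul with
  | zero =>
    refine ⟨0, ?_⟩
    rw [map_zero, map_zero, ← BimodTensor.tmulₗ_apply, map_zero, LinearMap.zero_apply, sub_zero]
  | add z z' h h' =>
    obtain ⟨p, hp⟩ := h
    obtain ⟨p', hp'⟩ := h'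
    refine ⟨p + p', ?_⟩
    rw [map_add, hp, hp', map_add, ← BimodTensor.tmulₗ_apply, ← BimodTensor.tmulₗ_apply,
      ← BimodTensor.tmulₗ_apply, map_add, LinearMap.add_apply]
    abel
  | tmul x y =>
    -- The source is x ⊗ y - x y ⊗ 1 = -x (y ⊗ 1 - 1 ⊗ y). Here y may be replaced by its `J`-part,
    -- as c ⊗ 1 = 1 ⊗ c for c in `C`.
    refine ⟨-(x • Res.incl E 0 (single k C J (E.prJ y))), ?_⟩
    rw [map_neg, aug, Res.extend_left_smul, Res.extend_incl, augAux_single, commMap_apply]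
    have h : E.inJ (E.prJ y) = y - E.inC (E.prC y) := eq_sub_of_add_eq' (E.inC_add_inJ y)
    have hc := relTensor_smul_right (k := k) (1 : L) (1 : L) _ (hD (E.prC y))
    rw [one_mul, mul_one] at hc
    rw [h, ← BimodTensor.tmulₗ_apply, ← BimodTensor.tmulₗ_apply, map_sub, map_sub,
      LinearMap.sub_apply, BimodTensor.tmulₗ_apply, BimodTensor.tmulₗ_apply,
      BimodTensor.tmulₗ_apply, BimodTensor.tmulₗ_apply, hc, sub_sub_sub_cancel_right, smul_sub,
      neg_sub, BimodTensor.left_smul_tmul, BimodTensor.left_smul_tmul, smul_eq_mul, smul_eq_mul,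
      mul_one]
    rfl

/-- The augmentation as a map of bimodules onto `K¹`. -/
def augBimod : toBimod k L L (Res E 0) →ₗ[L ⊗[k] Lᵐᵒᵖ] K1 k D :=
  LinearMap.codRestrict (LinearMap.ker (mulBimodMap k D))
    (toBimodMap (E.aug hD) (Res.extend_left_smul _ _ _) (Res.extend_right_smul _ _ _))
    (E.mulMap_aug hD)

theorem augBimod_surjective : Function.Surjective (E.augBimod hD) := by
  rintro ⟨z, hz⟩
  obtain ⟨p, hp⟩ := E.exists_aug_eq hD z
  refine ⟨p, Subtype.ext (hp.trans ?_)⟩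
  have hz' : mulMap k D z = 0 := hz
  rw [hz', ← BimodTensor.tmulₗ_apply, map_zero, LinearMap.zero_apply]
  exact sub_zero z

theorem augBimod_eq_zero_iff (hD' : ∀ d ∈ D, ∃ c, E.inC c = d) (p : Res E 0) :
    E.augBimod hD p = 0 ↔ p.x = 0 ∧ p.z = p.y := by
  rw [← E.aug_eq_zero_iff hD hD']
  exact Subtype.ext_iff

end NullExt

end NullSq

end

noncomputable section

namespace NullSq

open BimodPow ModuleCat

/-! ### The tensor product of the resolution with `L` -/

section OfBimod

variable {k S T X : Type u} [Field k] [Ring S] [Algebra k S] [Ring T] [Algebra k T]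
  [AddCommGroup X] [Module k X] [Module S X] [Module Tᵐᵒᵖ X]
  [IsScalarTower k S X] [IsScalarTower k Tᵐᵒᵖ X] [SMulCommClass S Tᵐᵒᵖ X]

theorem toBimod_tmul_smul (s : S) (t : Tᵐᵒᵖ) (x : toBimod k S T X) :
    (s ⊗ₜ t : S ⊗[k] Tᵐᵒᵖ) • x = (s • t • (show X from x) : X) :=
  TensorProduct.Algebra.smul_def (M := X) s t x

variable (k S T X) in
/-- The identity map from the bimodule as a module to the bimodule as a vector space. -/
def ofBimod : toBimod k S T X ≃ₗ[k] X :=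
  AddEquiv.toLinearEquiv (show toBimod k S T X ≃+ X from AddEquiv.refl X) fun r x => by
    have h : algebraMap k (S ⊗[k] Tᵐᵒᵖ) r = (algebraMap k S r) ⊗ₜ 1 :=
      Algebra.TensorProduct.algebraMap_apply r
    have h' : r • x = algebraMap k (S ⊗[k] Tᵐᵒᵖ) r • x := (algebraMap_smul _ r x).symm
    change (show X from r • x) = _
    rw [h', h, toBimod_tmul_smul, one_smul, algebraMap_smul]
    rfl

theorem ofBimod_tmul_smul (s : S) (t : Tᵐᵒᵖ) (x : toBimod k S T X) :
    ofBimod k S T X ((s ⊗ₜ t : S ⊗[k] Tᵐᵒᵖ) • x) = s • t • ofBimod k S T X x :=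
  toBimod_tmul_smul s t x

end OfBimod

section HZero

variable (k C J : Type*) [Field k] [Ring C] [Algebra k C]
  [AddCommGroup J] [Module k J] [Module C J] [Module Cᵐᵒᵖ J] [IsScalarTower k C J]
  [IsScalarTower k Cᵐᵒᵖ J] [SMulCommClass C Cᵐᵒᵖ J]

/-- `H_0(C, J^{⊗_C (n+1)})`. -/
abbrev CycPow (n : ℕ) : Type _ := HochschildZero k C (BimodPow k C J n)

variable {J} {n : ℕ}

/-- The projection to `H_0(C, J^{⊗_C (n+1)})`. -/
def cycMk : BimodPow k C J n →ₗ[k] CycPow k C J n :=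
  (commutatorSpan k C (BimodPow k C J n)).mkQ

variable {k C}

theorem cycMk_tprod (x : Fin (n + 1) → J) : cycMk k C (tprod k C x) = cycTprod k C J n x := rfl

theorem cycMk_smul (c : C) (t : BimodPow k C J n) :
    cycMk k C (c • t) = cycMk k C (MulOpposite.op c • t) := by
  rw [← sub_eq_zero, ← map_sub]
  exact (Submodule.Quotient.mk_eq_zero _).2 (Submodule.subset_span ⟨c, t, rfl⟩)

/-- Translates the index shift in `rot` into moving the last factor to the front. -/
theorem rot_cycMk_snoc (t : BimodPow k C J n) (j : J) :
    rot k C J (n + 1) 1 (cycMk k C (snoc k C J n t j)) = cycMk k C (cons k C J n j t) := by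
  have h : rot k C J (n + 1) 1 ∘ₗ cycMk k C ∘ₗ (snoc k C J n).flip j =
      cycMk k C ∘ₗ cons k C J n j := hom_ext fun x => by
    simp only [LinearMap.comp_apply, LinearMap.flip_apply, snoc_tprod, cons_tprod, cycMk_tprod,
      rot_cycTprod]
    congr 1
    ext i
    induction i using Fin.cases with
    | zero =>
      -- In `Fin (n + 2)` the index 0 - 1 is the last one.
      rw [zero_sub, Fin.cons_zero, ← eq_neg_of_add_eq_zero_left (Fin.last_add_one (n + 1))]
      exact Fin.snoc_last (α := fun _ => J) _ _
    | succ i =>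
      rw [Fin.cons_succ, ← Fin.coeSucc_eq_succ, add_sub_cancel_right]
      exact Fin.snoc_castSucc (α := fun _ => J) _ _ _
  exact LinearMap.congr_fun h t

/-- The linear map out of `H_0` given by a linear map that is invariant under cyclic permutation
of the action. -/
def cycLift {Z : Type*} [AddCommGroup Z] [Module k Z] (f : BimodPow k C J n →ₗ[k] Z)
    (h : ∀ (c : C) t, f (c • t) = f (MulOpposite.op c • t)) : CycPow k C J n →ₗ[k] Z :=
  (commutatorSpan k C (BimodPow k C J n)).liftQ f (Submodule.span_le.2 (by
    rintro _ ⟨c, t, rfl⟩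
    rw [SetLike.mem_coe, LinearMap.mem_ker, map_sub, h, sub_self]))

@[simp] theorem cycLift_cycMk {Z : Type*} [AddCommGroup Z] [Module k Z]
    (f : BimodPow k C J n →ₗ[k] Z)
    (h : ∀ (c : C) t, f (c • t) = f (MulOpposite.op c • t)) (t : BimodPow k C J n) :
    cycLift f h (cycMk k C t) = f t := rfl

end HZero

namespace NullExt

variable {k L C J : Type u} [Field k] [Ring L] [Algebra k L] [Ring C] [Algebra k C]
  [AddCommGroup J] [Module k J] [Module C J] [Module Cᵐᵒᵖ J] [IsScalarTower k C J]
  [IsScalarTower k Cᵐᵒᵖ J] [SMulCommClass C Cᵐᵒᵖ J] (E : NullExt k L C J) (n : ℕ)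

/-- The projection from `L ⊗_C J^{⊗_C (n+1)} ⊗_C L` to its zeroth Hochschild homology. -/
def trace : Res E n →ₗ[k] CycPow k C J n × CycPow k C J (n + 1) where
  -- After tensoring with `L`, a factor of `J` at the right end can be carried round to the left
  -- end, so `z` joins `y` after one rotation. In `w` this brings two outer factors of `J` together,
  -- so `w` dies.
  toFun p := (cycMk k C p.x, cycMk k C p.y + rot k C J (n + 1) 1 (cycMk k C p.z))
  map_add' p q := by
    ext
    · simp
    · simp
      abel
  map_smul' r p := by ext <;> simp

theorem trace_apply (p : Res E n) : E.trace n p =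
    (cycMk k C p.x, cycMk k C p.y + rot k C J (n + 1) 1 (cycMk k C p.z)) := rfl

theorem trace_smul (l : L) (p : Res E n) :
    E.trace n (l • p) = E.trace n (MulOpposite.op l • p) := by
  rw [trace_apply, trace_apply]
  simp only [Res.left_smul_x, Res.left_smul_y, Res.left_smul_z, Res.right_smul_x,
    Res.right_smul_y, Res.right_smul_z, map_add, cycMk_smul, rot_cycMk_snoc, MulOpposite.unop_op]
  congr 1
  abel

/-- The terms of the resolution as modules over `L ⊗ Lᵐᵒᵖ`. -/
abbrev resObj : ModuleCat.{u} (L ⊗[k] Lᵐᵒᵖ) := toBimod k L L (Res E n)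

variable (k L) in
/-- The functor `- ⊗_{L-L} L`. -/
abbrev tensorSelf : ModuleCat.{u} (L ⊗[k] Lᵐᵒᵖ) ⥤ ModuleCat.{u} k :=
  tensorFunctor k L (toBimod k L L L)

/-- The map from `P ⊗_{L-L} L`, for a term `P` of the resolution, given by `trace`. -/
def tensorTrace : (tensorSelf k L).obj (E.resObj n) →ₗ[k] CycPow k C J n × CycPow k C J (n + 1) :=
  (bimodRel k L (E.resObj n) (toBimod k L L L)).liftQ
    -- The map is x ⊗ y ↦ `trace` of x y.
    (TensorProduct.lift (((LinearMap.llcomp k _ _ _ (E.trace n)).comp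
      ((Algebra.lsmul k k (Res E n) : Lᵐᵒᵖ →ₐ[k] _).toLinearMap.comp
        ((MulOpposite.opLinearEquiv k).toLinearMap.comp (ofBimod k L L L).toLinearMap))).flip.comp
          (ofBimod k L L (Res E n)).toLinearMap))
    (Submodule.span_le.2 (by
      rintro _ ⟨l, l', x, y, rfl⟩
      rw [SetLike.mem_coe, LinearMap.mem_ker, map_sub, sub_eq_zero]
      change E.trace n (MulOpposite.op (ofBimod k L L L y) • ofBimod k L L (Res E n)
          ((l' ⊗ₜ MulOpposite.op l : L ⊗[k] Lᵐᵒᵖ) • x)) =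
        E.trace n (MulOpposite.op (ofBimod k L L L ((l ⊗ₜ MulOpposite.op l' : L ⊗[k] Lᵐᵒᵖ) • y)) •
          ofBimod k L L (Res E n) x)
      rw [ofBimod_tmul_smul, ofBimod_tmul_smul, ← smul_comm l', trace_smul]
      simp [mul_smul, mul_assoc]))

/-- The map `p ↦ p ⊗ 1`. -/
def tensorOne : Res E n →ₗ[k] (tensorSelf k L).obj (E.resObj n) :=
  (bimodRel k L (E.resObj n) (toBimod k L L L)).mkQ.comp
    (((TensorProduct.mk k (E.resObj n) (toBimod k L L L)).flip ((ofBimod k L L L).symm 1)).comp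
      (ofBimod k L L (Res E n)).symm.toLinearMap)

theorem mk_tmul_rel (l l' : L) (x : Res E n) (y : L) :
    (Submodule.Quotient.mk (((ofBimod k L L (Res E n)).symm (l' • MulOpposite.op l • x)) ⊗ₜ
        ((ofBimod k L L L).symm y)) : (tensorSelf k L).obj (E.resObj n)) =
      Submodule.Quotient.mk (((ofBimod k L L (Res E n)).symm x) ⊗ₜ
        ((ofBimod k L L L).symm (l * (y * l')))) := by
  refine (Submodule.Quotient.eq _).2 (Submodule.subset_span
    ⟨l, l', (ofBimod k L L (Res E n)).symm x, (ofBimod k L L L).symm y, ?_⟩)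
  have h : (l' ⊗ₜ[k] MulOpposite.op l : L ⊗[k] Lᵐᵒᵖ) • (ofBimod k L L (Res E n)).symm x =
      (ofBimod k L L (Res E n)).symm (l' • MulOpposite.op l • x) := toBimod_tmul_smul _ _ _
  have h' : (l ⊗ₜ[k] MulOpposite.op l' : L ⊗[k] Lᵐᵒᵖ) • (ofBimod k L L L).symm y =
      (ofBimod k L L L).symm (l * (y * l')) := toBimod_tmul_smul _ _ _
  rw [h, h']

theorem mk_tmul_eq (x : Res E n) (y : L) :
    (Submodule.Quotient.mk (((ofBimod k L L (Res E n)).symm x) ⊗ₜ ((ofBimod k L L L).symm y)) :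
      (tensorSelf k L).obj (E.resObj n)) = E.tensorOne n (MulOpposite.op y • x) := by
  have h := E.mk_tmul_rel n y 1 x 1
  rw [one_smul, mul_one, mul_one] at h
  exact h.symm

theorem tensorOne_smul (l : L) (x : Res E n) :
    E.tensorOne n (l • x) = E.tensorOne n (MulOpposite.op l • x) := by
  have h := E.mk_tmul_rel n 1 l x 1
  rw [MulOpposite.op_one, one_smul, one_mul, one_mul, mk_tmul_eq, mk_tmul_eq, MulOpposite.op_one,
    one_smul] at h
  exact h

theorem tensorTrace_tensorOne (x : Res E n) : E.tensorTrace n (E.tensorOne n x) = E.trace n x := by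
  change E.trace n (MulOpposite.op (1 : L) • x) = _
  rw [MulOpposite.op_one, one_smul]

theorem tensorOne_inclY_smul (c : C) (t : BimodPow k C J (n + 1)) :
    E.tensorOne n (Res.inclY E n (c • t)) = E.tensorOne n (Res.inclY E n (MulOpposite.op c • t)) := by
  have h : Res.inclY E n (c • t) = E.inC c • Res.inclY E n t := by ext <;> simp [Res.inclY]
  have h' : Res.inclY E n (MulOpposite.op c • t) = MulOpposite.op (E.inC c) • Res.inclY E n t := by
    ext <;> simp [Res.inclY]
  rw [h, h', tensorOne_smul]

theorem tensorOne_incl_smul (c : C) (t : BimodPow k C J n) :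
    E.tensorOne n (Res.incl E n (c • t)) = E.tensorOne n (Res.incl E n (MulOpposite.op c • t)) := by
  rw [Res.incl_smul, Res.incl_op_smul, tensorOne_smul]

/-- The inverse of `tensorTrace`. -/
def tensorTraceInv :
    CycPow k C J n × CycPow k C J (n + 1) →ₗ[k] (tensorSelf k L).obj (E.resObj n) :=
  LinearMap.coprod
    (cycLift (E.tensorOne n ∘ₗ Res.incl E n) (E.tensorOne_incl_smul n))
    (cycLift (E.tensorOne n ∘ₗ Res.inclY E n) (E.tensorOne_inclY_smul n))

theorem tensorOne_inclZ (t : BimodPow k C J (n + 1)) :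
    E.tensorOne n (Res.inclZ E n t) =
      E.tensorTraceInv n (0, rot k C J (n + 1) 1 (cycMk k C t)) := by
  have h : E.tensorOne n ∘ₗ Res.inclZ E n = E.tensorTraceInv n ∘ₗ LinearMap.inr k _ _ ∘ₗ
      rot k C J (n + 1) 1 ∘ₗ cycMk k C := hom_ext_snoc fun t j => by
    simp only [LinearMap.comp_apply, rot_cycMk_snoc, LinearMap.inr_apply, tensorTraceInv,
      LinearMap.coprod_apply, map_zero, zero_add, cycLift_cycMk, Res.inclY_cons, Res.inclZ_snoc,
      tensorOne_smul]
  exact LinearMap.congr_fun h t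

/-- An element of this component is j times an element of `z`; carried to the right, j meets a right
end in `J`, and the product is zero. -/
theorem tensorOne_inclW (t : BimodPow k C J (n + 2)) : E.tensorOne n (Res.inclW E n t) = 0 := by
  have h : E.tensorOne n ∘ₗ Res.inclW E n = 0 := hom_ext_cons fun j t => by
    rw [LinearMap.comp_apply, Res.inclW_cons, tensorOne_smul, LinearMap.zero_apply]
    convert map_zero (E.tensorOne n)
    ext <;> simp [Res.inclZ]
  exact LinearMap.congr_fun h t

theorem tensorTraceInv_trace (x : Res E n) :
    E.tensorTraceInv n (E.trace n x) = E.tensorOne n x := by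
  conv_rhs => rw [Res.eq_incl_add x]
  rw [map_add, map_add, map_add, tensorOne_inclZ, tensorOne_inclW, add_zero, trace_apply]
  simp only [tensorTraceInv, LinearMap.coprod_apply, map_add, cycLift_cycMk, map_zero, zero_add,
    LinearMap.comp_apply, add_assoc]

/-- `P ⊗_{L-L} L` for a term `P` of the resolution. -/
def tensorEquiv :
    (tensorSelf k L).obj (E.resObj n) ≃ₗ[k] CycPow k C J n × CycPow k C J (n + 1) :=
  LinearEquiv.ofLinearMap (E.tensorTrace n) (E.tensorTraceInv n)
    (by
      refine LinearMap.ext fun v => ?_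
      obtain ⟨⟨v⟩, ⟨w⟩⟩ := v
      have h : E.tensorTraceInv n (cycMk k C v, cycMk k C w) =
          E.tensorOne n (Res.incl E n v + Res.inclY E n w) := by
        rw [map_add]
        rfl
      change E.tensorTrace n (E.tensorTraceInv n (cycMk k C v, cycMk k C w)) =
        (cycMk k C v, cycMk k C w)
      rw [h, tensorTrace_tensorOne, trace_apply]
      simp [Res.inclY])
    (Submodule.linearMap_qext _ (TensorProduct.ext' fun x y => by
      change E.tensorTraceInv n (E.trace n (MulOpposite.op (ofBimod k L L L y) •
        ofBimod k L L (Res E n) x)) = _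
      rw [tensorTraceInv_trace, ← mk_tmul_eq]
      rfl))

/-- The differential of the resolution. -/
def resD (ε : k) : E.resObj (n + 1) ⟶ E.resObj n :=
  ConcreteCategory.ofHom (C := ModuleCat (L ⊗[k] Lᵐᵒᵖ))
    (toBimodMap (Res.d E n ε) (Res.d_left_smul ε) (Res.d_right_smul ε))

/-- The differential of the tensor product of the resolution with `L`. -/
def cycD (ε : k) : CycPow k C J (n + 1) × CycPow k C J (n + 2) →ₗ[k]
    CycPow k C J n × CycPow k C J (n + 1) :=
  LinearMap.inr k _ _ ∘ₗ (1 + ε • rot k C J (n + 1) 1) ∘ₗ LinearMap.fst k _ _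

/-- A generator x goes to y = x and z = ε x, whose trace is [x] + ε t[x]. The components `y` and `z`
of the source land in `w`, which the trace ignores; hence only the first coordinate matters. -/
theorem tensorEquiv_map (ε : k) (x : (tensorSelf k L).obj (E.resObj (n + 1))) :
    E.tensorEquiv n (((tensorSelf k L).map (E.resD n ε)).hom x) =
      cycD n ε (E.tensorEquiv (n + 1) x) := by
  have h : (E.tensorEquiv n).toLinearMap ∘ₗ ((tensorSelf k L).map (E.resD n ε)).hom =
      cycD n ε ∘ₗ (E.tensorEquiv (n + 1)).toLinearMap :=
    Submodule.linearMap_qext _ (TensorProduct.ext' fun x y => by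
      change E.trace n (MulOpposite.op (ofBimod k L L L y) •
        Res.d E n ε (ofBimod k L L (Res E (n + 1)) x)) =
        cycD n ε (E.trace (n + 1) (MulOpposite.op (ofBimod k L L L y) •
          (ofBimod k L L (Res E (n + 1)) x)))
      rw [← Res.d_right_smul]
      generalize MulOpposite.op (ofBimod k L L L y) • (ofBimod k L L (Res E (n + 1)) x) = p
      simp [trace_apply, cycD])
  exact LinearMap.congr_fun h x

end NullExt

end NullSq

end

/-! ### Tor over a trivial extension, as kernel and cokernel of 1 + t. -/

noncomputable section

namespace NullSq

open BimodPow ModuleCat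

namespace NullExt

variable {k L C J : Type u} [Field k] [Ring L] [Algebra k L] [Ring C] [Algebra k C]
  [AddCommGroup J] [Module k J] [Module C J] [Module Cᵐᵒᵖ J] [IsScalarTower k C J]
  [IsScalarTower k Cᵐᵒᵖ J] [SMulCommClass C Cᵐᵒᵖ J] (E : NullExt k L C J)
  {D : Subalgebra k L}

theorem map_resD_eq_zero (n : ℕ) (ε : k) [Subsingleton (CycPow k C J (n + 1))] :
    (tensorSelf k L).map (E.resD n ε) = 0 := by
  ext x
  refine (E.tensorEquiv n).injective ((E.tensorEquiv_map n ε x).trans ?_)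
  refine Eq.trans ?_ (map_zero (E.tensorEquiv n)).symm
  rw [cycD, LinearMap.comp_apply, LinearMap.comp_apply,
    Subsingleton.elim (LinearMap.fst k _ _ _) (0 : CycPow k C J (n + 1)), map_zero, map_zero]

/-- The kernel of a differential of the tensor product of the resolution with `L`. -/
theorem ker_map_resD (n : ℕ) (ε : k) [Subsingleton (CycPow k C J (n + 2))] :
    Nonempty (LinearMap.ker ((tensorSelf k L).map (E.resD n ε)).hom ≃ₗ[k]
      LinearMap.ker (1 + ε • rot k C J (n + 1) 1)) := by
  have h : ∀ x : (tensorSelf k L).obj (E.resObj (n + 1)),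
      ((tensorSelf k L).map (E.resD n ε)).hom x = 0 ↔
        (1 + ε • rot k C J (n + 1) 1) (E.tensorEquiv (n + 1) x).1 = 0 := fun x => by
    rw [← (E.tensorEquiv n).map_eq_zero_iff, tensorEquiv_map]
    exact Prod.ext_iff.trans (and_iff_right rfl)
  refine ⟨LinearEquiv.ofBijective (LinearMap.codRestrict _
    (LinearMap.fst k _ _ ∘ₗ (E.tensorEquiv (n + 1)).toLinearMap ∘ₗ Submodule.subtype _)
      fun x => (h x).1 x.2) ⟨fun x y hxy => ?_, fun v => ?_⟩⟩
  · exact Subtype.ext ((E.tensorEquiv (n + 1)).injective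
      (Prod.ext (congrArg Subtype.val hxy) (Subsingleton.elim _ _)))
  · refine ⟨⟨(E.tensorEquiv (n + 1)).symm (v, 0), (h _).2 ?_⟩, Subtype.ext ?_⟩
    · rw [LinearEquiv.apply_symm_apply]
      exact v.2
    · exact congrArg Prod.fst ((E.tensorEquiv (n + 1)).apply_symm_apply _)

/-- The cokernel of a differential of the tensor product of the resolution with `L`. -/
theorem coker_map_resD (n : ℕ) (ε : k) [Subsingleton (CycPow k C J n)] :
    Nonempty (((tensorSelf k L).obj (E.resObj n) ⧸
        LinearMap.range ((tensorSelf k L).map (E.resD n ε)).hom) ≃ₗ[k]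
      (CycPow k C J (n + 1) ⧸ LinearMap.range (1 + ε • rot k C J (n + 1) 1))) := by
  let g : (tensorSelf k L).obj (E.resObj n) ≃ₗ[k] CycPow k C J (n + 1) :=
    LinearEquiv.ofBijective (LinearMap.snd k _ _ ∘ₗ (E.tensorEquiv n).toLinearMap)
      ⟨fun x y hxy => (E.tensorEquiv n).injective (Prod.ext (Subsingleton.elim _ _) hxy),
        (Prod.snd_surjective).comp (E.tensorEquiv n).surjective⟩
  refine ⟨Submodule.Quotient.equiv _ _ g ?_⟩
  have h : g.toLinearMap ∘ₗ ((tensorSelf k L).map (E.resD n ε)).hom =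
      (1 + ε • rot k C J (n + 1) 1) ∘ₗ
        (LinearMap.fst k _ _ ∘ₗ (E.tensorEquiv (n + 1)).toLinearMap) :=
    LinearMap.ext fun x => congrArg Prod.snd (E.tensorEquiv_map n ε x)
  rw [← LinearMap.range_comp, h, LinearMap.range_comp_of_range_eq_top _ (LinearMap.range_eq_top.2
    (Prod.fst_surjective.comp (E.tensorEquiv (n + 1)).surjective))]

theorem resD_exact (n : ℕ) :
    Function.Exact (E.resD (n + 1) ((-1) ^ (n + 1))) (E.resD n ((-1) ^ n)) := by
  rw [pow_succ, mul_neg_one]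
  exact Res.d_exact (E := E) (n := n) ((-1) ^ n)

/-- The kernel of the augmentation is x = 0, z = y, which is the image of the differential with sign
+1. This fixes the signs (-1)ⁿ of the whole resolution. -/
theorem resD_exact_augBimod (hD : ∀ c, E.inC c ∈ D) (hD' : ∀ d ∈ D, ∃ c, E.inC c = d) :
    Function.Exact (E.resD 0 ((-1) ^ 0))
      (ConcreteCategory.ofHom (C := ModuleCat (L ⊗[k] Lᵐᵒᵖ)) (E.augBimod hD)) := fun p => by
  refine (E.augBimod_eq_zero_iff hD hD' p).trans ?_
  change (p : Res E 0).x = 0 ∧ (p : Res E 0).z = (p : Res E 0).y ↔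
    ∃ q : Res E 1, Res.d E 0 ((-1) ^ 0) q = p
  constructor
  · rintro ⟨hx, hy⟩
    exact ⟨⟨Res.y (E := E) p, 0, Res.w (E := E) p, 0⟩, Res.ext (by simp [hx]) (by simp)
      (by simp [hy]) (by simp)⟩
  · rintro ⟨q, rfl⟩
    simp

section Tor

variable {τ : J →ₗ[k] C ⊗[k] J} {τ' : J →ₗ[k] Cᵐᵒᵖ ⊗[k] J}

/-- As H₀ with 2m + 3 factors vanishes, so does the differential into degree 2m + 1, and that degree
reduces to its first coordinate. The outgoing differential there is 1 + (-1)^{2m} t. -/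
theorem bimodTor_odd (h : IsRelSection k C Cᵐᵒᵖ J τ) (h' : IsRelSection k Cᵐᵒᵖ C J τ')
    (hD : ∀ c, E.inC c ∈ D) (hD' : ∀ d ∈ D, ∃ c, E.inC c = d) (m : ℕ)
    [Subsingleton (CycPow k C J (2 * m + 2))] :
    Nonempty (bimodTor k L (2 * m + 1) (K1 k D) (toBimod k L L L) ≃ₗ[k]
      LinearMap.ker (1 + rot k C J (2 * m + 1) 1)) := by
  obtain ⟨e⟩ := leftDerived_equiv_ker (tensorSelf k L) E.resObj (fun n => E.resD n ((-1) ^ n))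
    (ConcreteCategory.ofHom (C := ModuleCat (L ⊗[k] Lᵐᵒᵖ)) (E.augBimod hD))
    (fun n => Res.isProjective E h h' n) E.resD_exact (E.resD_exact_augBimod hD hD')
    (E.augBimod_surjective hD) (2 * m) (E.map_resD_eq_zero _ _)
  obtain ⟨e'⟩ := E.ker_map_resD (2 * m) ((-1) ^ (2 * m))
  rw [pow_mul, neg_one_sq, one_pow, one_smul] at e'
  rw [pow_mul, neg_one_sq, one_pow] at e
  exact ⟨e.trans e'⟩

/-- As H₀ with 2m + 1 factors vanishes, so does the differential out of degree 2m, and that degree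
reduces to its second coordinate, which receives 1 + t. -/
theorem bimodTor_even (h : IsRelSection k C Cᵐᵒᵖ J τ) (h' : IsRelSection k Cᵐᵒᵖ C J τ')
    (hD : ∀ c, E.inC c ∈ D) (hD' : ∀ d ∈ D, ∃ c, E.inC c = d) (m : ℕ)
    [Subsingleton (CycPow k C J (2 * m))] :
    Nonempty (bimodTor k L (2 * m) (K1 k D) (toBimod k L L L) ≃ₗ[k]
      (CycPow k C J (2 * m + 1) ⧸ LinearMap.range (1 + rot k C J (2 * m + 1) 1))) := by
  obtain ⟨e⟩ := leftDerived_equiv_coker (tensorSelf k L) E.resObj (fun n => E.resD n ((-1) ^ n))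
    (ConcreteCategory.ofHom (C := ModuleCat (L ⊗[k] Lᵐᵒᵖ)) (E.augBimod hD))
    (fun n => Res.isProjective E h h' n) E.resD_exact (E.resD_exact_augBimod hD hD')
    (E.augBimod_surjective hD) (2 * m) (fun j => by
      -- Only j = 2m - 1 can receive a nonzero differential; when m = 0 there is no such j.
      by_cases hj : j + 1 = 2 * m
      · obtain ⟨n, hn⟩ : ∃ n, n = 2 * m := ⟨_, rfl⟩
        rw [← hn] at hj
        subst hj
        have : Subsingleton (CycPow k C J (j + 1)) := hn ▸ inferInstance
        rw [← hn, exactComplex_d]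
        exact E.map_resD_eq_zero _ _
      · rw [HomologicalComplex.shape _ _ _ hj]
        exact (tensorSelf k L).map_zero _ _)
  obtain ⟨e'⟩ := E.coker_map_resD (2 * m) ((-1) ^ (2 * m))
  rw [pow_mul, neg_one_sq, one_pow, one_smul] at e'
  rw [pow_mul, neg_one_sq, one_pow] at e
  exact ⟨e.trans e'⟩

end Tor

end NullExt

end NullSq

end

noncomputable section

namespace NullSq

/-! ### Null-square algebras as trivial extensions -/

/-- The off-diagonal matrices, as a bimodule over `A × B`. -/
def OffDiag (M N : Type*) : Type _ := M × N

namespace OffDiag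

section Basic

variable {k A B M N : Type*} [Field k] [Ring A] [Algebra k A] [Ring B] [Algebra k B]
  [AddCommGroup M] [Module k M] [Module B M] [Module Aᵐᵒᵖ M]
  [AddCommGroup N] [Module k N] [Module A N] [Module Bᵐᵒᵖ N]

instance : AddCommGroup (OffDiag M N) := inferInstanceAs (AddCommGroup (M × N))
instance : Module k (OffDiag M N) := inferInstanceAs (Module k (M × N))

@[ext] theorem ext {x y : OffDiag M N} (h : x.1 = y.1) (h' : x.2 = y.2) : x = y := Prod.ext h h'

@[simp] theorem zero_fst : (0 : OffDiag M N).1 = 0 := rfl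
@[simp] theorem zero_snd : (0 : OffDiag M N).2 = 0 := rfl
@[simp] theorem add_fst (x y : OffDiag M N) : (x + y).1 = x.1 + y.1 := rfl
@[simp] theorem add_snd (x y : OffDiag M N) : (x + y).2 = x.2 + y.2 := rfl
@[simp] theorem smul_fst (r : k) (x : OffDiag M N) : (r • x).1 = r • x.1 := rfl
@[simp] theorem smul_snd (r : k) (x : OffDiag M N) : (r • x).2 = r • x.2 := rfl

instance : SMul (A × B) (OffDiag M N) := ⟨fun c x => (c.2 • x.1, c.1 • x.2)⟩

@[simp] theorem left_smul_fst (c : A × B) (x : OffDiag M N) : (c • x).1 = c.2 • x.1 := rfl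
@[simp] theorem left_smul_snd (c : A × B) (x : OffDiag M N) : (c • x).2 = c.1 • x.2 := rfl

instance : SMul (A × B)ᵐᵒᵖ (OffDiag M N) :=
  ⟨fun c x => (MulOpposite.op c.unop.1 • x.1, MulOpposite.op c.unop.2 • x.2)⟩

@[simp] theorem right_smul_fst (c : (A × B)ᵐᵒᵖ) (x : OffDiag M N) :
    (c • x).1 = MulOpposite.op c.unop.1 • x.1 := rfl
@[simp] theorem right_smul_snd (c : (A × B)ᵐᵒᵖ) (x : OffDiag M N) :
    (c • x).2 = MulOpposite.op c.unop.2 • x.2 := rfl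

instance : Module (A × B) (OffDiag M N) where
  one_smul x := by ext <;> simp
  mul_smul c c' x := by ext <;> simp [mul_smul]
  smul_zero c := by ext <;> simp
  smul_add c x y := by ext <;> simp
  add_smul c c' x := by ext <;> simp [add_smul]
  zero_smul x := by ext <;> simp

instance : Module (A × B)ᵐᵒᵖ (OffDiag M N) where
  one_smul x := by ext <;> simp
  mul_smul c c' x := by ext <;> simp [mul_smul]
  smul_zero c := by ext <;> simp
  smul_add c x y := by ext <;> simp
  add_smul c c' x := by ext <;> simp [add_smul]
  zero_smul x := by ext <;> simp

variable [IsScalarTower k B M] [IsScalarTower k Aᵐᵒᵖ M] [SMulCommClass B Aᵐᵒᵖ M]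
    [IsScalarTower k A N] [IsScalarTower k Bᵐᵒᵖ N] [SMulCommClass A Bᵐᵒᵖ N]

instance : IsScalarTower k (A × B) (OffDiag M N) := ⟨fun r c x => by ext <;> simp⟩
instance : IsScalarTower k (A × B)ᵐᵒᵖ (OffDiag M N) := ⟨fun r c x => by ext <;> simp⟩
instance : SMulCommClass (A × B) (A × B)ᵐᵒᵖ (OffDiag M N) :=
  ⟨fun c c' x => by ext <;> simp [smul_comm]⟩

variable (k M N) in
/-- The inclusion of `M`. -/
def inM : M →ₗ[k] OffDiag M N := LinearMap.inl k M N

variable (k M N) in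
/-- The inclusion of `N`. -/
def inN : N →ₗ[k] OffDiag M N := LinearMap.inr k M N

variable (k M N) in
/-- The projection to `M`. -/
def prM : OffDiag M N →ₗ[k] M := LinearMap.fst k M N

variable (k M N) in
/-- The projection to `N`. -/
def prN : OffDiag M N →ₗ[k] N := LinearMap.snd k M N

@[simp] theorem prM_apply (x : OffDiag M N) : prM k M N x = x.1 := rfl
@[simp] theorem prN_apply (x : OffDiag M N) : prN k M N x = x.2 := rfl
@[simp] theorem inM_fst (x : M) : (inM k M N x).1 = x := rfl
@[simp] theorem inM_snd (x : M) : (inM k M N x).2 = 0 := rfl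
@[simp] theorem inN_fst (x : N) : (inN k M N x).1 = 0 := rfl
@[simp] theorem inN_snd (x : N) : (inN k M N x).2 = x := rfl

theorem inM_prM_add (x : OffDiag M N) : inM k M N (prM k M N x) + inN k M N (prN k M N x) = x :=
  OffDiag.ext (add_zero x.1) (zero_add x.2)

end Basic

section Projective

variable {k A B M N : Type u} [Field k] [Ring A] [Algebra k A] [Ring B] [Algebra k B]
  [AddCommGroup M] [Module k M] [Module B M] [Module Aᵐᵒᵖ M]
  [AddCommGroup N] [Module k N] [Module A N] [Module Bᵐᵒᵖ N]
  [IsScalarTower k B M] [IsScalarTower k Aᵐᵒᵖ M] [SMulCommClass B Aᵐᵒᵖ M]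
  [IsScalarTower k A N] [IsScalarTower k Bᵐᵒᵖ N] [SMulCommClass A Bᵐᵒᵖ N]

theorem exists_left (hM : IsProjectiveBimodule k B A M) (hN : IsProjectiveBimodule k A B N) :
    ∃ τ, IsRelSection k (A × B) (A × B)ᵐᵒᵖ (OffDiag M N) τ := by
  obtain ⟨τ, hτ⟩ := hM.exists_left
  obtain ⟨τ', hτ'⟩ := hN.exists_left
  refine ⟨_, IsRelSection.add
    -- On `M` the algebra A × B acts from the left through B and from the right through A. The
    -- section is pushed forward along the non-unital inclusion of B; the roles are exchanged for
    -- `N`.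
    (hτ.transport (inM k M N) (prM k M N) (LinearMap.inr k A B) Prod.snd
      (fun t => MulOpposite.op t.unop.1) ?_ ?_ ?_ ?_ ?_)
    (hτ'.transport (inN k M N) (prN k M N) (LinearMap.inl k A B) Prod.fst
      (fun t => MulOpposite.op t.unop.2) ?_ ?_ ?_ ?_ ?_) inM_prM_add⟩ <;>
  intros <;> first | rfl | (ext <;> simp)

theorem exists_right (hM : IsProjectiveBimodule k B A M) (hN : IsProjectiveBimodule k A B N) :
    ∃ τ, IsRelSection k (A × B)ᵐᵒᵖ (A × B) (OffDiag M N) τ := by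
  obtain ⟨τ, hτ⟩ := hM.exists_right
  obtain ⟨τ', hτ'⟩ := hN.exists_right
  let φ : Aᵐᵒᵖ →ₗ[k] (A × B)ᵐᵒᵖ := (MulOpposite.opLinearEquiv k).toLinearMap ∘ₗ
    LinearMap.inl k A B ∘ₗ (MulOpposite.opLinearEquiv k).symm.toLinearMap
  let φ' : Bᵐᵒᵖ →ₗ[k] (A × B)ᵐᵒᵖ := (MulOpposite.opLinearEquiv k).toLinearMap ∘ₗ
    LinearMap.inr k A B ∘ₗ (MulOpposite.opLinearEquiv k).symm.toLinearMap
  refine ⟨_, IsRelSection.add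
    (hτ.transport (inM k M N) (prM k M N) φ (fun t => MulOpposite.op t.unop.1) Prod.snd
      (fun s s' => MulOpposite.unop_injective ?_) ?_ ?_ ?_ ?_)
    (hτ'.transport (inN k M N) (prN k M N) φ' (fun t => MulOpposite.op t.unop.2) Prod.fst
      (fun s s' => MulOpposite.unop_injective ?_) ?_ ?_ ?_ ?_) inM_prM_add⟩ <;>
  intros <;> first | rfl | (ext <;> simp [φ, φ'])

end Projective

end OffDiag

namespace NullSquare

variable (k A B M N : Type*) [Field k] [Ring A] [Algebra k A] [Ring B] [Algebra k B]
  [AddCommGroup M] [Module k M] [Module B M] [Module Aᵐᵒᵖ M]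
  [AddCommGroup N] [Module k N] [Module A N] [Module Bᵐᵒᵖ N]
  [IsScalarTower k B M] [IsScalarTower k Aᵐᵒᵖ M] [SMulCommClass B Aᵐᵒᵖ M]
  [IsScalarTower k A N] [IsScalarTower k Bᵐᵒᵖ N] [SMulCommClass A Bᵐᵒᵖ N]

/-- A null-square algebra as a trivial extension of `A × B`. -/
def nullExt : NullExt k (NullSquare A B M N) (A × B) (OffDiag M N) where
  inC := AlgHom.ofLinearMap
    { toFun := fun c => ⟨c.1, 0, 0, c.2⟩
      map_add' := fun c c' => by ext <;> simp
      map_smul' := fun r c => by ext <;> simp }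
    rfl (fun c c' => by ext <;> simp)
  inJ :=
    { toFun := fun x => ⟨0, x.2, x.1, 0⟩
      map_add' := fun c c' => by ext <;> simp
      map_smul' := fun r c => by ext <;> simp }
  prC := AlgHom.ofLinearMap
    { toFun := fun l => (l.a, l.b)
      map_add' := fun c c' => rfl
      map_smul' := fun r c => rfl }
    rfl (fun c c' => rfl)
  prJ :=
    { toFun := fun l => (l.m, l.n)
      map_add' := fun c c' => rfl
      map_smul' := fun r c => rfl }
  prC_inC c := rfl
  prC_inJ j := rfl
  prJ_inC c := rfl
  prJ_inJ j := rfl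
  inC_add_inJ l :=
    NullSquare.ext (add_zero l.a) (zero_add l.n) (zero_add l.m) (add_zero l.b)
  prJ_mul l l' := OffDiag.ext (add_comm _ _) rfl

theorem inC_mem_diag (c : A × B) : (nullExt k A B M N).inC c ∈ diag k A B M N := ⟨rfl, rfl⟩

theorem exists_inC_eq (d : NullSquare A B M N) (hd : d ∈ diag k A B M N) :
    ∃ c, (nullExt k A B M N).inC c = d :=
  ⟨(d.a, d.b), NullSquare.ext rfl hd.1.symm hd.2.symm rfl⟩

end NullSquare

end NullSq

end

noncomputable section

namespace NullSq

/-! ### Tensor powers of the off-diagonal bimodule with an odd number of factors -/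

section Idempotent

variable {k C J : Type*} [Field k] [Ring C] [Algebra k C]
  [AddCommGroup J] [Module k J] [Module C J] [Module Cᵐᵒᵖ J] [IsScalarTower k C J]
  [IsScalarTower k Cᵐᵒᵖ J] [SMulCommClass C Cᵐᵒᵖ J] {e f : C} {n : ℕ}

/-- The left action of e is the right action of f, and that crosses to the next factor. Thus an
idempotent that moves on by one place changes into the other. -/
theorem cycTprod_update_swap (he : ∀ j : J, e • j = MulOpposite.op f • j) (i : Fin (n + 1))
    (x : Fin (n + 1) → J) :
    cycTprod k C J n (Function.update x i (e • x i)) =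
      cycTprod k C J n (Function.update x (i + 1) (f • x (i + 1))) := by
  rw [he, cycTprod_rel]

theorem cycTprod_update_nsmul (he : ∀ j : J, e • j = MulOpposite.op f • j)
    (hf : ∀ j : J, f • j = MulOpposite.op e • j) (x : Fin (n + 1) → J) (r : ℕ) :
    cycTprod k C J n (Function.update x 0 (e • x 0)) =
      cycTprod k C J n (Function.update x ((2 * r) • 1) (e • x ((2 * r) • 1))) := by
  induction r with
  | zero => simp
  | succ r ih => rw [ih, cycTprod_update_swap he, cycTprod_update_swap hf, mul_add_one, add_smul,
      two_nsmul, add_assoc]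

/-- There are 2m + 1 factors, so an idempotent that travels once round the cycle comes back as the
other one. Each summand of 1 = e + f is then annihilated, because e f = f e = 0. -/
theorem subsingleton_cycPow_even (he : ∀ j : J, e • j = MulOpposite.op f • j)
    (hf : ∀ j : J, f • j = MulOpposite.op e • j) (h1 : e + f = 1) (h0 : f * e = 0) (m : ℕ) :
    Subsingleton (CycPow k C J (2 * m)) := by
  have key : ∀ x : Fin (2 * m + 1) → J, cycTprod k C J (2 * m) (Function.update x 0 (e • x 0)) =
      cycTprod k C J (2 * m) (Function.update x 0 (f • x 0)) := fun x => by
    -- Moving e on by 2(m + 1) places leaves it at place 1, once round; f at place 0 also equals e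
    -- at place 1.
    have h : (2 * (m + 1)) • (1 : Fin (2 * m + 1)) = 0 + 1 := by
      have := card_nsmul_eq_zero (x := (1 : Fin (2 * m + 1)))
      rw [Fintype.card_fin] at this
      rw [show 2 * (m + 1) = (2 * m + 1) + 1 by ring, add_smul, this, one_nsmul]
    rw [cycTprod_update_nsmul he hf x (m + 1), h, cycTprod_update_swap hf]
  have hee : e * e = e := by
    rw [← add_zero (e * e), ← h0, ← add_mul, h1, one_mul]
  have hff : f * f = f := by
    have := congrArg (f * ·) h1
    simpa [mul_add, h0] using this
  have hef : e * f = 0 := by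
    have := congrArg (· * f) h1
    simpa [add_mul, hff] using this
  have h : LinearMap.id (R := k) (M := CycPow k C J (2 * m)) = 0 := cyc_hom_ext fun x => by
    -- With factor 0 already multiplied by e or by f, one side of `key` is unchanged and the other
    -- contains f e or e f, hence vanishes.
    have h₁ := key (Function.update x 0 (e • x 0))
    have h₂ := key (Function.update x 0 (f • x 0))
    simp only [Function.update_self, Function.update_idem, ← mul_smul, hee, hff, h0, hef,
      zero_smul] at h₁ h₂
    rw [(cycTprod k C J (2 * m)).map_update_zero] at h₁ h₂
    have h₃ := (cycTprod k C J (2 * m)).map_update_add x 0 (e • x 0) (f • x 0)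
    rw [← add_smul, h1, one_smul, Function.update_eq_self, h₁, ← h₂, add_zero] at h₃
    exact h₃
  exact subsingleton_of_forall_eq 0 fun v => LinearMap.congr_fun h v

end Idempotent

theorem OffDiag.subsingleton_cycPow (k A B M N : Type*) [Field k] [Ring A] [Algebra k A]
    [Ring B] [Algebra k B]
    [AddCommGroup M] [Module k M] [Module B M] [Module Aᵐᵒᵖ M]
    [AddCommGroup N] [Module k N] [Module A N] [Module Bᵐᵒᵖ N]
    [IsScalarTower k B M] [IsScalarTower k Aᵐᵒᵖ M] [SMulCommClass B Aᵐᵒᵖ M]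
    [IsScalarTower k A N] [IsScalarTower k Bᵐᵒᵖ N] [SMulCommClass A Bᵐᵒᵖ N] (m : ℕ) :
    Subsingleton (CycPow k (A × B) (OffDiag M N) (2 * m)) :=
  subsingleton_cycPow_even (e := (1, 0)) (f := (0, 1)) (fun j => by ext <;> simp)
    (fun j => by ext <;> simp) (by simp) (by simp) m

/-! ### Linear algebra -/

section LinearAlgebra

variable {k V W : Type*} [Field k] [AddCommGroup V] [Module k V] [AddCommGroup W] [Module k W]

/-- Maps `p : V → W` and `i : W → V` that exhibit `W` as the summand of the idempotent `i p`, which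
an endomorphism `τ` of `V` exchanges with its complement. -/
structure IsSwap (τ : V →ₗ[k] V) (σ : W →ₗ[k] W) (p : V →ₗ[k] W) (i : W →ₗ[k] V) : Prop where
  p_i : ∀ w, p (i w) = w
  swap : ∀ v, τ (i (p v)) = τ v - i (p (τ v))
  p_τ_τ_i : ∀ w, p (τ (τ (i w))) = σ w

namespace IsSwap

variable {τ : V →ₗ[k] V} {σ : W →ₗ[k] W} {p : V →ₗ[k] W} {i : W →ₗ[k] V}

theorem p_τ_i (h : IsSwap τ σ p i) (w : W) : p (τ (i w)) = 0 := by
  have := congrArg p (h.swap (i w))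
  rwa [h.p_i, map_sub, h.p_i, sub_self] at this

/-- τ carries the idempotent i p to its complement, so τ² commutes with it. -/
theorem τ_τ_i_p (h : IsSwap τ σ p i) (v : V) : τ (τ (i (p v))) = i (p (τ (τ v))) := by
  rw [h.swap, map_sub, h.swap, sub_sub_cancel]

theorem τ_τ_i (h : IsSwap τ σ p i) (w : W) : τ (τ (i w)) = i (σ w) := by
  rw [← h.p_τ_τ_i, ← h.τ_τ_i_p, h.p_i]

theorem σ_p (h : IsSwap τ σ p i) (v : V) : σ (p v) = p (τ (τ v)) := by
  rw [← h.p_τ_τ_i, h.τ_τ_i_p, h.p_i]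

/-- The kernel of `1 + τ` is the space of invariants of `σ`. -/
def kerEquiv (h : IsSwap τ σ p i) : LinearMap.ker (1 + τ) ≃ₗ[k] LinearMap.ker (1 - σ) :=
  have hτ : ∀ v : LinearMap.ker (1 + τ), τ v = -(v : V) := fun v =>
    (neg_eq_of_add_eq_zero_right v.2).symm
  have hσ : ∀ w : LinearMap.ker (1 - σ), σ w = w := fun w => (sub_eq_zero.1 w.2).symm
  LinearEquiv.ofLinearMap
    ((p ∘ₗ Submodule.subtype _).codRestrict _ fun v => by
      simp [h.σ_p, hτ])
    -- The inverse is w ↦ w - τ w: applying 1 + τ gives w - τ² w, and τ² is σ on W.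
    (((i - τ ∘ₗ i) ∘ₗ Submodule.subtype _).codRestrict _ fun w => by
      simp [h.τ_τ_i, hσ])
    (LinearMap.ext fun w => Subtype.ext <| by
      change p (i w - τ (i w)) = w
      rw [map_sub, h.p_i, h.p_τ_i, sub_zero])
    (LinearMap.ext fun v => Subtype.ext <| by
      change i (p v) - τ (i (p v)) = v
      rw [h.swap, hτ, map_neg, map_neg]
      abel)

/-- The cokernel of `1 + τ` is the space of coinvariants of `σ`. -/
def cokerEquiv (h : IsSwap τ σ p i) :
    (V ⧸ LinearMap.range (1 + τ)) ≃ₗ[k] (W ⧸ LinearMap.range (1 - σ)) :=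
  LinearEquiv.ofLinearMap
    -- Modulo the image of 1 + τ the part v - i p v is -τ (v - i p v) = -i p τ v, so v is
    -- represented in W by p v - p τ v.
    (Submodule.mapQ _ _ (p - p ∘ₗ τ) (by
      rintro _ ⟨v, rfl⟩
      exact ⟨p v, by simp [h.σ_p]; abel⟩))
    (Submodule.mapQ _ _ i (by
      rintro _ ⟨w, rfl⟩
      exact ⟨i w - τ (i w), by simp [h.τ_τ_i]⟩))
    (Submodule.linearMap_qext _ (LinearMap.ext fun w => by
      simp [h.p_i, h.p_τ_i]))
    (Submodule.linearMap_qext _ (LinearMap.ext fun v => (Submodule.Quotient.eq _).2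
      ⟨i (p v) - v, by
        simp [h.swap]; abel⟩))

end IsSwap

/-! ### Invariants and coinvariants of a group generated by one element. -/

section Cyclic

variable {G : Type*} [Group G] (ρ : Representation k G V) (g : G)

theorem invariants_eq_ker (hg : ∀ s, ∃ r : ℕ, g ^ r = s) :
    ρ.invariants = LinearMap.ker (1 - ρ g) := by
  ext v
  rw [Representation.mem_invariants, LinearMap.mem_ker, LinearMap.sub_apply, sub_eq_zero, eq_comm]
  refine ⟨fun h => h g, fun h s => ?_⟩
  obtain ⟨r, rfl⟩ := hg s
  induction r with
  | zero => simp
  | succ r ih => rw [pow_succ, map_mul, Module.End.mul_apply, h]; exact ih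

/-- By telescoping, gʳ v - v is a sum of terms g u - u. -/
theorem coinvariants_ker_eq_range (hg : ∀ s, ∃ r : ℕ, g ^ r = s) :
    Representation.Coinvariants.ker ρ = LinearMap.range (1 - ρ g) := by
  apply le_antisymm
  · refine Submodule.span_le.2 ?_
    rintro _ ⟨⟨s, v⟩, rfl⟩
    obtain ⟨r, rfl⟩ := hg s
    induction r generalizing v with
    | zero => simp
    | succ r ih =>
      have h : ρ g v - v = (1 - ρ g) (-v) := by simp [sub_eq_add_neg, add_comm]
      have h' : ρ (g ^ (r + 1)) v - v = (ρ (g ^ r) (ρ g v) - ρ g v) + (ρ g v - v) := by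
        rw [pow_succ, map_mul, Module.End.mul_apply, sub_add_sub_cancel]
      exact Set.mem_of_eq_of_mem h' (Submodule.add_mem _ (ih _) ⟨-v, h.symm⟩)
  · rintro _ ⟨v, rfl⟩
    have h : (1 - ρ g) v = ρ g (-v) - -v := by simp [sub_eq_add_neg, add_comm]
    exact h ▸ Representation.Coinvariants.sub_mem_ker g (-v)

end Cyclic

end LinearAlgebra

end NullSq

end

noncomputable section

namespace NullSq

open BimodPow

/-! ### Tensor powers of the off-diagonal bimodule with an even number of factors -/

namespace OffDiag

variable (k A B M N : Type*) [Field k] [Ring A] [Algebra k A] [Ring B] [Algebra k B]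
  [AddCommGroup M] [Module k M] [Module B M] [Module Aᵐᵒᵖ M]
  [IsScalarTower k B M] [IsScalarTower k Aᵐᵒᵖ M] [SMulCommClass B Aᵐᵒᵖ M]
  [AddCommGroup N] [Module k N] [Module A N] [Module Bᵐᵒᵖ N]
  [IsScalarTower k A N] [IsScalarTower k Bᵐᵒᵖ N] [SMulCommClass A Bᵐᵒᵖ N]

/-- The bilinear map `(j, j') ↦ j_M ⊗ j'_N`. -/
def pairing : OffDiag M N →ₗ[k] OffDiag M N →ₗ[k] BimodTensor k B A B M N :=
  (BimodTensor.tmulₗ k B A B).compl₁₂ (prM k M N) (prN k M N)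

variable {M N}

variable {k A B}

/-- Between a factor in `M` and one in `N` only the A-component of c acts, so this is the relation
of the tensor product over A. -/
theorem pairing_op_smul (c : A × B) (j j' : OffDiag M N) :
    pairing k A B M N (MulOpposite.op c • j) j' = pairing k A B M N j (c • j') :=
  BimodTensor.tmul_smul k B A B j.1 c.1 j'.2

theorem pairing_smul_left (c : A × B) (j j' : OffDiag M N) :
    pairing k A B M N (c • j) j' = c.2 • pairing k A B M N j j' := rfl

theorem pairing_smul_right (c : A × B) (j j' : OffDiag M N) :
    pairing k A B M N j (MulOpposite.op c • j') =
      MulOpposite.op c.2 • pairing k A B M N j j' := rfl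

theorem smul_inM (c : A × B) (x : M) : c • inM k M N x = inM k M N (c.2 • x) := by
  ext <;> simp

theorem op_smul_inM (c : A × B) (x : M) :
    MulOpposite.op c • inM k M N x = inM k M N (MulOpposite.op c.1 • x) := by
  ext <;> simp

theorem smul_inN (c : A × B) (x : N) : c • inN k M N x = inN k M N (c.1 • x) := by
  ext <;> simp

theorem op_smul_inN (c : A × B) (x : N) :
    MulOpposite.op c • inN k M N x = inN k M N (MulOpposite.op c.2 • x) := by
  ext <;> simp

/-- The step in the definition of `contract`: `j ⊗ j' ⊗ t ↦ (j_M ⊗ j'_N) ⊗ f(t)`. -/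
def contractInner {n m : ℕ}
    (f : BimodPow k (A × B) (OffDiag M N) n →ₗ[k] BimodPow k B (BimodTensor k B A B M N) m)
    (hf : ∀ (c : A × B) t, f (c • t) = c.2 • f t) (j : OffDiag M N) :
    BimodPow k (A × B) (OffDiag M N) (n + 1) →ₗ[k]
      BimodPow k B (BimodTensor k B A B M N) (m + 1) :=
  liftCons (((cons k B _ m).comp (pairing k A B M N j)).compl₂ f) (fun j' c t => by
    simp only [LinearMap.compl₂_apply, LinearMap.comp_apply, pairing_smul_right, hf,
      cons_op_smul])

theorem contractInner_cons {n m : ℕ}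
    (f : BimodPow k (A × B) (OffDiag M N) n →ₗ[k] BimodPow k B (BimodTensor k B A B M N) m)
    (hf : ∀ (c : A × B) t, f (c • t) = c.2 • f t) (j j' : OffDiag M N)
    (t : BimodPow k (A × B) (OffDiag M N) n) :
    contractInner f hf j (cons k _ _ _ j' t) = cons k B _ m (pairing k A B M N j j') (f t) := by
  rw [contractInner, liftCons_cons]
  rfl

/-- The step in the definition of `contract`: `j ⊗ j' ⊗ t ↦ (j_M ⊗ j'_N) ⊗ f(t)`. -/
def contractStep {n m : ℕ}
    (f : BimodPow k (A × B) (OffDiag M N) n →ₗ[k] BimodPow k B (BimodTensor k B A B M N) m)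
    (hf : ∀ (c : A × B) t, f (c • t) = c.2 • f t) :
    BimodPow k (A × B) (OffDiag M N) (n + 2) →ₗ[k]
      BimodPow k B (BimodTensor k B A B M N) (m + 1) :=
  liftCons
    { toFun := contractInner f hf
      map_add' := fun j j' => hom_ext_cons fun i t => by simp [contractInner_cons]
      map_smul' := fun r j => hom_ext_cons fun i t => by simp [contractInner_cons] }
    (fun j c t => by
      have h : contractInner f hf (MulOpposite.op c • j) =
          contractInner f hf j ∘ₗ Algebra.lsmul k k _ c := hom_ext_cons fun i t => by
        simp [contractInner_cons, pairing_op_smul]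
      exact LinearMap.congr_fun h t)

theorem contractStep_cons {n m : ℕ}
    (f : BimodPow k (A × B) (OffDiag M N) n →ₗ[k] BimodPow k B (BimodTensor k B A B M N) m)
    (hf : ∀ (c : A × B) t, f (c • t) = c.2 • f t) (j j' : OffDiag M N)
    (t : BimodPow k (A × B) (OffDiag M N) n) :
    contractStep f hf (cons k _ _ _ j (cons k _ _ _ j' t)) =
      cons k B _ m (pairing k A B M N j j') (f t) :=
  (liftCons_cons _ _ _ _).trans (contractInner_cons f hf j j' t)

variable (k A B M N) in
/-- The first case of `contract`. -/
def contractPair :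
    BimodPow k (A × B) (OffDiag M N) 1 →ₗ[k] BimodPow k B (BimodTensor k B A B M N) 0 :=
  liftCons (((pairing k A B M N).compl₂ (single k (A × B) _).symm.toLinearMap).compr₂
    (single k B _).toLinearMap) (fun j c t => by
      obtain ⟨j', rfl⟩ := (single k (A × B) (OffDiag M N)).surjective t
      simp [smul_single, pairing_op_smul])

theorem contractPair_cons (j j' : OffDiag M N) :
    contractPair k A B M N (cons k _ _ _ j (single k _ _ j')) =
      single k B _ (pairing k A B M N j j') := by
  rw [contractPair, liftCons_cons]
  simp

theorem hom_ext_cons_single {Z : Type*} [AddCommGroup Z] [Module k Z]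
    {f g : BimodPow k (A × B) (OffDiag M N) 1 →ₗ[k] Z}
    (h : ∀ j j', f (cons k _ _ _ j (single k _ _ j')) = g (cons k _ _ _ j (single k _ _ j'))) :
    f = g := hom_ext_cons fun j t => by
  obtain ⟨j', rfl⟩ := (single k (A × B) (OffDiag M N)).surjective t
  exact h j j'

theorem hom_ext_cons_cons {n : ℕ} {Z : Type*} [AddCommGroup Z] [Module k Z]
    {f g : BimodPow k (A × B) (OffDiag M N) (n + 2) →ₗ[k] Z}
    (h : ∀ j j' t, f (cons k _ _ _ j (cons k _ _ _ j' t)) = g (cons k _ _ _ j (cons k _ _ _ j' t))) :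
    f = g := hom_ext_cons fun j t =>
  LinearMap.congr_fun (f := f ∘ₗ cons k _ _ _ j) (g := g ∘ₗ cons k _ _ _ j)
    (hom_ext_cons (h j)) t

theorem contractPair_op_smul (c : A × B) (t : BimodPow k (A × B) (OffDiag M N) 1) :
    contractPair k A B M N (MulOpposite.op c • t) =
      MulOpposite.op c.2 • contractPair k A B M N t :=
  LinearMap.congr_fun
    (f := contractPair k A B M N ∘ₗ Algebra.lsmul k k _ (MulOpposite.op c))
    (g := Algebra.lsmul k k _ (MulOpposite.op c.2) ∘ₗ contractPair k A B M N)
    (hom_ext_cons_single fun j j' => by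
      simp [contractPair_cons, op_smul_single, pairing_smul_right]) t

theorem contractStep_op_smul {n m : ℕ}
    (f : BimodPow k (A × B) (OffDiag M N) n →ₗ[k] BimodPow k B (BimodTensor k B A B M N) m)
    (hf : ∀ (c : A × B) t, f (c • t) = c.2 • f t) (c : A × B)
    (hc : ∀ t, f (MulOpposite.op c • t) = MulOpposite.op c.2 • f t)
    (t : BimodPow k (A × B) (OffDiag M N) (n + 2)) :
    contractStep f hf (MulOpposite.op c • t) = MulOpposite.op c.2 • contractStep f hf t :=
  LinearMap.congr_fun
    (f := contractStep f hf ∘ₗ Algebra.lsmul k k _ (MulOpposite.op c))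
    (g := Algebra.lsmul k k _ (MulOpposite.op c.2) ∘ₗ contractStep f hf)
    (hom_ext_cons_cons fun j j' t => by
      simp [contractStep_cons, hc]) t

variable (k A B M N) in
/-- The map `contract`, together with its compatibility with the left action. -/
def contractAux : ∀ m : ℕ,
    {f : BimodPow k (A × B) (OffDiag M N) (2 * m + 1) →ₗ[k]
      BimodPow k B (BimodTensor k B A B M N) m // ∀ (c : A × B) t, f (c • t) = c.2 • f t}
  | 0 => ⟨contractPair k A B M N, fun c t => LinearMap.congr_fun
      (f := contractPair k A B M N ∘ₗ Algebra.lsmul k k _ c)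
      (g := Algebra.lsmul k k _ c.2 ∘ₗ contractPair k A B M N) (hom_ext_cons_single fun j j' => by
        simp [contractPair_cons, pairing_smul_left, smul_single]) t⟩
  | m + 1 => ⟨contractStep (contractAux m).1 (contractAux m).2, fun c t => LinearMap.congr_fun
      (f := contractStep (contractAux m).1 (contractAux m).2 ∘ₗ Algebra.lsmul k k _ c)
      (g := Algebra.lsmul k k _ c.2 ∘ₗ contractStep (contractAux m).1 (contractAux m).2)
      (hom_ext_cons_cons fun j j' t => by
        simp [contractStep_cons, pairing_smul_left]) t⟩

variable (k A B M N) in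
/-- The map from the tensor power of `M × N` with `2 m + 2` factors to the tensor power of `M ⊗ N`
with `m + 1` factors that takes pairs of adjacent factors to their components in `M` and in `N`. -/
def contract (m : ℕ) : BimodPow k (A × B) (OffDiag M N) (2 * m + 1) →ₗ[k]
    BimodPow k B (BimodTensor k B A B M N) m := (contractAux k A B M N m).1

theorem contract_smul (m : ℕ) (c : A × B) (t : BimodPow k (A × B) (OffDiag M N) (2 * m + 1)) :
    contract k A B M N m (c • t) = c.2 • contract k A B M N m t := (contractAux k A B M N m).2 c t

theorem contract_zero (j j' : OffDiag M N) :
    contract k A B M N 0 (cons k _ _ 0 j (single k _ _ j')) =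
      single k B _ (pairing k A B M N j j') := contractPair_cons j j'

theorem contract_succ (m : ℕ) (j j' : OffDiag M N)
    (t : BimodPow k (A × B) (OffDiag M N) (2 * m + 1)) :
    contract k A B M N (m + 1) (cons k _ _ (2 * m + 2) j (cons k _ _ (2 * m + 1) j' t)) =
      cons k B _ m (pairing k A B M N j j') (contract k A B M N m t) :=
  contractStep_cons _ (contractAux k A B M N m).2 j j' t

theorem contract_op_smul : ∀ (m : ℕ) (c : A × B)
    (t : BimodPow k (A × B) (OffDiag M N) (2 * m + 1)),
    contract k A B M N m (MulOpposite.op c • t) = MulOpposite.op c.2 • contract k A B M N m t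
  | 0, c, t => contractPair_op_smul c t
  | m + 1, c, t => contractStep_op_smul _ (contractAux k A B M N m).2 c (contract_op_smul m c) t

/-! ### The inverse of `contract` -/

variable (k A B M N) in
/-- The bilinear map `(m ⊗ n, t) ↦ m ⊗ n ⊗ t`. -/
def expandCons (n : ℕ) : BimodTensor k B A B M N →ₗ[k]
    BimodPow k (A × B) (OffDiag M N) n →ₗ[k] BimodPow k (A × B) (OffDiag M N) (n + 2) :=
  BimodTensor.lift k B A B
    ((LinearMap.llcomp k _ _ _).compl₁₂ (cons k (A × B) (OffDiag M N) (n + 1) ∘ₗ inM k M N)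
      (cons k (A × B) (OffDiag M N) n ∘ₗ inN k M N))
    (fun x a y => LinearMap.ext fun t => by
      -- Both actions of a come from (a, 0) in A × B, so the relation over A is an instance of the
      -- relation over A × B.
      have hx : inM k M N (MulOpposite.op a • x) = MulOpposite.op (a, (0 : B)) • inM k M N x :=
        (op_smul_inM (a, (0 : B)) x).symm
      have hy : inN k M N (a • y) = (a, (0 : B)) • inN k M N y := (smul_inN (a, (0 : B)) y).symm
      simp [hx, hy, cons_op_smul])

theorem expandCons_tmul (n : ℕ) (x : M) (y : N) (t : BimodPow k (A × B) (OffDiag M N) n) :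
    expandCons k A B M N n (BimodTensor.tmul k B A B x y) t =
      cons k _ _ (n + 1) (inM k M N x) (cons k _ _ n (inN k M N y) t) := rfl

theorem expandCons_op_smul (n : ℕ) (c : A × B) (x : BimodTensor k B A B M N)
    (t : BimodPow k (A × B) (OffDiag M N) n) :
    expandCons k A B M N n (MulOpposite.op c.2 • x) t = expandCons k A B M N n x (c • t) :=
  LinearMap.congr_fun
    (f := (expandCons k A B M N n).flip t ∘ₗ Algebra.lsmul k k _ (MulOpposite.op c.2))
    (g := (expandCons k A B M N n).flip (c • t)) (BimodTensor.hom_ext fun x y => by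
      simp [expandCons_tmul, ← op_smul_inN, cons_op_smul]) x

theorem expandCons_smul (n : ℕ) (c : A × B) (x : BimodTensor k B A B M N)
    (t : BimodPow k (A × B) (OffDiag M N) n) :
    expandCons k A B M N n (c.2 • x) t = c • expandCons k A B M N n x t :=
  LinearMap.congr_fun
    (f := (expandCons k A B M N n).flip t ∘ₗ Algebra.lsmul k k _ c.2)
    (g := Algebra.lsmul k k _ c ∘ₗ (expandCons k A B M N n).flip t)
    (BimodTensor.hom_ext fun x y => by
      simp [expandCons_tmul, smul_inM]) x

theorem expandCons_smul_right (n : ℕ) (c : A × B) (x : BimodTensor k B A B M N)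
    (t : BimodPow k (A × B) (OffDiag M N) n) :
    expandCons k A B M N n x (MulOpposite.op c • t) =
      MulOpposite.op c • expandCons k A B M N n x t :=
  LinearMap.congr_fun
    (f := (expandCons k A B M N n).flip (MulOpposite.op c • t))
    (g := Algebra.lsmul k k _ (MulOpposite.op c) ∘ₗ (expandCons k A B M N n).flip t)
    (BimodTensor.hom_ext fun x y => by
      simp [expandCons_tmul]) x

variable (k A B M N) in
/-- The linear map `m ⊗ n ↦ m ⊗ n`. -/
def expandPair : BimodTensor k B A B M N →ₗ[k] BimodPow k (A × B) (OffDiag M N) 1 :=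
  BimodTensor.lift k B A B
    ((cons k (A × B) (OffDiag M N) 0).compl₁₂ (inM k M N)
      ((single k (A × B) (OffDiag M N)).toLinearMap ∘ₗ inN k M N))
    (fun x a y => by
      have hx : inM k M N (MulOpposite.op a • x) = MulOpposite.op (a, (0 : B)) • inM k M N x :=
        (op_smul_inM (a, (0 : B)) x).symm
      have hy : inN k M N (a • y) = (a, (0 : B)) • inN k M N y := (smul_inN (a, (0 : B)) y).symm
      simp [hx, hy, cons_op_smul, smul_single])

theorem expandPair_tmul (x : M) (y : N) :
    expandPair k A B M N (BimodTensor.tmul k B A B x y) =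
      cons k _ _ 0 (inM k M N x) (single k _ _ (inN k M N y)) := rfl

theorem expandPair_smul (c : A × B) (x : BimodTensor k B A B M N) :
    expandPair k A B M N (c.2 • x) = c • expandPair k A B M N x :=
  LinearMap.congr_fun (f := expandPair k A B M N ∘ₗ Algebra.lsmul k k _ c.2)
    (g := Algebra.lsmul k k _ c ∘ₗ expandPair k A B M N) (BimodTensor.hom_ext fun x y => by
      simp [expandPair_tmul, smul_inM]) x

theorem expandPair_op_smul (c : A × B) (x : BimodTensor k B A B M N) :
    expandPair k A B M N (MulOpposite.op c.2 • x) = MulOpposite.op c • expandPair k A B M N x :=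
  LinearMap.congr_fun (f := expandPair k A B M N ∘ₗ Algebra.lsmul k k _ (MulOpposite.op c.2))
    (g := Algebra.lsmul k k _ (MulOpposite.op c) ∘ₗ expandPair k A B M N)
    (BimodTensor.hom_ext fun x y => by
      simp [expandPair_tmul, op_smul_inN, op_smul_single]) x

/-- The step in the definition of `expand`: `x ⊗ t ↦ x ⊗ f(t)`. -/
def expandStep {n m : ℕ}
    (f : BimodPow k B (BimodTensor k B A B M N) m →ₗ[k] BimodPow k (A × B) (OffDiag M N) n)
    (hf : ∀ (c : A × B) t, f (c.2 • t) = c • f t) :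
    BimodPow k B (BimodTensor k B A B M N) (m + 1) →ₗ[k]
      BimodPow k (A × B) (OffDiag M N) (n + 2) :=
  liftCons ((expandCons k A B M N n).compl₂ f) (fun x b t => by
    have h := expandCons_op_smul n ((0 : A), b) x (f t)
    rw [← hf] at h
    exact h)

theorem expandStep_cons {n m : ℕ}
    (f : BimodPow k B (BimodTensor k B A B M N) m →ₗ[k] BimodPow k (A × B) (OffDiag M N) n)
    (hf : ∀ (c : A × B) t, f (c.2 • t) = c • f t) (x : BimodTensor k B A B M N)
    (t : BimodPow k B (BimodTensor k B A B M N) m) :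
    expandStep f hf (cons k B _ m x t) = expandCons k A B M N n x (f t) :=
  liftCons_cons _ _ _ _

theorem expandStep_smul {n m : ℕ}
    (f : BimodPow k B (BimodTensor k B A B M N) m →ₗ[k] BimodPow k (A × B) (OffDiag M N) n)
    (hf : ∀ (c : A × B) t, f (c.2 • t) = c • f t) (c : A × B)
    (t : BimodPow k B (BimodTensor k B A B M N) (m + 1)) :
    expandStep f hf (c.2 • t) = c • expandStep f hf t :=
  LinearMap.congr_fun (f := expandStep f hf ∘ₗ Algebra.lsmul k k _ c.2)
    (g := Algebra.lsmul k k _ c ∘ₗ expandStep f hf) (hom_ext_cons fun x t => by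
      simp [expandStep_cons, expandCons_smul]) t

theorem expandStep_op_smul {n m : ℕ}
    (f : BimodPow k B (BimodTensor k B A B M N) m →ₗ[k] BimodPow k (A × B) (OffDiag M N) n)
    (hf : ∀ (c : A × B) t, f (c.2 • t) = c • f t) (c : A × B)
    (hc : ∀ t, f (MulOpposite.op c.2 • t) = MulOpposite.op c • f t)
    (t : BimodPow k B (BimodTensor k B A B M N) (m + 1)) :
    expandStep f hf (MulOpposite.op c.2 • t) = MulOpposite.op c • expandStep f hf t :=
  LinearMap.congr_fun (f := expandStep f hf ∘ₗ Algebra.lsmul k k _ (MulOpposite.op c.2))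
    (g := Algebra.lsmul k k _ (MulOpposite.op c) ∘ₗ expandStep f hf)
    (hom_ext_cons fun x t => by
      simp [expandStep_cons, expandCons_smul_right, hc]) t

variable (k A B M N) in
/-- The map `expand`, together with its compatibility with the left action. -/
def expandAux : ∀ m : ℕ,
    {f : BimodPow k B (BimodTensor k B A B M N) m →ₗ[k]
      BimodPow k (A × B) (OffDiag M N) (2 * m + 1) // ∀ (c : A × B) t, f (c.2 • t) = c • f t}
  | 0 => ⟨expandPair k A B M N ∘ₗ (single k B _).symm.toLinearMap, fun c t => by
      obtain ⟨x, rfl⟩ := (single k B (BimodTensor k B A B M N)).surjective t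
      rw [smul_single]
      simp [expandPair_smul]⟩
  | m + 1 => ⟨expandStep (expandAux m).1 (expandAux m).2, expandStep_smul _ _⟩

variable (k A B M N) in
/-- The map from the tensor power of `M ⊗ N` with `m + 1` factors to the tensor power of `M × N`
with `2 m + 2` factors. -/
def expand (m : ℕ) : BimodPow k B (BimodTensor k B A B M N) m →ₗ[k]
    BimodPow k (A × B) (OffDiag M N) (2 * m + 1) := (expandAux k A B M N m).1

theorem expand_smul (m : ℕ) (c : A × B) (t : BimodPow k B (BimodTensor k B A B M N) m) :
    expand k A B M N m (c.2 • t) = c • expand k A B M N m t := (expandAux k A B M N m).2 c t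

theorem expand_single (x : BimodTensor k B A B M N) :
    expand k A B M N 0 (single k B _ x) = expandPair k A B M N x :=
  congrArg (expandPair k A B M N) ((single k B _).symm_apply_apply x)

theorem expand_cons (m : ℕ) (x : BimodTensor k B A B M N)
    (t : BimodPow k B (BimodTensor k B A B M N) m) :
    expand k A B M N (m + 1) (cons k B _ m x t) =
      expandCons k A B M N (2 * m + 1) x (expand k A B M N m t) :=
  expandStep_cons _ (expandAux k A B M N m).2 x t

theorem expand_op_smul : ∀ (m : ℕ) (c : A × B) (t : BimodPow k B (BimodTensor k B A B M N) m),
    expand k A B M N m (MulOpposite.op c.2 • t) = MulOpposite.op c • expand k A B M N m t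
  | 0, c, t => by
      obtain ⟨x, rfl⟩ := (single k B (BimodTensor k B A B M N)).surjective t
      rw [op_smul_single, expand_single, expand_single]
      exact expandPair_op_smul c x
  | m + 1, c, t => expandStep_op_smul _ (expandAux k A B M N m).2 c (expand_op_smul m c) t

end OffDiag

end NullSq

end

/-! ### Pairing the factors identifies the summand that begins in M. -/

noncomputable section

namespace NullSq

open BimodPow

namespace OffDiag

variable {k A B M N : Type*} [Field k] [Ring A] [Algebra k A] [Ring B] [Algebra k B]
  [AddCommGroup M] [Module k M] [Module B M] [Module Aᵐᵒᵖ M]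
  [IsScalarTower k B M] [IsScalarTower k Aᵐᵒᵖ M] [SMulCommClass B Aᵐᵒᵖ M]
  [AddCommGroup N] [Module k N] [Module A N] [Module Bᵐᵒᵖ N]
  [IsScalarTower k A N] [IsScalarTower k Bᵐᵒᵖ N] [SMulCommClass A Bᵐᵒᵖ N]

theorem contract_expandPair (x : BimodTensor k B A B M N) :
    contract k A B M N 0 (expandPair k A B M N x) = single k B _ x :=
  LinearMap.congr_fun (f := contract k A B M N 0 ∘ₗ expandPair k A B M N)
    (g := (single k B _).toLinearMap)
    (BimodTensor.hom_ext fun y z => contract_zero (inM k M N y) (inN k M N z)) x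

theorem contract_expandCons (m : ℕ) (x : BimodTensor k B A B M N)
    (t : BimodPow k (A × B) (OffDiag M N) (2 * m + 1)) :
    contract k A B M N (m + 1) (expandCons k A B M N (2 * m + 1) x t) =
      cons k B _ m x (contract k A B M N m t) :=
  LinearMap.congr_fun
    (f := contract k A B M N (m + 1) ∘ₗ (expandCons k A B M N (2 * m + 1)).flip t)
    (g := (cons k B _ m).flip (contract k A B M N m t))
    (BimodTensor.hom_ext fun y z => contract_succ m (inM k M N y) (inN k M N z) t) x

theorem contract_expand : ∀ (m : ℕ) (t : BimodPow k B (BimodTensor k B A B M N) m),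
    contract k A B M N m (expand k A B M N m t) = t
  | 0, t => by
    obtain ⟨x, rfl⟩ := (single k B (BimodTensor k B A B M N)).surjective t
    rw [expand_single, contract_expandPair]
  | m + 1, t => LinearMap.congr_fun
    (f := contract k A B M N (m + 1) ∘ₗ expand k A B M N (m + 1)) (g := LinearMap.id)
    (hom_ext_cons fun x t => by
      rw [LinearMap.comp_apply, expand_cons, contract_expandCons, contract_expand m]
      rfl) t

theorem inM_fst_eq_smul (j : OffDiag M N) : inM k M N j.1 = ((0, 1) : A × B) • j := by
  ext <;> simp

theorem inN_snd_eq_smul (j : OffDiag M N) : inN k M N j.2 = ((1, 0) : A × B) • j := by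
  ext <;> simp

theorem op_smul_right_unit (j : OffDiag M N) :
    MulOpposite.op ((0, 1) : A × B) • j = ((1, 0) : A × B) • j := by
  ext <;> simp

theorem op_smul_left_unit (j : OffDiag M N) :
    MulOpposite.op ((1, 0) : A × B) • j = ((0, 1) : A × B) • j := by
  ext <;> simp

/-- One idempotent in front fixes the type of every factor: (0, 1) selects `M` in the first, crosses
the tensor sign as (1, 0), which selects `N` in the second, and reaches the third as (0, 1) again.
-/
theorem cons_inM_cons (n : ℕ) (j j' : OffDiag M N) (t : BimodPow k (A × B) (OffDiag M N) n) :
    cons k (A × B) _ (n + 1) (inM k M N j.1)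
      (cons k (A × B) _ n (inN k M N j'.2) (((0, 1) : A × B) • t)) =
      ((0, 1) : A × B) • cons k (A × B) _ (n + 1) j (cons k (A × B) _ n j' t) := by
  have h : ((1, 0) : A × B) * (1, 0) = (1, 0) := by simp
  rw [inN_snd_eq_smul (A := A) (B := B), ← cons_op_smul, op_smul_right_unit, smul_smul, h, ← smul_cons,
    ← cons_op_smul, inM_fst_eq_smul (A := A) (B := B), smul_cons, op_smul_left_unit, smul_smul]
  simp

theorem cons_inM_single (j j' : OffDiag M N) :
    cons k (A × B) _ 0 (inM k M N j.1) (single k (A × B) _ (inN k M N j'.2)) =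
      ((0, 1) : A × B) • cons k (A × B) _ 0 j (single k (A × B) _ j') := by
  rw [inN_snd_eq_smul (A := A) (B := B), ← smul_single, ← cons_op_smul, inM_fst_eq_smul (A := A) (B := B),
    smul_cons, op_smul_left_unit, smul_smul]
  simp

theorem expandPair_pairing (j j' : OffDiag M N) :
    expandPair k A B M N (pairing k A B M N j j') =
      ((0, 1) : A × B) • cons k (A × B) _ 0 j (single k (A × B) _ j') :=
  (expandPair_tmul (k := k) (A := A) (B := B) j.1 j'.2).trans (cons_inM_single j j')

theorem expandCons_pairing (n : ℕ) (j j' : OffDiag M N)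
    (t : BimodPow k (A × B) (OffDiag M N) n) :
    expandCons k A B M N n (pairing k A B M N j j') (((0, 1) : A × B) • t) =
      ((0, 1) : A × B) • cons k (A × B) _ (n + 1) j (cons k (A × B) _ n j' t) :=
  (expandCons_tmul (k := k) (A := A) (B := B) n j.1 j'.2 _).trans (cons_inM_cons n j j' t)

theorem expand_contract_zero (t : BimodPow k (A × B) (OffDiag M N) 1) :
    expand k A B M N 0 (contract k A B M N 0 t) = ((0, 1) : A × B) • t := by
  have h : expand k A B M N 0 ∘ₗ contract k A B M N 0 =
      Algebra.lsmul k k (BimodPow k (A × B) (OffDiag M N) 1) ((0, 1) : A × B) :=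
    hom_ext_cons_single fun j j' => by
      have h₁ := congrArg (expand k A B M N 0) (contract_zero (k := k) (A := A) (B := B) j j')
      rw [expand_single, expandPair_pairing] at h₁
      exact h₁
  exact LinearMap.congr_fun h t

theorem expand_contract_succ (m : ℕ)
    (hm : ∀ t : BimodPow k (A × B) (OffDiag M N) (2 * m + 1),
      expand k A B M N m (contract k A B M N m t) = ((0, 1) : A × B) • t)
    (t : BimodPow k (A × B) (OffDiag M N) (2 * m + 1 + 2)) :
    expand k A B M N (m + 1) (contract k A B M N (m + 1) t) = ((0, 1) : A × B) • t := by
  have h : expand k A B M N (m + 1) ∘ₗ contract k A B M N (m + 1) =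
      Algebra.lsmul k k (BimodPow k (A × B) (OffDiag M N) (2 * m + 1 + 2)) ((0, 1) : A × B) :=
    hom_ext_cons_cons fun j j' t => by
      have h₁ := congrArg (expand k A B M N (m + 1))
        (contract_succ (k := k) (A := A) (B := B) m j j' t)
      rw [expand_cons, hm, expandCons_pairing] at h₁
      exact h₁
  exact LinearMap.congr_fun h t

/-- Together with `contract_expand`, this identifies the tensor power of M ⊗_A N with the summand of
words whose first factor is in `M`. -/
theorem expand_contract : ∀ (m : ℕ) (t : BimodPow k (A × B) (OffDiag M N) (2 * m + 1)),
    expand k A B M N m (contract k A B M N m t) = ((0, 1) : A × B) • t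
  | 0, t => expand_contract_zero t
  | m + 1, t => expand_contract_succ m (expand_contract m) t

theorem expandCons_expandPair (x : BimodTensor k B A B M N) (y : M) (z : N) :
    expandCons k A B M N 1 x (expandPair k A B M N (BimodTensor.tmul k B A B y z)) =
      snoc k (A × B) (OffDiag M N) 2 (snoc k (A × B) (OffDiag M N) 1 (expandPair k A B M N x) (inM k M N y))
        (inN k M N z) :=
  LinearMap.congr_fun
    (f := (expandCons k A B M N 1).flip (expandPair k A B M N (BimodTensor.tmul k B A B y z)))
    (g := (snoc k (A × B) (OffDiag M N) 2).flip (inN k M N z) ∘ₗ (snoc k (A × B) (OffDiag M N) 1).flip (inM k M N y) ∘ₗ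
      expandPair k A B M N)
    (BimodTensor.hom_ext fun x₁ x₂ => by
      simp only [LinearMap.flip_apply, LinearMap.comp_apply, expandPair_tmul, expandCons_tmul,
        cons_single, cons_snoc]) x

theorem expandCons_snoc_snoc (n : ℕ) (x : BimodTensor k B A B M N)
    (t : BimodPow k (A × B) (OffDiag M N) n) (j j' : OffDiag M N) :
    expandCons k A B M N (n + 2) x (snoc k (A × B) (OffDiag M N) (n + 1) (snoc k (A × B) (OffDiag M N) n t j) j') =
      snoc k (A × B) (OffDiag M N) (n + 3) (snoc k (A × B) (OffDiag M N) (n + 2) (expandCons k A B M N n x t) j) j' :=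
  LinearMap.congr_fun
    (f := (expandCons k A B M N (n + 2)).flip
      (snoc k (A × B) (OffDiag M N) (n + 1) (snoc k (A × B) (OffDiag M N) n t j) j'))
    (g := (snoc k (A × B) (OffDiag M N) (n + 3)).flip j' ∘ₗ (snoc k (A × B) (OffDiag M N) (n + 2)).flip j ∘ₗ
      (expandCons k A B M N n).flip t)
    (BimodTensor.hom_ext fun x₁ x₂ => by
      simp only [LinearMap.flip_apply, LinearMap.comp_apply, expandCons_tmul, cons_snoc]) x

/-- `expand` is defined recursively from the front, whereas rotation takes factors from the end;
hence a formula at the end is needed. -/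
theorem expand_snoc : ∀ (m : ℕ) (t : BimodPow k B (BimodTensor k B A B M N) m) (y : M) (z : N),
    expand k A B M N (m + 1) (snoc k B (BimodTensor k B A B M N) m t (BimodTensor.tmul k B A B y z)) =
      snoc k (A × B) (OffDiag M N) (2 * m + 2)
        (snoc k (A × B) (OffDiag M N) (2 * m + 1) (expand k A B M N m t) (inM k M N y)) (inN k M N z)
  | 0, t, y, z => by
    obtain ⟨x, rfl⟩ := (single k B (BimodTensor k B A B M N)).surjective t
    rw [← cons_single, expand_cons, expand_single, expand_single]
    exact expandCons_expandPair x y z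
  | m + 1, t, y, z => LinearMap.congr_fun
    (f := expand k A B M N (m + 2) ∘ₗ (snoc k B (BimodTensor k B A B M N) (m + 1)).flip (BimodTensor.tmul k B A B y z))
    (g := (snoc k (A × B) (OffDiag M N) (2 * m + 4)).flip (inN k M N z) ∘ₗ
      (snoc k (A × B) (OffDiag M N) (2 * m + 3)).flip (inM k M N y) ∘ₗ expand k A B M N (m + 1))
    (hom_ext_cons fun x t => by
      simp only [LinearMap.flip_apply, LinearMap.comp_apply]
      rw [← cons_snoc, expand_cons, expand_snoc m t, expand_cons]
      exact expandCons_snoc_snoc _ _ _ _ _) t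

/-! ### Passage to H₀ and comparison of the rotations. -/

variable (k A B M N) in
/-- The map on `H_0` given by `contract`. -/
def cycContract (m : ℕ) : CycPow k (A × B) (OffDiag M N) (2 * m + 1) →ₗ[k]
    CycPow k B (BimodTensor k B A B M N) m :=
  cycLift (cycMk k B ∘ₗ contract k A B M N m) (fun c t => by
    rw [LinearMap.comp_apply, LinearMap.comp_apply, contract_smul, contract_op_smul, cycMk_smul])

variable (k A B M N) in
/-- The map on `H_0` given by `expand`. -/
def cycExpand (m : ℕ) : CycPow k B (BimodTensor k B A B M N) m →ₗ[k]
    CycPow k (A × B) (OffDiag M N) (2 * m + 1) :=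
  cycLift (cycMk k (A × B) ∘ₗ expand k A B M N m) (fun b t => by
    rw [LinearMap.comp_apply, LinearMap.comp_apply]
    exact (congrArg _ (expand_smul m ((0 : A), b) t)).trans ((cycMk_smul _ _).trans
      (congrArg _ (expand_op_smul m ((0 : A), b) t).symm)))

theorem rot_rot_snoc (n : ℕ) (t : BimodPow k (A × B) (OffDiag M N) n) (j j' : OffDiag M N) :
    rot k (A × B) _ (n + 2) 1 (rot k (A × B) _ (n + 2) 1 (cycMk k (A × B)
      (snoc k (A × B) _ (n + 1) (snoc k (A × B) _ n t j) j'))) =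
      cycMk k (A × B) (cons k (A × B) _ (n + 1) j (cons k (A × B) _ n j' t)) := by
  rw [rot_cycMk_snoc, cons_snoc, rot_cycMk_snoc]

/-- Rotating the pairs by one place is rotating the single factors by two: the last pair moves to
the front one factor after the other. -/
theorem cycContract_rot_rot_cycExpand : ∀ (m : ℕ) (w : CycPow k B (BimodTensor k B A B M N) m),
    cycContract k A B M N m (rot k (A × B) _ (2 * m + 1) 1 (rot k (A × B) _ (2 * m + 1) 1
      (cycExpand k A B M N m w))) = rot k B _ m 1 w
  | 0, w => by
    -- With one pair nothing moves: 1 + 1 = 0 in `Fin 2`.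
    have h : rot k (A × B) (OffDiag M N) (2 * 0 + 1) 1 * rot k (A × B) (OffDiag M N) (2 * 0 + 1) 1 =
        1 := by
      rw [← rot_add]
      exact rot_zero k (A × B) (OffDiag M N) 1
    obtain ⟨t, rfl⟩ := Submodule.Quotient.mk_surjective _ w
    have h' : rot k B (BimodTensor k B A B M N) 0 1 = 1 := rot_zero k B _ 0
    rw [h', ← Module.End.mul_apply, h]
    exact congrArg (cycMk k B) (contract_expand 0 t)
  | m + 1, w => by
    obtain ⟨t, rfl⟩ := Submodule.Quotient.mk_surjective _ w
    refine LinearMap.congr_fun (f := cycContract k A B M N (m + 1) ∘ₗ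
      rot k (A × B) _ (2 * (m + 1) + 1) 1 ∘ₗ rot k (A × B) _ (2 * (m + 1) + 1) 1 ∘ₗ
        cycExpand k A B M N (m + 1) ∘ₗ cycMk k B) (g := rot k B _ (m + 1) 1 ∘ₗ cycMk k B)
      (hom_ext_snoc fun t x => ?_) t
    refine LinearMap.congr_fun (f := cycContract k A B M N (m + 1) ∘ₗ
      rot k (A × B) _ (2 * (m + 1) + 1) 1 ∘ₗ rot k (A × B) _ (2 * (m + 1) + 1) 1 ∘ₗ
        cycExpand k A B M N (m + 1) ∘ₗ cycMk k B ∘ₗ snoc k B _ m t)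
      (g := rot k B _ (m + 1) 1 ∘ₗ cycMk k B ∘ₗ snoc k B _ m t)
      (BimodTensor.hom_ext fun y z => ?_) x
    simp only [LinearMap.comp_apply]
    rw [rot_cycMk_snoc, cycExpand, cycLift_cycMk, LinearMap.comp_apply, expand_snoc]
    refine (congrArg _ (rot_rot_snoc (2 * m + 1) _ _ _)).trans ?_
    rw [cycContract, cycLift_cycMk, LinearMap.comp_apply]
    exact congrArg (cycMk k B) ((contract_succ m _ _ _).trans
      (congrArg _ (contract_expand m t)))

theorem cycExpand_cycContract (m : ℕ) (x : Fin (2 * m + 2) → OffDiag M N) :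
    cycExpand k A B M N m (cycContract k A B M N m (cycTprod k (A × B) _ (2 * m + 1) x)) =
      cycTprod k (A × B) _ (2 * m + 1) (Function.update x 0 (((0, 1) : A × B) • x 0)) := by
  refine (congrArg (cycMk k (A × B)) (expand_contract m (tprod k (A × B) x))).trans ?_
  rw [left_smul_tprod]
  rfl

/-- The composite of `contract` and `expand` acts as (0, 1) on factor 0. After rotation it acts on
factor 1, and there it equals (1, 0) = 1 - (0, 1) on factor 0, the complementary projection. -/
theorem rot_cycExpand_cycContract (m : ℕ) (v : CycPow k (A × B) (OffDiag M N) (2 * m + 1)) :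
    rot k (A × B) _ (2 * m + 1) 1 (cycExpand k A B M N m (cycContract k A B M N m v)) =
      rot k (A × B) _ (2 * m + 1) 1 v -
        cycExpand k A B M N m (cycContract k A B M N m (rot k (A × B) _ (2 * m + 1) 1 v)) := by
  refine LinearMap.congr_fun (f := rot k (A × B) _ (2 * m + 1) 1 ∘ₗ cycExpand k A B M N m ∘ₗ
      cycContract k A B M N m) (g := rot k (A × B) _ (2 * m + 1) 1 -
        cycExpand k A B M N m ∘ₗ cycContract k A B M N m ∘ₗ rot k (A × B) _ (2 * m + 1) 1)
    (cyc_hom_ext fun x => ?_) v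
  simp only [LinearMap.comp_apply, LinearMap.sub_apply]
  rw [cycExpand_cycContract, rot_cycTprod, rot_cycTprod, cycExpand_cycContract, update_sub]
  set x' : Fin (2 * m + 1 + 1) → OffDiag M N := fun i => x (i - 1) with hx'
  have h0 : x 0 = x' (0 + 1) := by simp [hx']
  have h1 : ((1, 0) : A × B) • x' 0 = x' 0 - ((0, 1) : A × B) • x' 0 := by
    have h : ((1, 0) : A × B) = 1 - (0, 1) := by ext <;> simp
    rw [h, sub_smul, one_smul]
  rw [h0, ← cycTprod_rel, op_smul_right_unit, h1, MultilinearMap.map_update_sub,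
    Function.update_eq_self]

theorem isSwap (m : ℕ) : IsSwap (rot k (A × B) (OffDiag M N) (2 * m + 1) 1)
    (rot k B (BimodTensor k B A B M N) m 1) (cycContract k A B M N m) (cycExpand k A B M N m) where
  p_i w := by
    obtain ⟨t, rfl⟩ := Submodule.Quotient.mk_surjective _ w
    exact congrArg (cycMk k B) (contract_expand m t)
  swap := rot_cycExpand_cycContract m
  p_τ_τ_i := cycContract_rot_rot_cycExpand m

end OffDiag

/-! ### The theorem for null-square algebras. -/

theorem exists_pow_eq (m : ℕ) (s : Multiplicative (ZMod (m + 1))) :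
    ∃ r : ℕ, Multiplicative.ofAdd (1 : ZMod (m + 1)) ^ r = s :=
  ⟨(Multiplicative.toAdd s).val, by
    rw [← ofAdd_nsmul, nsmul_one, ZMod.natCast_zmod_val, ofAdd_toAdd]⟩

theorem cyclicRep_generator (k B X : Type*) [Field k] [Ring B] [Algebra k B]
    [AddCommGroup X] [Module k X] [Module B X] [Module Bᵐᵒᵖ X] [IsScalarTower k B X]
    [IsScalarTower k Bᵐᵒᵖ X] [SMulCommClass B Bᵐᵒᵖ X] (m : ℕ) :
    cyclicRep k B X m (Multiplicative.ofAdd (1 : ZMod (m + 1))) = rot k B X m 1 := rfl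

theorem bimodTor_nullSquare_odd (k A B M N : Type u) [Field k] [Ring A] [Algebra k A] [Ring B]
    [Algebra k B]
    [AddCommGroup M] [Module k M] [Module B M] [Module Aᵐᵒᵖ M]
    [IsScalarTower k B M] [IsScalarTower k Aᵐᵒᵖ M] [SMulCommClass B Aᵐᵒᵖ M]
    [AddCommGroup N] [Module k N] [Module A N] [Module Bᵐᵒᵖ N]
    [IsScalarTower k A N] [IsScalarTower k Bᵐᵒᵖ N] [SMulCommClass A Bᵐᵒᵖ N]
    (hM : IsProjectiveBimodule k B A M) (hN : IsProjectiveBimodule k A B N) (m : ℕ) :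
    Nonempty
      (bimodTor k (NullSquare A B M N) (2 * m + 1)
          (K1 k (NullSquare.diag k A B M N))
          (toBimod k (NullSquare A B M N) (NullSquare A B M N) (NullSquare A B M N)) ≃ₗ[k]
        (cyclicRep k B (BimodTensor k B A B M N) m).invariants) := by
  obtain ⟨τ, h⟩ := OffDiag.exists_left hM hN
  obtain ⟨τ', h'⟩ := OffDiag.exists_right hM hN
  -- The index is 2(m + 1), so the number of factors, 2m + 3, is odd.
  have : Subsingleton (CycPow k (A × B) (OffDiag M N) (2 * m + 2)) :=
    OffDiag.subsingleton_cycPow k A B M N (m + 1)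
  obtain ⟨e⟩ := (NullSquare.nullExt k A B M N).bimodTor_odd h h'
    (NullSquare.inC_mem_diag k A B M N) (NullSquare.exists_inC_eq k A B M N) m
  rw [invariants_eq_ker _ _ (exists_pow_eq m), cyclicRep_generator]
  exact ⟨e.trans (OffDiag.isSwap m).kerEquiv⟩

theorem bimodTor_nullSquare_even (k A B M N : Type u) [Field k] [Ring A] [Algebra k A] [Ring B]
    [Algebra k B]
    [AddCommGroup M] [Module k M] [Module B M] [Module Aᵐᵒᵖ M]
    [IsScalarTower k B M] [IsScalarTower k Aᵐᵒᵖ M] [SMulCommClass B Aᵐᵒᵖ M]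
    [AddCommGroup N] [Module k N] [Module A N] [Module Bᵐᵒᵖ N]
    [IsScalarTower k A N] [IsScalarTower k Bᵐᵒᵖ N] [SMulCommClass A Bᵐᵒᵖ N]
    (hM : IsProjectiveBimodule k B A M) (hN : IsProjectiveBimodule k A B N) (m : ℕ) :
    Nonempty
      (bimodTor k (NullSquare A B M N) (2 * m)
          (K1 k (NullSquare.diag k A B M N))
          (toBimod k (NullSquare A B M N) (NullSquare A B M N) (NullSquare A B M N)) ≃ₗ[k]
        (cyclicRep k B (BimodTensor k B A B M N) m).Coinvariants) := by
  obtain ⟨τ, h⟩ := OffDiag.exists_left hM hN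
  obtain ⟨τ', h'⟩ := OffDiag.exists_right hM hN
  have : Subsingleton (CycPow k (A × B) (OffDiag M N) (2 * m)) :=
    OffDiag.subsingleton_cycPow k A B M N m
  obtain ⟨e⟩ := (NullSquare.nullExt k A B M N).bimodTor_even h h'
    (NullSquare.inC_mem_diag k A B M N) (NullSquare.exists_inC_eq k A B M N) m
  exact ⟨(e.trans (OffDiag.isSwap m).cokerEquiv).trans (Submodule.quotEquivOfEq _ _
    ((coinvariants_ker_eq_range _ _ (exists_pow_eq m)).trans
      (by rw [cyclicRep_generator])).symm)⟩

end NullSq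

end

theorem mainTheorem6 (k A B M N : Type u) [Field k] [Ring A] [Algebra k A] [Ring B] [Algebra k B]
    [AddCommGroup M] [Module k M] [Module B M] [Module Aᵐᵒᵖ M]
    [IsScalarTower k B M] [IsScalarTower k Aᵐᵒᵖ M] [SMulCommClass B Aᵐᵒᵖ M]
    [AddCommGroup N] [Module k N] [Module A N] [Module Bᵐᵒᵖ N]
    [IsScalarTower k A N] [IsScalarTower k Bᵐᵒᵖ N] [SMulCommClass A Bᵐᵒᵖ N]
    (hM : IsProjectiveBimodule k B A M) (hN : IsProjectiveBimodule k A B N) (m : ℕ) :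
    Nonempty
      (bimodTor k (NullSquare A B M N) (2 * m + 1)
          (K1 k (NullSquare.diag k A B M N))
          (toBimod k (NullSquare A B M N) (NullSquare A B M N) (NullSquare A B M N)) ≃ₗ[k]
        (cyclicRep k B (BimodTensor k B A B M N) m).invariants) ∧
    Nonempty
      (bimodTor k (NullSquare A B M N) (2 * m)
          (K1 k (NullSquare.diag k A B M N))
          (toBimod k (NullSquare A B M N) (NullSquare A B M N) (NullSquare A B M N)) ≃ₗ[k]
        (cyclicRep k B (BimodTensor k B A B M N) m).Coinvariants) := by
  exact ⟨bimodTor_nullSquare_odd k A B M N hM hN m, bimodTor_nullSquare_even k A B M N hM hN m⟩
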